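/- Let $\mathbb{H}^d$ be the set of vectors of length $d$ each of whose entries is a real number or missing. A point of $\mathbb{H}^d$ is $\Delta$-missing if at most $\Delta$ of its entries are missing. For $x\in\mathbb{H}^d$ and $c\in\mathbb{R}^d$ let $\mathrm{dist}(x,c)=\big(\sum_i |x_i-c_i|^2\big)^{1/2}$, where the sum runs over the specified entries $x_i$ of $x$. A $k$-means clustering of $n$ points $p_1,\dots,p_n\in\mathbb{H}^d$ consists of a partition of the points into $k$ (possibly empty) clusters and of centers $c_1,\dots,c_k\in\mathbb{R}^d$, one for each cluster; its cost is the sum of the squared distances of the points to the centers of their clusters. It is $(1+\epsilon)$-approximate if its cost is at most $1+\epsilon$ times the cost of every $k$-means clustering of the same points. Theorem. There are a randomized algorithm, i.e. one program for a unit-cost real random-access machine that can draw uniformly random integers from a given range $\{0,\dots,m\}$, and an absolute constant $C$, such that the following holds for all integers $n,d,k,\Delta\ge 1$, all real $\epsilon>0$ and all $\Delta$-missing points $p_1,\dots,p_n\in\mathbb{H}^d$. On the input $(n,d,k,\Delta,\epsilon,p_1,\dots,p_n)$ the algorithm always halts within $$2^{\,C\max\left\{\Delta^4k(\log\Delta+k),\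 \frac{\Delta k}{\epsilon}\left(\log\frac1\epsilon+k\right)\right\}}\,d\,n$$ steps, and with probability at least $1/2$ its output is a $(1+\epsilon)$-approximate $k$-means clustering of $p_1,\dots,p_n$ (the cluster of every point and all the centers). -/

import Mathlib

/-! ### Points with missing entries and their `k`-means cost -/

/-- Points of `ℍ^d`: vectors of length `d` whose entries are real numbers or missing (`none`). -/
abbrev MissingPoint (d : ℕ) : Type := Fin d → Option ℝ

namespace MissingPoint

/-- `u` is a `Δ`-missing point: at most `Δ` of its entries are missing. -/
def IsMissing {d : ℕ} (Δ : ℕ) (u : MissingPoint d) : Prop :=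
  (Finset.univ.filter fun i => u i = none).card ≤ Δ

/-- `|a - b|`, with the convention that it is `0` if `a` or `b` is missing. -/
def absDiff : Option ℝ → Option ℝ → ℝ
  | some a, some b => |a - b|
  | _, _ => 0

/-- The distance between `x` and `y` on the coordinate set `I`. -/
noncomputable def distOn {d : ℕ} (I : Finset (Fin d)) (x y : MissingPoint d) : ℝ :=
  Real.sqrt (∑ i ∈ I, absDiff (x i) (y i) ^ 2)

/-- A point of `ℝ^d`, seen as a point of `ℍ^d` without missing entries. -/
def ofReal {d : ℕ} (c : Fin d → ℝ) : MissingPoint d := fun i => some (c i)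

end MissingPoint

/-- The cost of the clustering of the points `P 0, …, P (n-1)` in which the `i`-th point belongs to
the cluster `lab i`, and the `t`-th cluster has the center `c t ∈ ℝ^d`: the sum of the squared
distances of the points to the centers of their clusters. -/
noncomputable def clusteringCost {n d k : ℕ} (P : Fin n → MissingPoint d) (lab : Fin n → Fin k)
    (c : Fin k → Fin d → ℝ) : ℝ :=
  ∑ t : Fin k, ∑ i ∈ Finset.univ.filter (fun i => lab i = t),
    MissingPoint.distOn Finset.univ (P i) (MissingPoint.ofReal (c t)) ^ 2

/-- The clustering `(lab, c)` is a `(1 + ε)`-approximate solution of the `k`-means clustering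
problem for `P`: its cost is at most `1 + ε` times the cost of any clustering into `k` clusters. -/
def IsApproxKMeans {n d k : ℕ} (ε : ℝ) (P : Fin n → MissingPoint d) (lab : Fin n → Fin k)
    (c : Fin k → Fin d → ℝ) : Prop :=
  ∀ (lab' : Fin n → Fin k) (c' : Fin k → Fin d → ℝ),
    clusteringCost P lab c ≤ (1 + ε) * clusteringCost P lab' c'

/-! ### A randomized real random-access machine

The memory consists of integer arrays and real arrays; scalar variables are cells of arrays. There
are comparisons, the ring operations on integers, the field operations on reals, the conversion of
integers to reals (but no rounding of reals to integers, no integer division and no operations on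
bits), indirect addressing, and random integers. A program is one finite piece of syntax and every
elementary command, test or change of control counts one step. As the expressions in a program have
a size that is fixed with the program, this is, up to a constant factor which depends on the program
only, the usual unit-cost measure. -/

namespace RealRAM

/-- The memory: `ints a i` and `reals a i` are the `i`-th cells of the integer array and of
the real array with name `a`. -/
structure Store where
  ints : ℕ → ℕ → ℕ
  reals : ℕ → ℕ → ℝ

/-- Integer expressions. -/
inductive IExp : Type
  | lit (m : ℕ)
  | get (a : ℕ) (i : IExp)
  | add (x y : IExp)
  | sub (x y : IExp)
  | mul (x y : IExp)

/-- Real expressions. -/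
inductive RExp : Type
  | ofInt (e : IExp)
  | get (a : ℕ) (i : IExp)
  | add (x y : RExp)
  | sub (x y : RExp)
  | mul (x y : RExp)
  | div (x y : RExp)

/-- Tests. -/
inductive BExp : Type
  | ltI (x y : IExp)
  | ltR (x y : RExp)
  | not (b : BExp)
  | and (b c : BExp)

/-- The value of an integer expression (subtraction is truncated at `0`). -/
def IExp.eval (s : Store) : IExp → ℕ
  | .lit m => m
  | .get a i => s.ints a (i.eval s)
  | .add x y => x.eval s + y.eval s
  | .sub x y => x.eval s - y.eval s
  | .mul x y => x.eval s * y.eval s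

/-- The value of a real expression. -/
noncomputable def RExp.eval (s : Store) : RExp → ℝ
  | .ofInt e => (e.eval s : ℝ)
  | .get a i => s.reals a (i.eval s)
  | .add x y => x.eval s + y.eval s
  | .sub x y => x.eval s - y.eval s
  | .mul x y => x.eval s * y.eval s
  | .div x y => x.eval s / y.eval s

/-- The truth of a test. -/
def BExp.Holds (s : Store) : BExp → Prop
  | .ltI x y => x.eval s < y.eval s
  | .ltR x y => x.eval s < y.eval s
  | .not b => ¬ b.Holds s
  | .and b c => b.Holds s ∧ c.Holds s

/-- Programs. `rand a i e` writes into the cell `i` of the integer array `a` a fresh uniformly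
random element of `{0, 1, …, e}`. -/
inductive Cmd : Type
  | skip
  | setI (a : ℕ) (i e : IExp)
  | setR (a : ℕ) (i : IExp) (e : RExp)
  | rand (a : ℕ) (i e : IExp)
  | seq (c c' : Cmd)
  | ite (b : BExp) (c c' : Cmd)
  | loop (b : BExp) (c : Cmd)

/-- Write `v` into the cell `i` of the integer array `a`. -/
def Store.writeI (s : Store) (a i v : ℕ) : Store :=
  { s with ints := Function.update s.ints a (Function.update (s.ints a) i v) }

/-- Write `v` into the cell `i` of the real array `a`. -/
def Store.writeR (s : Store) (a i : ℕ) (v : ℝ) : Store :=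
  { s with reals := Function.update s.reals a (Function.update (s.reals a) i v) }

/-- A configuration: the commands that remain to be executed, in this order, and the memory.
The machine has halted if no command remains. -/
abbrev Config : Type := List Cmd × Store

open Classical in
/-- One step of the machine. -/
noncomputable def step : Config → PMF Config
  | ([], s) => PMF.pure ([], s)
  | (.skip :: K, s) => PMF.pure (K, s)
  | (.setI a i e :: K, s) => PMF.pure (K, s.writeI a (i.eval s) (e.eval s))
  | (.setR a i e :: K, s) => PMF.pure (K, s.writeR a (i.eval s) (e.eval s))
  | (.rand a i e :: K, s) =>
      (PMF.uniformOfFintype (Fin (e.eval s + 1))).map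
        fun v => (K, s.writeI a (i.eval s) (v : ℕ))
  | (.seq c c' :: K, s) => PMF.pure (c :: c' :: K, s)
  | (.ite b c c' :: K, s) => PMF.pure (if b.Holds s then c :: K else c' :: K, s)
  | (.loop b c :: K, s) => PMF.pure (if b.Holds s then c :: .loop b c :: K else K, s)

/-- The distribution of the configuration after `t` steps of the program `c` started in `s`. -/
noncomputable def run (c : Cmd) (s : Store) : ℕ → PMF Config
  | 0 => PMF.pure ([c], s)
  | t + 1 => (run c s t).bind step

/-- The program `c`, started in `s`, halts within `t` steps, whatever its random choices are. -/
def HaltsWithin (c : Cmd) (s : Store) (t : ℕ) : Prop :=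
  ∀ x ∈ (run c s t).support, x.1 = []

/-- The memory at the beginning. The integer array `0` holds `n, d, k, Δ` and the real array `0`
holds `ε`. The `j`-th entry of the `i`-th point has the address `j + d * i` in the arrays with
name `1`: the integer array tells whether it is specified (`1`) or missing (`0`), and the real array
holds its value (`0` if it is missing). Everything else is `0`. -/
noncomputable def inputStore {n d : ℕ} (k Δ : ℕ) (ε : ℝ) (P : Fin n → MissingPoint d) : Store where
  ints a m :=
    if a = 0 then [n, d, k, Δ].getD m 0
    else if a = 1 then
      if h : m < n * d then
        (P (finProdFinEquiv.symm ⟨m, h⟩).1 (finProdFinEquiv.symm ⟨m, h⟩).2).elim 0 fun _ => 1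
      else 0
    else 0
  reals a m :=
    if a = 0 then (if m = 0 then ε else 0)
    else if a = 1 then
      if h : m < n * d then
        (P (finProdFinEquiv.symm ⟨m, h⟩).1 (finProdFinEquiv.symm ⟨m, h⟩).2).getD 0
      else 0
    else 0

/-- The memory `s` holds the clustering `(lab, c)` as output: the cell `i` of the integer
array `2` is the index of the cluster of the `i`-th point, and the cell `j + d * t` of the real
array `2` is the `j`-th coordinate of the `t`-th center. -/
def HasOutput {n d k : ℕ} (s : Store) (lab : Fin n → Fin k) (c : Fin k → Fin d → ℝ) : Prop :=
  (∀ i : Fin n, s.ints 2 i = lab i) ∧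
    ∀ (t : Fin k) (j : Fin d), s.reals 2 (j + d * t) = c t j

/-- The halted configurations whose output is a `(1 + ε)`-approximate `k`-means clustering
of `P`. -/
def successSet {n d : ℕ} (k : ℕ) (ε : ℝ) (P : Fin n → MissingPoint d) : Set Config :=
  {x | x.1 = [] ∧ ∃ (lab : Fin n → Fin k) (c : Fin k → Fin d → ℝ),
    HasOutput x.2 lab c ∧ IsApproxKMeans ε P lab c}

end RealRAM

/-! Fix an optimal clustering with labels `l` and centers `c`; it exists since there are finitely
many labelings, and for a fixed one the cost is quadratic in every coordinate of every center. The
algorithm does not know it. It finds centers coordinate by coordinate, in a search tree that is kept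
as a stack. A node holds the active points, partially known centers, a charge for the points already
discarded, and a budget of work. Call an active point finished if the center of its label is known
on all its specified entries.

If at least a fraction `1 / D` of the active points is unfinished, estimation helps. Many of the
unfinished points share one label `t`, and with a probability that is not too small all `m` uniform
samples fall among them. The mean of such samples raises the cost of a coordinate by a factor `1 +
O(1 / m)` only (`sum_tuples_mean_sq_le` and Markov's inequality). While more than `2 Δ` coordinates
of the center are unknown, mode `0` fixes every coordinate that is specified in half of the samples.
Each sample misses at most `Δ` entries, so at most `2 Δ` coordinates remain. After that, a mode `e ≠
0` fixes the `e`-th unknown coordinate alone. Hence `R = k (2 Δ + 1)` good estimations suffice, and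
a good child exists with probability at least `1 / Bp` (`exists_good_draws`). The weights in `Ref`
exceed `1` by just so much that their decrease pays for the errors (`Ref_child_le`).

If fewer points are unfinished, discarding helps. The active points are ordered by the distance to
the nearest available center, and those up to a random pivot are discarded. The few unfinished ones
among them are charged at most the distance `T` of the pivot each, which is paid by the many
finished points that stay active and cost at least `T`. This accounting is the predicate `Lucky`;
over all levels it loses a factor `1 + 1 / m`.

The algorithm cannot see which move is right, so a visit makes both: it pushes the pivoted node and,
above it, the child. A visit spends a budget equal to the number of active points, and in the second
case a pivot leaves on average at most `9 / 10` of them, so `bud - 10 |A|` does not fall on average.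
Thus `value`, a lower bound for the probability of success, does not fall in expectation
(`value_le_sumDraws`). One trial succeeds with probability at least `Q = q ^ R / 2`, and `1 / Q`
trials give `1 / 2`. Luck matters only for finding a cheap solution: by `Safe`, the recorded cost
always bounds the true cost from above, so it is sound to keep the best candidate.

The halting time is bounded for all random choices by `potential`, where a unit of budget weighs
`22` times as much as one at the next depth. The search is analysed by induction on this potential
(`wins_searchCode`), with `Ens` as a Hoare logic with time bounds for the deterministic code and
`Wins` for averages over the random draws. Altogether the cost is at most `1 + 33 / m` times the
optimum, with `m ≥ 33 / ε`, and the time is `(m k Δ) ^ O(m k Δ)` times `d n`. The factor `log k` in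
the exponent is absorbed by `k`, and `log Δ` by one of the two terms of the maximum, according to
whether `1 / ε ≤ Δ`. -/

namespace RealRAM

/-! ### The distribution of the configuration after some steps -/

/-- The distribution of the configuration that is reached from `x` in `t` steps. -/
noncomputable def runFrom : ℕ → Config → PMF Config
  | 0, x => PMF.pure x
  | t + 1, x => (step x).bind (runFrom t)

theorem runFrom_succ' (t : ℕ) (x : Config) : runFrom (t + 1) x = (runFrom t x).bind step := by
  induction t generalizing x with
  | zero => simp [runFrom]
  | succ t ih =>
    rw [runFrom]
    conv_rhs => rw [runFrom, PMF.bind_bind]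
    congr 1
    funext y
    exact ih y

theorem run_eq_runFrom (c : Cmd) (s : Store) (t : ℕ) : run c s t = runFrom t ([c], s) := by
  induction t with
  | zero => rfl
  | succ t ih => rw [runFrom_succ', ← ih, run]

/-- From `x`, the machine halts within `t` steps, and it ends in `S` with probability at
least `p`. -/
def Wins (S : Set Config) (t : ℕ) (p : ℝ) (x : Config) : Prop :=
  (∀ y ∈ (runFrom t x).support, y.1 = []) ∧
    ENNReal.ofReal p ≤ (runFrom t x).toOuterMeasure S

/-- A halted configuration is a fixed point of `step`, so the distribution is stationary once its
whole support has halted. Time bounds may therefore be relaxed freely. -/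
theorem Wins.succ {S : Set Config} {t : ℕ} {p : ℝ} {x : Config} (h : Wins S t p x) :
    Wins S (t + 1) p x := by
  have key : runFrom (t + 1) x = runFrom t x := by
    rw [runFrom_succ']
    conv_rhs => rw [← PMF.bind_pure (runFrom t x)]
    ext y
    rw [PMF.bind_apply, PMF.bind_apply]
    refine tsum_congr fun z => ?_
    by_cases hz : z ∈ (runFrom t x).support
    · obtain ⟨l, s⟩ := z
      have : l = [] := h.1 _ hz
      subst this
      rfl
    · rw [PMF.mem_support_iff, not_not] at hz
      simp [hz]
  unfold Wins
  rw [key]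
  exact h

theorem Wins.mono {S : Set Config} {t t' : ℕ} {p p' : ℝ} {x : Config} (h : Wins S t p x)
    (ht : t ≤ t') (hp : p' ≤ p) : Wins S t' p' x := by
  have h1 : Wins S t' p x := by
    induction t', ht using Nat.le_induction with
    | base => exact h
    | succ n _ ih => exact ih.succ
  exact ⟨h1.1, (ENNReal.ofReal_le_ofReal hp).trans h1.2⟩

theorem Wins.of_step {S : Set Config} {t : ℕ} {p : ℝ} {x y : Config} (hx : step x = PMF.pure y)
    (h : Wins S t p y) : Wins S (t + 1) p x := by
  unfold Wins
  rw [runFrom, hx, PMF.pure_bind]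
  exact h

theorem Wins.halted {S : Set Config} {s : Store} (h : (([] : List Cmd), s) ∈ S) :
    Wins S 0 1 ([], s) := by
  refine ⟨fun y hy => ?_, ?_⟩
  · simp only [runFrom, PMF.support_pure, Set.mem_singleton_iff] at hy
    rw [hy]
  · simp [runFrom, PMF.toOuterMeasure_pure_apply, h]

theorem Wins.halted_zero {S : Set Config} {s : Store} :
    Wins S 0 0 ([], s) := by
  refine ⟨fun y hy => ?_, ?_⟩
  · simp only [runFrom, PMF.support_pure, Set.mem_singleton_iff] at hy
    rw [hy]
  · simp

/-- The law of total probability. The bound `p v` may depend on the drawn number while the time may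
not; this is what allows a submartingale argument under a deterministic time bound. -/
theorem Wins.rand {S : Set Config} {t N : ℕ} {a : ℕ} {i e : IExp} {K : List Cmd} {s : Store}
    {p : ℕ → ℝ} (hN : e.eval s + 1 = N) (hp : ∀ v < N, 0 ≤ p v)
    (h : ∀ v < N, Wins S t (p v) (K, s.writeI a (i.eval s) v)) :
    Wins S (t + 1) ((∑ v ∈ Finset.range N, p v) / N) (.rand a i e :: K, s) := by
  subst hN
  have hrun : runFrom (t + 1) (.rand a i e :: K, s) =
      (PMF.uniformOfFintype (Fin (e.eval s + 1))).bind
        fun v => runFrom t (K, s.writeI a (i.eval s) (v : ℕ)) := by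
    rw [runFrom, step, PMF.bind_map]
    change ((PMF.uniformOfFintype (Fin (e.eval s + 1))).bind fun v => PMF.pure (v : ℕ)).bind _ = _
    rw [PMF.bind_bind]
    simp only [PMF.pure_bind, Function.comp]
  unfold Wins
  rw [hrun]
  refine ⟨fun y hy => ?_, ?_⟩
  · rw [PMF.mem_support_bind_iff] at hy
    obtain ⟨v, _, hv⟩ := hy
    exact (h v v.2).1 y hv
  · rw [PMF.toOuterMeasure_bind_apply, tsum_fintype, Finset.sum_range, div_eq_inv_mul,
      Finset.mul_sum]
    rw [ENNReal.ofReal_sum_of_nonneg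
      (fun (v : Fin (e.eval s + 1)) _ => mul_nonneg (by positivity) (hp v v.2))]
    refine Finset.sum_le_sum fun v _ => ?_
    rw [ENNReal.ofReal_mul (by positivity), PMF.uniformOfFintype_apply, Fintype.card_fin]
    refine mul_le_mul' ?_ (h v v.2).2
    rw [ENNReal.ofReal_inv_of_pos (by positivity), ENNReal.ofReal_natCast]

/-! ### Deterministic executions -/

/-- `Exec c s t s'`: the program `c`, which draws no random numbers on this way, leads from `s`
to `s'` in `t` steps. -/
inductive Exec : Cmd → Store → ℕ → Store → Prop
  | skip (s : Store) : Exec .skip s 1 s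
  | setI (a : ℕ) (i e : IExp) (s : Store) :
      Exec (.setI a i e) s 1 (s.writeI a (i.eval s) (e.eval s))
  | setR (a : ℕ) (i : IExp) (e : RExp) (s : Store) :
      Exec (.setR a i e) s 1 (s.writeR a (i.eval s) (e.eval s))
  | seq {c c' : Cmd} {s s₁ s₂ : Store} {t t' : ℕ} (h : Exec c s t s₁) (h' : Exec c' s₁ t' s₂) :
      Exec (.seq c c') s (t' + t + 1) s₂
  | iteT {b : BExp} {c c' : Cmd} {s s' : Store} {t : ℕ} (hb : b.Holds s) (h : Exec c s t s') :
      Exec (.ite b c c') s (t + 1) s'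
  | iteF {b : BExp} {c c' : Cmd} {s s' : Store} {t : ℕ} (hb : ¬ b.Holds s) (h : Exec c' s t s') :
      Exec (.ite b c c') s (t + 1) s'
  | loopF {b : BExp} {c : Cmd} {s : Store} (hb : ¬ b.Holds s) : Exec (.loop b c) s 1 s
  | loopT {b : BExp} {c : Cmd} {s s₁ s₂ : Store} {t t' : ℕ} (hb : b.Holds s)
      (h : Exec c s t s₁) (h' : Exec (.loop b c) s₁ t' s₂) : Exec (.loop b c) s (t' + t + 1) s₂

/-- A deterministic prefix costs time but no probability. Through this lemma all facts about code
without random draws enter the analysis of `Wins`. -/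
theorem Exec.wins {S : Set Config} {c : Cmd} {s s' : Store} {t : ℕ} (h : Exec c s t s') :
    ∀ {K : List Cmd} {τ : ℕ} {p : ℝ}, Wins S τ p (K, s') → Wins S (τ + t) p (c :: K, s) := by
  induction h with
  | skip s => exact fun h => h.of_step rfl
  | setI a i e s => exact fun h => h.of_step rfl
  | setR a i e s => exact fun h => h.of_step rfl
  | seq _ _ ih ih' =>
    intro K τ p h
    have := ih (ih' h)
    exact (this.of_step (x := (.seq _ _ :: K, _)) rfl).mono (by omega) le_rfl
  | iteT hb _ ih =>
    intro K τ p h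
    refine ((ih h).of_step ?_).mono (by omega) le_rfl
    simp [step, hb]
  | iteF hb _ ih =>
    intro K τ p h
    refine ((ih h).of_step ?_).mono (by omega) le_rfl
    simp [step, hb]
  | loopF hb =>
    intro K τ p h
    refine h.of_step ?_
    simp [step, hb]
  | loopT hb _ _ ih ih' =>
    intro K τ p h
    refine ((ih (ih' h)).of_step ?_).mono (by omega) le_rfl
    simp [step, hb]

/-- The program `c` does not write into the integer array `a`. -/
def Cmd.KeepsI (a : ℕ) : Cmd → Prop
  | .skip => True
  | .setI b _ _ => b ≠ a
  | .setR _ _ _ => True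
  | .rand b _ _ => b ≠ a
  | .seq c c' => c.KeepsI a ∧ c'.KeepsI a
  | .ite _ c c' => c.KeepsI a ∧ c'.KeepsI a
  | .loop _ c => c.KeepsI a

/-- The program `c` does not write into the real array `a`. -/
def Cmd.KeepsR (a : ℕ) : Cmd → Prop
  | .skip => True
  | .setI _ _ _ => True
  | .setR b _ _ => b ≠ a
  | .rand _ _ _ => True
  | .seq c c' => c.KeepsR a ∧ c'.KeepsR a
  | .ite _ c c' => c.KeepsR a ∧ c'.KeepsR a
  | .loop _ c => c.KeepsR a

/-- Every array that `c` does not write into is the same in `s` and `s'`. -/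
def Keeps (c : Cmd) (s s' : Store) : Prop :=
  (∀ a, c.KeepsI a → s'.ints a = s.ints a) ∧ ∀ a, c.KeepsR a → s'.reals a = s.reals a

theorem Keeps.refl (c : Cmd) (s : Store) : Keeps c s s := ⟨fun _ _ => rfl, fun _ _ => rfl⟩

theorem Keeps.trans {c : Cmd} {s s' s'' : Store} (h : Keeps c s s') (h' : Keeps c s' s'') :
    Keeps c s s'' :=
  ⟨fun a ha => (h'.1 a ha).trans (h.1 a ha), fun a ha => (h'.2 a ha).trans (h.2 a ha)⟩

/-- The frame rule of the logic: whether an array is preserved is a decidable syntactic property of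
the program, so such side conditions are settled by `decide`. -/
theorem Exec.keeps {c : Cmd} {s s' : Store} {t : ℕ} (h : Exec c s t s') : Keeps c s s' := by
  induction h with
  | skip s => exact Keeps.refl _ _
  | setI a i e s =>
    exact ⟨fun b hb => Function.update_of_ne (Ne.symm hb) _ _, fun _ _ => rfl⟩
  | setR a i e s =>
    exact ⟨fun _ _ => rfl, fun b hb => Function.update_of_ne (Ne.symm hb) _ _⟩
  | seq _ _ ih ih' =>
    exact ⟨fun a ha => (ih'.1 a ha.2).trans (ih.1 a ha.1),
      fun a ha => (ih'.2 a ha.2).trans (ih.2 a ha.1)⟩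
  | iteT _ _ ih => exact ⟨fun a ha => ih.1 a ha.1, fun a ha => ih.2 a ha.1⟩
  | iteF _ _ ih => exact ⟨fun a ha => ih.1 a ha.2, fun a ha => ih.2 a ha.2⟩
  | loopF _ => exact Keeps.refl _ _
  | loopT _ _ _ ih ih' =>
    exact ⟨fun a ha => (ih'.1 a ha).trans (ih.1 a ha),
      fun a ha => (ih'.2 a ha).trans (ih.2 a ha)⟩

/-- Started in `s`, the program `c` arrives deterministically and within `τ` steps at a memory
with the property `P`. -/
def Ens (c : Cmd) (s : Store) (τ : ℕ) (P : Store → Prop) : Prop :=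
  ∃ t ≤ τ, ∃ s', Exec c s t s' ∧ P s'

theorem Ens.keeps {c : Cmd} {s : Store} {τ : ℕ} {P : Store → Prop} (h : Ens c s τ P) :
    Ens c s τ fun s' => P s' ∧ Keeps c s s' := by
  obtain ⟨t, ht, s', he, hP⟩ := h
  exact ⟨t, ht, s', he, hP, he.keeps⟩

theorem Ens.mono {c : Cmd} {s : Store} {τ τ' : ℕ} {P P' : Store → Prop} (h : Ens c s τ P)
    (hτ : τ ≤ τ') (hP : ∀ s', P s' → P' s') : Ens c s τ' P' := by
  obtain ⟨t, ht, s', he, hs⟩ := h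
  exact ⟨t, ht.trans hτ, s', he, hP _ hs⟩

/-- The consequence rule, with the information which arrays are kept. -/
theorem Ens.conseq {c : Cmd} {s : Store} {τ τ' : ℕ} {P P' : Store → Prop} (h : Ens c s τ P)
    (hτ : τ ≤ τ') (hP : ∀ s', Keeps c s s' → P s' → P' s') : Ens c s τ' P' :=
  h.keeps.mono hτ fun s' hs => hP s' hs.2 hs.1

theorem Ens.skip {s : Store} {P : Store → Prop} (h : P s) : Ens .skip s 1 P :=
  ⟨1, le_rfl, s, .skip s, h⟩

theorem Ens.setI {s : Store} {P : Store → Prop} {a : ℕ} {i e : IExp}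
    (h : P (s.writeI a (i.eval s) (e.eval s))) : Ens (.setI a i e) s 1 P :=
  ⟨1, le_rfl, _, .setI a i e s, h⟩

theorem Ens.setR {s : Store} {P : Store → Prop} {a : ℕ} {i : IExp} {e : RExp}
    (h : P (s.writeR a (i.eval s) (e.eval s))) : Ens (.setR a i e) s 1 P :=
  ⟨1, le_rfl, _, .setR a i e s, h⟩

theorem Ens.seq {c c' : Cmd} {s : Store} {τ τ' : ℕ} {P : Store → Prop}
    (h : Ens c s τ fun s₁ => Ens c' s₁ τ' P) : Ens (.seq c c') s (τ + τ' + 1) P := by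
  obtain ⟨t, ht, s₁, he, t', ht', s₂, he', hP⟩ := h
  exact ⟨t' + t + 1, by omega, s₂, .seq he he', hP⟩

theorem Ens.ite {b : BExp} {c c' : Cmd} {s : Store} {τ : ℕ} {P : Store → Prop}
    (h : b.Holds s → Ens c s τ P) (h' : ¬ b.Holds s → Ens c' s τ P) :
    Ens (.ite b c c') s (τ + 1) P := by
  by_cases hb : b.Holds s
  · obtain ⟨t, ht, s', he, hP⟩ := h hb
    exact ⟨t + 1, by omega, s', .iteT hb he, hP⟩
  · obtain ⟨t, ht, s', he, hP⟩ := h' hb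
    exact ⟨t + 1, by omega, s', .iteF hb he, hP⟩

/-- The loop rule: the number of remaining passes is bounded by `N - j`. -/
theorem Ens.loop {b : BExp} {c : Cmd} {τ N : ℕ} {P : Store → Prop} (Inv : ℕ → Store → Prop)
    (hb : ∀ j s, Inv j s → b.Holds s → j < N)
    (hstep : ∀ j s, Inv j s → b.Holds s → Ens c s τ (Inv (j + 1)))
    (hend : ∀ j s, Inv j s → ¬ b.Holds s → P s)
    {j : ℕ} {s : Store} (h0 : Inv j s) : Ens (.loop b c) s ((N - j) * (τ + 1) + 1) P := by
  obtain ⟨r, hr⟩ : ∃ r, r = N - j := ⟨_, rfl⟩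
  induction r generalizing j s with
  | zero =>
    have hs : ¬ b.Holds s := fun h => by have := hb j s h0 h; omega
    exact ⟨1, by omega, s, .loopF hs, hend j s h0 hs⟩
  | succ r ih =>
    by_cases hs : b.Holds s
    · obtain ⟨t, ht, s₁, he, hI⟩ := hstep j s h0 hs
      obtain ⟨t', ht', s₂, he', hP⟩ := ih hI (by omega)
      refine ⟨t' + t + 1, ?_, s₂, .loopT hs he he', hP⟩
      have : N - j = (N - (j + 1)) + 1 := by have := hb j s h0 hs; omega
      rw [this, add_mul]
      omega
    · exact ⟨1, by omega, s, .loopF hs, hend j s h0 hs⟩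

/-! ### Abbreviations for programs -/

/-- The scalar integer variable with name `a`. -/
abbrev iv (a : ℕ) : IExp := .get a (.lit 0)

/-- The scalar real variable with name `a`. -/
abbrev rv (a : ℕ) : RExp := .get a (.lit 0)

/-- Assignment to a scalar integer variable. -/
abbrev setIv (a : ℕ) (e : IExp) : Cmd := .setI a (.lit 0) e

/-- Assignment to a scalar real variable. -/
abbrev setRv (a : ℕ) (e : RExp) : Cmd := .setR a (.lit 0) e

/-- `for a = 0, …, N - 1 do c`. -/
def forTo (a : ℕ) (N : IExp) (c : Cmd) : Cmd :=
  .seq (setIv a (.lit 0)) (.loop (.ltI (iv a) N) (.seq c (setIv a (.add (iv a) (.lit 1)))))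

/-- The rule for `for` loops. In the step and at the end, all arrays that are not written into by
the loop are as in the beginning. -/
theorem Ens.forTo {a : ℕ} {N : IExp} {c : Cmd} {s : Store} {τ M : ℕ} {P : Store → Prop}
    (Inv : ℕ → Store → Prop)
    (hc : c.KeepsI a)
    (hN : ∀ s', Keeps (RealRAM.forTo a N c) s s' → N.eval s' = M)
    (h0 : Inv 0 (s.writeI a 0 0))
    (hstep : ∀ j s', j < M → Keeps (RealRAM.forTo a N c) s s' → s'.ints a 0 = j → Inv j s' →
      Ens c s' τ fun s'' => Inv (j + 1) (s''.writeI a 0 (j + 1)))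
    (hend : ∀ s', Keeps (RealRAM.forTo a N c) s s' → Inv M s' → P s') :
    Ens (RealRAM.forTo a N c) s (M * (τ + 3) + 3) P := by
  have hkeep0 : Keeps (RealRAM.forTo a N c) s (s.writeI a 0 0) :=
    ⟨fun b hb => Function.update_of_ne (Ne.symm hb.1) _ _, fun _ _ => rfl⟩
  -- A pass costs the test, the sequencing, the body and the increment, hence `τ + 3`. The remaining
  -- `3` steps are the initialization, its sequencing and the last test.
  have hloop : Ens (.loop (.ltI (iv a) N) (.seq c (setIv a (.add (iv a) (.lit 1)))))
      (s.writeI a 0 0) ((M - 0) * ((τ + 1 + 1) + 1) + 1) P := by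
    refine Ens.loop (N := M) (fun j s' => s'.ints a 0 = j ∧ j ≤ M ∧
      Keeps (RealRAM.forTo a N c) s s' ∧ Inv j s') ?_ ?_ ?_ (j := 0)
      ⟨by simp [Store.writeI], Nat.zero_le _, hkeep0, h0⟩
    · rintro j s' ⟨hj, _, hk, _⟩ hb
      simpa [BExp.Holds, IExp.eval, hj, hN s' hk] using hb
    · rintro j s' ⟨hj, hjM, hk, hI⟩ hb
      have hlt : j < M := by simpa [BExp.Holds, IExp.eval, hj, hN s' hk] using hb
      refine Ens.seq ((hstep j s' hlt hk hj hI).conseq le_rfl fun s'' hk' hI' => Ens.setI ?_)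
      have hja : s''.ints a 0 = j := by rw [hk'.1 a hc, hj]
      have he : IExp.eval s'' ((iv a).add (.lit 1)) = j + 1 := by simp [IExp.eval, hja]
      rw [he]
      refine ⟨by simp [Store.writeI, IExp.eval], hlt, hk.trans ⟨fun b hb => ?_, fun b hb => ?_⟩, hI'⟩
      · rw [← hk'.1 b hb.2.1]
        exact Function.update_of_ne (Ne.symm hb.1) _ _
      · exact hk'.2 b hb.2.1
    · rintro j s' ⟨hj, hjM, hk, hI⟩ hb
      have : ¬ j < M := by simpa [BExp.Holds, IExp.eval, hj, hN s' hk] using hb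
      obtain rfl : j = M := by omega
      exact hend s' hk hI
  refine (Ens.seq (Ens.setI (P := fun s₁ => Ens _ s₁ _ P) hloop)).mono ?_ fun _ h => h
  simp only [Nat.sub_zero]
  have : M * (τ + 1 + 1 + 1) = M * (τ + 3) := rfl
  omega

end RealRAM

namespace MissingKMeans

open Finset

/-! ### Sums over lists and tuples -/

theorem sum_range_getD (L : List ℕ) (f : ℕ → ℝ) :
    ∑ p ∈ range L.length, f (L.getD p 0) = (L.map f).sum := by
  induction L with
  | nil => simp
  | cons a L ih =>
    rw [List.length_cons, Finset.sum_range_succ']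
    simp only [List.getD_cons_succ, List.getD_cons_zero, List.map_cons, List.sum_cons]
    rw [ih, add_comm]

theorem sum_filter_range (a : ℕ) (q : ℕ → Prop) [DecidablePred q] (f : ℕ → ℝ) :
    (((List.range a).filter fun p => decide (q p)).map f).sum
      = ∑ p ∈ (range a).filter q, f p := by
  induction a with
  | zero => simp
  | succ a ih =>
    rw [List.range_succ, List.filter_append, List.map_append, List.sum_append, ih,
      Finset.range_add_one, Finset.filter_insert]
    by_cases h : q a
    · rw [if_pos h, Finset.sum_insert (by simp), add_comm]
      simp [h]
    · simp [h]

theorem length_filter_range (a : ℕ) (q : ℕ → Prop) [DecidablePred q] :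
    ((List.range a).filter fun p => decide (q p)).length = ((range a).filter q).card := by
  induction a with
  | zero => simp
  | succ a ih =>
    rw [List.range_succ, List.filter_append, List.length_append, ih,
      Finset.range_add_one, Finset.filter_insert]
    by_cases h : q a
    · rw [if_pos h, Finset.card_insert_of_notMem (by simp)]
      simp [h]
    · simp [h]

/-- The tuples of length `m` with entries in `Q`. -/
abbrev tuples (Q : Finset ℕ) (m : ℕ) : Finset (Fin m → ℕ) := Fintype.piFinset fun _ => Q

/-- Splitting off the first entry is the induction step both for the moments of a sample and for the
loop that draws the samples one after the other. -/
theorem sum_tuples_succ {M : Type*} [AddCommMonoid M] (Q : Finset ℕ) (m : ℕ)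
    (f : (Fin (m + 1) → ℕ) → M) :
    ∑ g ∈ tuples Q (m + 1), f g = ∑ v ∈ Q, ∑ g ∈ tuples Q m, f (Fin.cons v g) := by
  rw [← Finset.sum_product']
  refine Finset.sum_bij' (fun g _ => (g 0, Fin.tail g)) (fun x _ => Fin.cons x.1 x.2) ?_ ?_ ?_ ?_ ?_
  · intro g hg
    rw [Fintype.mem_piFinset] at hg
    simp only [Finset.mem_product, Fintype.mem_piFinset]
    exact ⟨hg 0, fun j => hg j.succ⟩
  · rintro ⟨v, g⟩ hg
    simp only [Finset.mem_product, Fintype.mem_piFinset] at hg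
    rw [Fintype.mem_piFinset]
    intro j
    refine Fin.cases ?_ (fun j => ?_) j
    · simpa using hg.1
    · simpa using hg.2 j
  · intro g _
    exact Fin.cons_self_tail g
  · rintro ⟨v, g⟩ _
    simp
  · intro g _
    simp [Fin.cons_self_tail]

theorem card_tuples (Q : Finset ℕ) (m : ℕ) : (tuples Q m).card = Q.card ^ m := by
  simp [tuples, Fintype.card_piFinset]

theorem sum_tuples_sum_eq_zero (Q : Finset ℕ) (w : ℕ → ℝ) (hw : ∑ p ∈ Q, w p = 0) (m : ℕ) :
    ∑ g ∈ tuples Q m, ∑ j, w (g j) = 0 := by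
  induction m with
  | zero => simp
  | succ m ih =>
    rw [sum_tuples_succ]
    simp only [Fin.sum_univ_succ, Fin.cons_zero, Fin.cons_succ, Finset.sum_add_distrib, ih]
    rw [Finset.sum_comm]
    simp [hw]

/-- The second moment of the sum of independent samples with mean zero. -/
theorem card_mul_sum_tuples_sq (Q : Finset ℕ) (w : ℕ → ℝ) (hw : ∑ p ∈ Q, w p = 0) (m : ℕ) :
    (Q.card : ℝ) * ∑ g ∈ tuples Q m, (∑ j, w (g j)) ^ 2
      = m * (Q.card : ℝ) ^ m * ∑ p ∈ Q, w p ^ 2 := by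
  induction m with
  | zero => simp
  | succ m ih =>
    rw [sum_tuples_succ]
    have h1 : ∀ v : ℕ, ∑ g ∈ tuples Q m, (∑ j, w ((Fin.cons v g : Fin (m + 1) → ℕ) j)) ^ 2
        = (Q.card : ℝ) ^ m * w v ^ 2 + ∑ g ∈ tuples Q m, (∑ j, w (g j)) ^ 2 := by
      intro v
      -- The cross term is `2 * w v` times a sum that vanishes because `w` has mean zero.
      simp only [Fin.sum_univ_succ, Fin.cons_zero, Fin.cons_succ, add_sq,
        Finset.sum_add_distrib, ← Finset.mul_sum, sum_tuples_sum_eq_zero Q w hw m]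
      simp
    simp only [h1, Finset.sum_add_distrib, ← Finset.mul_sum, Finset.sum_const, nsmul_eq_mul]
    rw [mul_add, ih]
    push_cast
    ring

/-- A finite form of Markov's inequality. -/
theorem card_le_two_mul_card_filter {α : Type*} (T : Finset α) (f : α → ℝ)
    (hf : ∀ g ∈ T, 0 ≤ f g) {b : ℝ} (hb : 0 ≤ b) (h : ∑ g ∈ T, f g ≤ T.card * b) :
    T.card ≤ 2 * (T.filter fun g => f g ≤ 2 * b).card := by
  classical
  have hsplit := Finset.card_filter_add_card_filter_not (s := T) (fun g => f g ≤ 2 * b)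
  set N := (T.filter fun g => ¬ f g ≤ 2 * b).card with hN
  suffices hh : 2 * N ≤ T.card by omega
  have h1 : (N : ℝ) * (2 * b) ≤ ∑ g ∈ T.filter (fun g => ¬ f g ≤ 2 * b), f g := by
    rw [hN, ← nsmul_eq_mul]
    exact Finset.card_nsmul_le_sum _ _ _ fun g hg => (not_le.1 (Finset.mem_filter.1 hg).2).le
  have h2 : ∑ g ∈ T.filter (fun g => ¬ f g ≤ 2 * b), f g ≤ ∑ g ∈ T, f g :=
    Finset.sum_le_sum_of_subset_of_nonneg (Finset.filter_subset _ _) fun g hg _ => hf g hg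
  -- For `b = 0` the hypothesis forces `f` to vanish on `T`, and no element exceeds the bound.
  rcases hb.eq_or_lt with rfl | hb
  · have : N = 0 := by
      rw [hN, Finset.card_eq_zero, Finset.filter_eq_empty_iff]
      intro g hg
      have : f g ≤ ∑ g ∈ T, f g := Finset.single_le_sum hf hg
      rw [not_not]
      simp only [mul_zero] at h ⊢
      linarith
    omega
  · have : (N : ℝ) * (2 * b) ≤ T.card * b := h1.trans (h2.trans h)
    have : (2 * N : ℝ) ≤ T.card := by
      by_contra hcon
      nlinarith
    exact_mod_cast this

/-- The sum of squared differences decomposes at the mean. -/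
theorem sum_sq_sub {ι : Type*} (Q : Finset ι) (y : ι → ℝ) (v : ℝ) :
    ∑ p ∈ Q, (y p - v) ^ 2 = ∑ p ∈ Q, (y p - (∑ p ∈ Q, y p) / Q.card) ^ 2
      + Q.card * (v - (∑ p ∈ Q, y p) / Q.card) ^ 2 := by
  rcases Q.eq_empty_or_nonempty with rfl | hQ
  · simp
  have hc : (Q.card : ℝ) ≠ 0 := by exact_mod_cast hQ.card_pos.ne'
  set μ := (∑ p ∈ Q, y p) / Q.card with hμ
  have hs : ∑ p ∈ Q, y p = Q.card * μ := by rw [hμ]; field_simp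
  have : ∀ p, (y p - v) ^ 2 = (y p - μ) ^ 2 + ((v - μ) ^ 2 + -2 * (v - μ) * (y p - μ)) := by
    intro p; ring
  simp only [this, Finset.sum_add_distrib, ← Finset.mul_sum, Finset.sum_sub_distrib, hs,
    Finset.sum_const, nsmul_eq_mul]
  ring

/-- In a finite set of `N` points with distinct keys, the points of rank between `lo` and `hi`
number `hi - lo + 1`. -/
theorem card_filter_rank {ι α : Type*} [LinearOrder α] (S : Finset ι) (key : ι → α)
    (hinj : Set.InjOn key S) {lo hi : ℕ} (hlo : 1 ≤ lo) (hhi : hi ≤ S.card) :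
    (S.filter fun z => lo ≤ (S.filter fun p => key p ≤ key z).card ∧
      (S.filter fun p => key p ≤ key z).card ≤ hi).card = hi + 1 - lo := by
  classical
  set rk : ι → ℕ := fun z => (S.filter fun p => key p ≤ key z).card with hrk
  have hlt : ∀ z ∈ S, ∀ z' ∈ S, key z < key z' → rk z < rk z' := by
    intro z _ z' hz' h
    refine Finset.card_lt_card ⟨fun p hp => ?_, fun hsub => ?_⟩
    · simp only [Finset.mem_filter] at hp ⊢
      exact ⟨hp.1, hp.2.trans h.le⟩
    · have := hsub (Finset.mem_filter.2 ⟨hz', le_rfl⟩)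
      exact absurd (Finset.mem_filter.1 this).2 (not_le.2 h)
  have hinj' : Set.InjOn rk S := by
    intro z hz z' hz' h
    by_contra hne
    have : key z ≠ key z' := fun hk => hne (hinj hz hz' hk)
    rcases lt_or_gt_of_ne this with h' | h'
    · exact absurd h (hlt z hz z' hz' h').ne
    · exact absurd h (hlt z' hz' z hz h').ne'
  -- The rank is injective with values between `1` and `S.card`, hence takes each of them exactly
  -- once.
  have himg : S.image rk = Finset.Icc 1 S.card := by
    refine Finset.eq_of_subset_of_card_le (fun j hj => ?_) ?_
    · obtain ⟨z, hz, rfl⟩ := Finset.mem_image.1 hj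
      rw [Finset.mem_Icc]
      exact ⟨Finset.card_pos.2 ⟨z, Finset.mem_filter.2 ⟨hz, le_rfl⟩⟩,
        Finset.card_le_card (Finset.filter_subset _ _)⟩
    · rw [Finset.card_image_of_injOn hinj', Nat.card_Icc]
      omega
  have h2 : (S.filter fun z => lo ≤ rk z ∧ rk z ≤ hi).image rk = Finset.Icc lo hi := by
    ext j
    simp only [Finset.mem_image, Finset.mem_filter, Finset.mem_Icc]
    constructor
    · rintro ⟨z, ⟨_, h⟩, rfl⟩
      exact h
    · intro h
      have : j ∈ S.image rk := by
        rw [himg, Finset.mem_Icc]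
        omega
      obtain ⟨z, hz, rfl⟩ := Finset.mem_image.1 this
      exact ⟨z, ⟨hz, h⟩, rfl⟩
  rw [← Finset.card_image_of_injOn (f := rk)
    (hinj'.mono fun z hz => (Finset.mem_filter.1 hz).1), h2, Nat.card_Icc]

end MissingKMeans

namespace MissingKMeans

open Finset

/-! ### Instances, partial centers and the abstract algorithm -/

/-- An instance: `n` points in dimension `d`, `k` clusters, at most `Δ` missing entries, and the
number `m` of samples from which a center is estimated. -/
structure Inst where
  (n d k Δ m : ℕ)
  pt : ℕ → ℕ → Option ℝ

/-- Partially known centers. A known coordinate is never changed again. -/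
abbrev Centers : Type := ℕ → ℕ → Option ℝ

/-- The squared difference, `0` if one of the entries is missing. -/
noncomputable def sqd : Option ℝ → Option ℝ → ℝ
  | some a, some b => (a - b) ^ 2
  | _, _ => 0

theorem sqd_nonneg (o o' : Option ℝ) : 0 ≤ sqd o o' := by
  cases o <;> cases o' <;> simp [sqd, sq_nonneg]

/-- A node of the search tree: the list `A` of active points, the partial centers `u`, the cost
`acc` of the points that are not active any more, the work `bud` that may still be spent, and its
initial value `b0`. -/
structure Frame where
  A : List ℕ
  u : Centers
  acc : ℝ
  bud : ℕ
  b0 : ℕ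

/-- The active point at the position `p`. -/
def Frame.act (F : Frame) (p : ℕ) : ℕ := F.A.getD p 0

namespace Inst

variable (I : Inst)

/-- The maximal depth of the search tree. -/
def R : ℕ := I.k * (2 * I.Δ + 1)

/-- The inverse of the fraction of unfinished points that is tolerated. -/
def D : ℕ := 32 * I.m * (I.R + 2)

/-- The inverse of a lower bound of the probability that a node has a good child. -/
def Bp : ℕ := 2 * I.k * (2 * I.Δ + 1) * (2 * I.Δ * I.k * I.D) ^ I.m

/-- The squared distance of the point `x` to the `t`-th center. -/
noncomputable def dist (u : Centers) (t x : ℕ) : ℝ := ∑ i ∈ range I.d, sqd (I.pt x i) (u t i)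

/-- The `t`-th center is known on all specified entries of `x`. -/
def Avail (u : Centers) (t x : ℕ) : Prop := ∀ i < I.d, I.pt x i ≠ none → u t i ≠ none

open Classical in
/-- The nearest center among the first ones that are available for `x`. -/
noncomputable def near (u : Centers) (x : ℕ) : ℕ → Option ℕ
  | 0 => none
  | t + 1 => if I.Avail u t x ∧ ∀ t', near u x t = some t' → I.dist u t x < I.dist u t' x
      then some t else near u x t

/-- The squared distance of `x` to the nearest available center. -/
noncomputable def dv (u : Centers) (x : ℕ) : ℝ := (I.near u x I.k).elim 0 fun t => I.dist u t x

/-- Some center is available for `x`. -/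
def Has (u : Centers) (x : ℕ) : Prop := I.near u x I.k ≠ none

/-- The position `p` is not above the pivot position `z` in the order by the distance to the
nearest available center. -/
def Low (F : Frame) (z p : ℕ) : Prop :=
  I.Has F.u (F.act p) ∧ (I.dv F.u (F.act p) < I.dv F.u (F.act z) ∨
    I.dv F.u (F.act p) = I.dv F.u (F.act z) ∧ p ≤ z)

open Classical in
/-- The positions above the pivot. -/
noncomputable def up (F : Frame) (z : ℕ) : List ℕ :=
  (List.range F.A.length).filter fun p => ¬ I.Low F z p

/-- The pivot splits the active points evenly enough. -/
def Accept (F : Frame) (z : ℕ) : Prop :=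
  I.Has F.u (F.act z) ∧ F.A.length ≤ 4 * (I.up F z).length ∧
    4 * (I.up F z).length ≤ 3 * F.A.length

open Classical in
/-- Remove the points that are not above the pivot. -/
noncomputable def pivot (F : Frame) (z : ℕ) : Frame :=
  if I.Accept F z then
    { A := (I.up F z).map F.act
      u := F.u
      acc := F.acc + ∑ p ∈ (range F.A.length).filter (I.Low F z), I.dv F.u (F.act p)
      bud := F.bud - F.A.length
      b0 := F.b0 }
  else { F with bud := F.bud - F.A.length }

open Classical in
/-- The number of samples in which the coordinate `i` is specified. -/
noncomputable def cnt (F : Frame) (g : Fin I.m → ℕ) (i : ℕ) : ℕ :=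
  (univ.filter fun j => I.pt (F.act (g j)) i ≠ none).card

/-- The sum of the specified entries of the samples in the coordinate `i`. -/
noncomputable def tot (F : Frame) (g : Fin I.m → ℕ) (i : ℕ) : ℝ :=
  ∑ j, (I.pt (F.act (g j)) i).getD 0

open Classical in
/-- The number of unknown coordinates up to `i`. -/
noncomputable def pos (u : Centers) (t i : ℕ) : ℕ :=
  ((range (i + 1)).filter fun i' => u t i' = none).card

/-- The coordinate `i` of the `t`-th center is estimated from the samples `g` in the mode `e`. -/
def Fix (F : Frame) (t e : ℕ) (g : Fin I.m → ℕ) (i : ℕ) : Prop :=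
  F.u t i = none ∧ ((e = 0 ∧ I.m ≤ 2 * I.cnt F g i) ∨
    (e ≠ 0 ∧ e = pos F.u t i ∧ 1 ≤ I.cnt F g i))

open Classical in
/-- The centers after the estimation. -/
noncomputable def freeze (F : Frame) (t e : ℕ) (g : Fin I.m → ℕ) : Centers := fun b i =>
  if b = t ∧ I.Fix F t e g i then some (I.tot F g i / I.cnt F g i) else F.u b i

/-- The child of a node. -/
noncomputable def child (F : Frame) (t e : ℕ) (g : Fin I.m → ℕ) : Frame where
  A := F.A
  u := I.freeze F t e g
  acc := F.acc
  bud := 20 * F.A.length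
  b0 := 20 * F.A.length

/-! ### Nearest available centers -/

theorem dist_nonneg (u : Centers) (t x : ℕ) : 0 ≤ I.dist u t x :=
  Finset.sum_nonneg fun _ _ => sqd_nonneg _ _

theorem near_none {u : Centers} {x K : ℕ} (h : I.near u x K = none) :
    ∀ t < K, ¬ I.Avail u t x := by
  induction K with
  | zero => simp
  | succ K ih =>
    rw [near] at h
    split_ifs at h with hc
    intro t ht hA
    rcases Nat.lt_succ_iff_lt_or_eq.1 ht with h' | rfl
    · exact ih h t h' hA
    · exact hc ⟨hA, fun t' ht' => by rw [h] at ht'; simp at ht'⟩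

theorem near_some {u : Centers} {x K t : ℕ} (h : I.near u x K = some t) :
    t < K ∧ I.Avail u t x ∧ ∀ t' < K, I.Avail u t' x → I.dist u t x ≤ I.dist u t' x := by
  induction K generalizing t with
  | zero => simp [near] at h
  | succ K ih =>
    rw [near] at h
    split_ifs at h with hc
    · obtain rfl : K = t := by simpa using h
      refine ⟨Nat.lt_succ_self _, hc.1, fun t' ht' hA => ?_⟩
      rcases Nat.lt_succ_iff_lt_or_eq.1 ht' with h' | rfl
      · cases hn : I.near u x K with
        | none => exact absurd hA (I.near_none hn t' h')
        | some t₀ => exact (hc.2 t₀ hn).le.trans ((ih hn).2.2 t' h' hA)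
      · exact le_rfl
    · obtain ⟨h1, h2, h3⟩ := ih h
      refine ⟨h1.trans (Nat.lt_succ_self _), h2, fun t' ht' hA => ?_⟩
      rcases Nat.lt_succ_iff_lt_or_eq.1 ht' with h' | rfl
      · exact h3 t' h' hA
      · by_contra hlt
        exact hc ⟨hA, fun t₀ ht₀ => by
          rw [h] at ht₀
          obtain rfl : t = t₀ := by simpa using ht₀
          exact not_le.1 hlt⟩

theorem dv_nonneg (u : Centers) (x : ℕ) : 0 ≤ I.dv u x := by
  unfold dv
  cases I.near u x I.k with
  | none => exact le_rfl
  | some t => exact I.dist_nonneg u t x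

theorem has_of_avail {u : Centers} {t x : ℕ} (ht : t < I.k) (h : I.Avail u t x) : I.Has u x :=
  fun hn => I.near_none hn t ht h

theorem dv_le_of_avail {u : Centers} {t x : ℕ} (ht : t < I.k) (h : I.Avail u t x) :
    I.dv u x ≤ I.dist u t x := by
  unfold dv
  cases hn : I.near u x I.k with
  | none => exact absurd h (I.near_none hn t ht)
  | some t₀ => exact (I.near_some hn).2.2 t ht h

/-! ### The potential -/

variable (l : ℕ → ℕ) (c : ℕ → ℕ → ℝ)

/-- The unknown coordinates of the `t`-th center. -/
noncomputable def unk (u : Centers) (t : ℕ) : Finset ℕ := (range I.d).filter fun i => u t i = none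

open Classical in
/-- The weight of the unknown coordinates. -/
noncomputable def wt (u : Centers) (t : ℕ) : ℝ :=
  if (I.unk u t).card ≤ 2 * I.Δ then 1 + 8 / I.m else 1 + 16 / I.m

/-- The weighted cost of an entry if the center `c t` is used for the unknown coordinates. -/
noncomputable def term (u : Centers) (t x i : ℕ) : ℝ :=
  match I.pt x i with
  | none => 0
  | some y => match u t i with
    | some v => (y - v) ^ 2
    | none => I.wt u t * (y - c t i) ^ 2

/-- The weighted cost of a point. -/
noncomputable def refp (u : Centers) (x : ℕ) : ℝ := ∑ i ∈ range I.d, I.term c u (l x) x i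

/-- The weighted cost of the active points. -/
noncomputable def Ref (F : Frame) : ℝ := ∑ p ∈ range F.A.length, I.refp l c F.u (F.act p)

/-- The number of good estimations that are missing. -/
noncomputable def rank (u : Centers) : ℕ := ∑ t ∈ range I.k, min (2 * I.Δ + 1) (I.unk u t).card

open Classical in
/-- The positions whose center is not yet known on all their entries. -/
noncomputable def unfin (F : Frame) : Finset ℕ :=
  (range F.A.length).filter fun p => ¬ I.Avail F.u (l (F.act p)) (F.act p)

theorem wt_pos (u : Centers) (t : ℕ) : 0 < I.wt u t := by
  unfold wt
  split_ifs <;> positivity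

theorem term_nonneg (u : Centers) (t x i : ℕ) : 0 ≤ I.term c u t x i := by
  unfold term
  cases I.pt x i with
  | none => exact le_rfl
  | some y =>
    cases u t i with
    | none => exact mul_nonneg (I.wt_pos u t).le (sq_nonneg _)
    | some v => exact sq_nonneg _

theorem refp_nonneg (u : Centers) (x : ℕ) : 0 ≤ I.refp l c u x :=
  Finset.sum_nonneg fun _ _ => I.term_nonneg c _ _ _ _

/-- For a finished point no specified entry meets an unknown coordinate, so neither the weights nor
the reference centers enter its weighted cost. -/
theorem refp_eq_dist {u : Centers} {x : ℕ} (h : I.Avail u (l x) x) :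
    I.refp l c u x = I.dist u (l x) x := by
  refine Finset.sum_congr rfl fun i hi => ?_
  have := h i (Finset.mem_range.1 hi)
  unfold term
  cases hp : I.pt x i with
  | none => cases u (l x) i <;> rfl
  | some y =>
    cases hu : u (l x) i with
    | none => exact absurd hu (this (by simp [hp]))
    | some v => rfl

theorem dv_le_refp {u : Centers} {x : ℕ} (hl : l x < I.k) (h : I.Avail u (l x) x) :
    I.dv u x ≤ I.refp l c u x :=
  (I.dv_le_of_avail hl h).trans (I.refp_eq_dist l c h).ge

end Inst

end MissingKMeans

namespace MissingKMeans

open Finset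

/-! ### Estimation of a center from samples -/

open Classical in
/-- The mean of the specified values among `m` samples from `Q` is a good estimate of the mean of
the specified values in `Q`, if at least half of the samples are specified. -/
theorem sum_tuples_mean_sq_le (Q : Finset ℕ) (o : ℕ → Option ℝ) {m : ℕ} (hm : 0 < m) {μ : ℝ}
    (hμ : μ = (∑ p ∈ Q.filter (fun p => o p ≠ none), (o p).getD 0)
      / (Q.filter fun p => o p ≠ none).card) :
    ∑ g ∈ tuples Q m, (if m ≤ 2 * (univ.filter fun j => o (g j) ≠ none).card then
        ((Q.filter fun p => o p ≠ none).card : ℝ) * ((∑ j, (o (g j)).getD 0)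
          / (univ.filter fun j => o (g j) ≠ none).card - μ) ^ 2 else 0)
      ≤ (tuples Q m).card *
        (4 / m * ∑ p ∈ Q.filter (fun p => o p ≠ none), ((o p).getD 0 - μ) ^ 2) := by
  -- Missing entries count as `0` after centering. Then `w` has mean zero on all of `Q`, and the
  -- random number of specified samples causes no trouble: the sum of `w` is this number times the
  -- error of the estimate.
  set w : ℕ → ℝ := fun p => if o p ≠ none then (o p).getD 0 - μ else 0 with hw
  set n₀ : ℝ := ((Q.filter fun p => o p ≠ none).card : ℝ) with hn₀
  set V : ℝ := ∑ p ∈ Q.filter (fun p => o p ≠ none), ((o p).getD 0 - μ) ^ 2 with hV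
  have hmR : (0 : ℝ) < m := by exact_mod_cast hm
  have hw0 : ∑ p ∈ Q, w p = 0 := by
    rw [hw, ← Finset.sum_filter, Finset.sum_sub_distrib, Finset.sum_const, nsmul_eq_mul, ← hn₀]
    rcases eq_or_ne n₀ 0 with h | h
    · have : Q.filter (fun p => o p ≠ none) = ∅ := by
        rw [← Finset.card_eq_zero]
        exact Nat.cast_eq_zero.1 (hn₀ ▸ h)
      simp [this, h]
    · rw [hμ]
      field_simp
      ring
  have hw2 : ∑ p ∈ Q, w p ^ 2 = V := by
    rw [hV, Finset.sum_filter]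
    refine Finset.sum_congr rfl fun p _ => ?_
    rw [hw]
    dsimp only
    split_ifs <;> simp
  have hmom := card_mul_sum_tuples_sq Q w hw0 m
  rw [hw2] at hmom
  have hterm : ∀ g ∈ tuples Q m, (if m ≤ 2 * (univ.filter fun j => o (g j) ≠ none).card then
        n₀ * ((∑ j, (o (g j)).getD 0)
          / (univ.filter fun j => o (g j) ≠ none).card - μ) ^ 2 else 0)
      ≤ n₀ * (4 / m ^ 2) * (∑ j, w (g j)) ^ 2 := by
    intro g _
    have hn : 0 ≤ n₀ := Nat.cast_nonneg _
    split_ifs with hc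
    · set S := (univ.filter fun j => o (g j) ≠ none).card with hS
      have hSm : (m : ℝ) ≤ 2 * S := by exact_mod_cast hc
      have hS0 : (0 : ℝ) < S := by linarith
      have h1 : ∑ j, w (g j) = (∑ j, (o (g j)).getD 0) - S * μ := by
        have : ∀ j, w (g j) = (o (g j)).getD 0 - (if o (g j) ≠ none then μ else 0) := by
          intro j
          rw [hw]
          dsimp only
          split_ifs with h
          · rfl
          · rw [not_not] at h
            simp [h]
        simp only [this, Finset.sum_sub_distrib, ← Finset.sum_filter, Finset.sum_const,
          nsmul_eq_mul, hS]
      have h2 : (∑ j, (o (g j)).getD 0) / S - μ = (∑ j, w (g j)) / S := by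
        rw [h1]
        field_simp
      rw [h2, mul_assoc]
      refine mul_le_mul_of_nonneg_left ?_ hn
      rw [div_pow, div_mul_eq_mul_div, div_le_div_iff₀ (by positivity) (by positivity)]
      -- As half of the samples are specified, dividing by `S` instead of `m` costs at most the
      -- factor `4`.
      have : (m : ℝ) ^ 2 ≤ 4 * S ^ 2 := by nlinarith
      nlinarith [sq_nonneg (∑ j, w (g j))]
    · positivity
  refine (Finset.sum_le_sum hterm).trans ?_
  rw [← Finset.mul_sum, card_tuples]
  -- Enlarging `n₀` to `Q.card` produces the left-hand side of the identity for the second moment.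
  have hle : n₀ ≤ Q.card := by
    rw [hn₀]
    exact_mod_cast Finset.card_le_card (Finset.filter_subset _ _)
  have hnn : 0 ≤ ∑ g ∈ tuples Q m, (∑ j, w (g j)) ^ 2 := Finset.sum_nonneg fun _ _ => sq_nonneg _
  calc n₀ * (4 / m ^ 2) * ∑ g ∈ tuples Q m, (∑ j, w (g j)) ^ 2
      = 4 / m ^ 2 * (n₀ * ∑ g ∈ tuples Q m, (∑ j, w (g j)) ^ 2) := by ring
    _ ≤ 4 / m ^ 2 * (Q.card * ∑ g ∈ tuples Q m, (∑ j, w (g j)) ^ 2) := by gcongr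
    _ = _ := by
      rw [hmom]
      push_cast
      field_simp

namespace Inst

variable (I : Inst) (l : ℕ → ℕ) (c : ℕ → ℕ → ℝ)

theorem freeze_of_ne {F : Frame} {t e : ℕ} {g : Fin I.m → ℕ} {t' : ℕ} (h : t' ≠ t) :
    I.freeze F t e g t' = F.u t' := by
  funext i
  simp [freeze, h]

theorem freeze_of_fix {F : Frame} {t e : ℕ} {g : Fin I.m → ℕ} {i : ℕ} (h : I.Fix F t e g i) :
    I.freeze F t e g t i = some (I.tot F g i / I.cnt F g i) := by
  simp [freeze, h]

theorem freeze_of_not_fix {F : Frame} {t e : ℕ} {g : Fin I.m → ℕ} {i : ℕ}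
    (h : ¬ I.Fix F t e g i) : I.freeze F t e g t i = F.u t i := by
  simp [freeze, h]

theorem unk_freeze_of_ne {F : Frame} {t e : ℕ} {g : Fin I.m → ℕ} {t' : ℕ} (h : t' ≠ t) :
    I.unk (I.freeze F t e g) t' = I.unk F.u t' := by
  unfold unk
  rw [I.freeze_of_ne h]

theorem mem_unk {u : Centers} {t i : ℕ} : i ∈ I.unk u t ↔ i < I.d ∧ u t i = none := by
  simp [unk]

theorem mem_unk_freeze {F : Frame} {t e : ℕ} {g : Fin I.m → ℕ} {i : ℕ} :
    i ∈ I.unk (I.freeze F t e g) t ↔ i ∈ I.unk F.u t ∧ ¬ I.Fix F t e g i := by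
  rw [mem_unk, mem_unk]
  by_cases h : I.Fix F t e g i
  · simp [I.freeze_of_fix h, h]
  · simp [I.freeze_of_not_fix h, h]

theorem term_freeze_of_ne {F : Frame} {t e : ℕ} {g : Fin I.m → ℕ} {t' x i : ℕ} (h : t' ≠ t) :
    I.term c (I.freeze F t e g) t' x i = I.term c F.u t' x i := by
  unfold term wt
  rw [I.unk_freeze_of_ne h, I.freeze_of_ne h]

open Classical in
/-- The positions with label `t` at which the coordinate `i` is specified. -/
noncomputable def spos (F : Frame) (t i : ℕ) : Finset ℕ :=
  (range F.A.length).filter fun p => l (F.act p) = t ∧ I.pt (F.act p) i ≠ none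

/-- The value at the position `p` in the coordinate `i`. -/
noncomputable def val (F : Frame) (i p : ℕ) : ℝ := (I.pt (F.act p) i).getD 0

/-- The mean of the values in the coordinate `i` at the positions with label `t`. -/
noncomputable def mean (F : Frame) (t i : ℕ) : ℝ :=
  (∑ p ∈ I.spos l F t i, I.val F i p) / (I.spos l F t i).card

/-- The error of an estimation, summed over the coordinates in `U`. -/
noncomputable def err (F : Frame) (t : ℕ) (U : Finset ℕ) (g : Fin I.m → ℕ) : ℝ :=
  ∑ i ∈ U, if I.m ≤ 2 * I.cnt F g i then
    ((I.spos l F t i).card : ℝ) * (I.tot F g i / I.cnt F g i - I.mean l F t i) ^ 2 else 0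

theorem err_nonneg (F : Frame) (t : ℕ) (U : Finset ℕ) (g : Fin I.m → ℕ) :
    0 ≤ I.err l F t U g := by
  refine Finset.sum_nonneg fun i _ => ?_
  split_ifs <;> positivity

/-- The cost of the positions with label `t` at their means, summed over the coordinates
in `U`. -/
noncomputable def var (F : Frame) (t : ℕ) (U : Finset ℕ) : ℝ :=
  ∑ i ∈ U, ∑ p ∈ I.spos l F t i, (I.val F i p - I.mean l F t i) ^ 2

theorem sum_term_of_known {F : Frame} {u : Centers} {t i : ℕ} {v : ℝ} (hu : u t i = some v) :
    ∑ p ∈ range F.A.length, (if l (F.act p) = t then I.term c u t (F.act p) i else 0)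
      = ∑ p ∈ I.spos l F t i, (I.val F i p - v) ^ 2 := by
  unfold spos
  rw [Finset.sum_filter]
  refine Finset.sum_congr rfl fun p _ => ?_
  unfold term val
  cases hp : I.pt (F.act p) i <;> simp [hu]

theorem sum_term_of_unknown {F : Frame} {u : Centers} {t i : ℕ} (hu : u t i = none) :
    ∑ p ∈ range F.A.length, (if l (F.act p) = t then I.term c u t (F.act p) i else 0)
      = I.wt u t * ∑ p ∈ I.spos l F t i, (I.val F i p - c t i) ^ 2 := by
  unfold spos
  rw [Finset.sum_filter, Finset.mul_sum]
  refine Finset.sum_congr rfl fun p _ => ?_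
  unfold term val
  cases hp : I.pt (F.act p) i <;> simp [hu]

theorem var_le_cost (F : Frame) (t i : ℕ) (v : ℝ) :
    ∑ p ∈ I.spos l F t i, (I.val F i p - I.mean l F t i) ^ 2
      ≤ ∑ p ∈ I.spos l F t i, (I.val F i p - v) ^ 2 := by
  rw [sum_sq_sub _ _ v]
  have : 0 ≤ ((I.spos l F t i).card : ℝ) *
    (v - (∑ p ∈ I.spos l F t i, I.val F i p) / (I.spos l F t i).card) ^ 2 := by positivity
  unfold mean
  linarith

/-- If the error of the estimation is small, the weighted cost does not grow. -/
theorem Ref_child_le {F : Frame} {t e : ℕ} {g : Fin I.m → ℕ} {U : Finset ℕ}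
    (hU : U ⊆ I.unk F.u t) (hfix : ∀ i, i < I.d → I.Fix F t e g i → i ∈ U ∧ I.m ≤ 2 * I.cnt F g i)
    (herr : I.err l F t U g ≤ 8 / I.m * I.var l F t U)
    (hcase : (2 * I.Δ < (I.unk F.u t).card ∧ (I.unk (I.freeze F t e g) t).card ≤ 2 * I.Δ) ∨
      ((I.unk F.u t).card ≤ 2 * I.Δ ∧ ∀ i ∈ U, I.Fix F t e g i)) :
    I.Ref l c (I.child F t e g) ≤ I.Ref l c F := by
  classical
  set u' := I.freeze F t e g with hu'
  have hmn : (0 : ℝ) ≤ 8 / I.m := by positivity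
  set C : ℕ → ℝ := fun i => ∑ p ∈ I.spos l F t i, (I.val F i p - c t i) ^ 2 with hC
  set V : ℕ → ℝ := fun i => ∑ p ∈ I.spos l F t i, (I.val F i p - I.mean l F t i) ^ 2 with hV
  set ex : ℕ → ℝ := fun i => if I.m ≤ 2 * I.cnt F g i then
    ((I.spos l F t i).card : ℝ) * (I.tot F g i / I.cnt F g i - I.mean l F t i) ^ 2 else 0 with hex
  have hC0 : ∀ i, 0 ≤ C i := fun i => Finset.sum_nonneg fun _ _ => sq_nonneg _
  have hVC : ∀ i, V i ≤ C i := fun i => I.var_le_cost l F t i (c t i)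
  have hex0 : ∀ i, 0 ≤ ex i := by
    intro i
    rw [hex]
    dsimp only
    split_ifs <;> positivity
  have hwt : I.wt u' t ≤ 1 + 8 / I.m := by
    have : (I.unk u' t).card ≤ 2 * I.Δ := by
      rcases hcase with h | h
      · exact h.2
      · refine le_trans (Finset.card_le_card fun i hi => ?_) h.1
        exact (I.mem_unk_freeze.1 hi).1
    rw [wt, if_pos this]
  set τ : Centers → ℕ → ℝ := fun u i =>
    ∑ p ∈ range F.A.length, (if l (F.act p) = t then I.term c u t (F.act p) i else 0) with hτ
  -- The balance of one coordinate: a coordinate in `U` releases at least `8 / m` times its variance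
  -- by the decrease of its weight, and may spend its error. Summed over `U`, the hypothesis on the
  -- error closes the balance.
  have hτ' : ∀ i ∈ range I.d, τ u' i ≤ τ F.u i + ((if i ∈ U then ex i else 0)
      - (if i ∈ U then 8 / I.m * V i else 0)) := by
    intro i hi
    rw [Finset.mem_range] at hi
    by_cases hf : I.Fix F t e g i
    · obtain ⟨hiU, hcnt⟩ := hfix i hi hf
      have h1 : τ u' i = V i + ex i := by
        rw [hτ]
        dsimp only
        rw [I.sum_term_of_known l c (I.freeze_of_fix hf), sum_sq_sub, hex]
        dsimp only
        rw [if_pos hcnt]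
        rfl
      have h2 : τ F.u i = I.wt F.u t * C i := I.sum_term_of_unknown l c hf.1
      have h3 : 1 + 8 / I.m ≤ I.wt F.u t := by
        unfold wt
        split_ifs
        · exact le_rfl
        · gcongr
          norm_num
      rw [h1, h2, if_pos hiU, if_pos hiU]
      have h4 := mul_le_mul_of_nonneg_right h3 (hC0 i)
      have h5 := mul_le_mul_of_nonneg_left (hVC i) hmn
      linarith [hVC i]
    · have hsame : u' t i = F.u t i := I.freeze_of_not_fix hf
      by_cases hn : F.u t i = none
      · have h1 : τ u' i = I.wt u' t * C i := I.sum_term_of_unknown l c (hsame.trans hn)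
        have h2 : τ F.u i = I.wt F.u t * C i := I.sum_term_of_unknown l c hn
        -- In the first case the weight drops from `1 + 16 / m` to `1 + 8 / m` for the whole center,
        -- so even the coordinates that stay unknown release enough. In the second case no
        -- coordinate of `U` stays unknown.
        rcases hcase with h | h
        · have h3 : I.wt F.u t = 1 + 16 / I.m := by
            rw [wt, if_neg (not_le.2 h.1)]
          have h4 := mul_le_mul_of_nonneg_right hwt (hC0 i)
          have h5 := mul_le_mul_of_nonneg_left (hVC i) hmn
          have h6 : (16 : ℝ) / I.m = 8 / I.m + 8 / I.m := by ring
          rw [h1, h2, h3, h6]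
          have h7 := mul_nonneg hmn (hC0 i)
          have h8 := hex0 i
          split_ifs <;> nlinarith
        · have hiU : i ∉ U := fun hiU => hf (h.2 i hiU)
          have h3 : I.wt F.u t = 1 + 8 / I.m := by rw [wt, if_pos h.1]
          rw [h1, h2, h3, if_neg hiU, if_neg hiU]
          have h4 := mul_le_mul_of_nonneg_right hwt (hC0 i)
          linarith
      · obtain ⟨v, hv⟩ := Option.ne_none_iff_exists'.1 hn
        have hiU : i ∉ U := fun hiU => hn (I.mem_unk.1 (hU hiU)).2
        have h1 : τ u' i = τ F.u i := by
          rw [hτ]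
          dsimp only
          rw [I.sum_term_of_known l c (hsame.trans hv), I.sum_term_of_known l c hv]
        rw [h1, if_neg hiU, if_neg hiU]
        simp
  -- The terms of the other labels do not change, so only the coordinate sums `τ` have to be
  -- compared.
  have hsplit : ∀ u : Centers, (∀ t' ≠ t, ∀ x i, I.term c u t' x i = I.term c F.u t' x i) →
      ∑ p ∈ range F.A.length, I.refp l c u (F.act p) = ∑ i ∈ range I.d, τ u i +
        ∑ p ∈ range F.A.length, ∑ i ∈ range I.d,
          (if l (F.act p) = t then 0 else I.term c F.u (l (F.act p)) (F.act p) i) := by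
    intro u hu
    have : ∑ i ∈ range I.d, τ u i = ∑ p ∈ range F.A.length, ∑ i ∈ range I.d,
        (if l (F.act p) = t then I.term c u t (F.act p) i else 0) := Finset.sum_comm
    rw [this, ← Finset.sum_add_distrib]
    refine Finset.sum_congr rfl fun p _ => ?_
    rw [refp, ← Finset.sum_add_distrib]
    refine Finset.sum_congr rfl fun i _ => ?_
    split_ifs with h
    · rw [h, add_zero]
    · rw [hu _ h, zero_add]
  have hA : I.Ref l c (I.child F t e g)
      = ∑ p ∈ range F.A.length, I.refp l c u' (F.act p) := rfl
  rw [hA, Ref, hsplit u' fun t' ht' x i => I.term_freeze_of_ne c ht', hsplit F.u fun _ _ _ _ => rfl]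
  refine add_le_add ?_ le_rfl
  refine (Finset.sum_le_sum hτ').trans ?_
  rw [Finset.sum_add_distrib, Finset.sum_sub_distrib]
  have hUd : (range I.d).filter (· ∈ U) = U := by
    ext i
    simp only [Finset.mem_filter, Finset.mem_range]
    exact ⟨fun h => h.2, fun h => ⟨(I.mem_unk.1 (hU h)).1, h⟩⟩
  have hif : ∀ f : ℕ → ℝ, ∑ i ∈ range I.d, (if i ∈ U then f i else 0) = ∑ i ∈ U, f i := by
    intro f
    rw [← Finset.sum_filter, hUd]
  rw [hif, hif, ← Finset.mul_sum]
  have herr' : ∑ i ∈ U, ex i ≤ 8 / I.m * ∑ i ∈ U, V i := herr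
  linarith

end Inst

end MissingKMeans

/-! ### Existence of many good draws -/

namespace MissingKMeans

open Finset

/-- The pigeonhole principle. It selects a label shared by many unfinished points, and later an
unknown coordinate that many of these points specify. -/
theorem exists_card_le_mul_fiber {α : Type*} (S : Finset α) (f : α → ℕ) (T : Finset ℕ)
    (hf : ∀ x ∈ S, f x ∈ T) (hS : S.Nonempty) :
    ∃ t ∈ T, S.card ≤ T.card * (S.filter fun x => f x = t).card := by
  classical
  by_contra! hcon
  have hT : T.Nonempty := ⟨_, hf _ hS.choose_spec⟩
  have h1 := Finset.card_eq_sum_card_fiberwise (s := S) (t := T) (f := f) hf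
  have h2 : ∑ t ∈ T, T.card * (S.filter fun x => f x = t).card < ∑ t ∈ T, S.card :=
    Finset.sum_lt_sum_of_nonempty hT hcon
  rw [← Finset.mul_sum, ← h1, Finset.sum_const, smul_eq_mul] at h2
  exact lt_irrefl _ h2

namespace Inst

variable (I : Inst) (l : ℕ → ℕ) (c : ℕ → ℕ → ℝ)

theorem pos_lt_pos {u : Centers} {t i i' : ℕ} (hi' : u t i' = none) (h : i < i') :
    pos u t i < pos u t i' := by
  classical
  unfold pos
  refine Finset.card_lt_card ⟨fun j hj => ?_, fun hsub => ?_⟩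
  · simp only [Finset.mem_filter, Finset.mem_range] at hj ⊢
    exact ⟨by omega, hj.2⟩
  · have := hsub (Finset.mem_filter.2 ⟨Finset.mem_range.2 (Nat.lt_succ_self i'), hi'⟩)
    simp only [Finset.mem_filter, Finset.mem_range] at this
    omega

/-- Each unknown coordinate raises the count, so a mode `e ≠ 0` addresses at most one of them. The
count includes `i` itself and starts at `1`, which leaves `0` free for the other mode. -/
theorem pos_inj {u : Centers} {t i i' : ℕ} (hi : u t i = none) (hi' : u t i' = none)
    (h : pos u t i = pos u t i') : i = i' := by
  rcases lt_trichotomy i i' with h' | h' | h'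
  · exact absurd h (pos_lt_pos hi' h').ne
  · exact h'
  · exact absurd h (pos_lt_pos hi h').ne'

theorem one_le_pos {u : Centers} {t i : ℕ} (hi : u t i = none) : 1 ≤ pos u t i := by
  classical
  exact Finset.card_pos.2 ⟨i, by simp [hi]⟩

theorem pos_le_card_unk {u : Centers} {t i : ℕ} (hi : i < I.d) :
    pos u t i ≤ (I.unk u t).card := by
  classical
  refine Finset.card_le_card fun j hj => ?_
  simp only [Finset.mem_filter, Finset.mem_range] at hj
  rw [mem_unk]
  exact ⟨by omega, hj.2⟩

theorem rank_freeze_lt {F : Frame} {t e : ℕ} {g : Fin I.m → ℕ} (ht : t < I.k)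
    (h : min (2 * I.Δ + 1) (I.unk (I.freeze F t e g) t).card + 1
      ≤ min (2 * I.Δ + 1) (I.unk F.u t).card) :
    I.rank (I.freeze F t e g) + 1 ≤ I.rank F.u := by
  unfold rank
  have ht' : t ∈ range I.k := Finset.mem_range.2 ht
  rw [← Finset.add_sum_erase _ _ ht', ← Finset.add_sum_erase (range I.k)
    (fun t => min (2 * I.Δ + 1) (I.unk F.u t).card) ht']
  have : ∑ x ∈ (range I.k).erase t, min (2 * I.Δ + 1) (I.unk (I.freeze F t e g) x).card
      = ∑ x ∈ (range I.k).erase t, min (2 * I.Δ + 1) (I.unk F.u x).card :=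
    Finset.sum_congr rfl fun x hx => by rw [I.unk_freeze_of_ne (Finset.ne_of_mem_erase hx)]
  rw [this]
  omega

/-- In the mode `0`, at most `2 Δ` coordinates remain unknown. -/
theorem card_unk_freeze_le {F : Frame} {t : ℕ} {g : Fin I.m → ℕ} (hm : 0 < I.m)
    (hmiss : ∀ x, ((range I.d).filter fun i => I.pt x i = none).card ≤ I.Δ) :
    (I.unk (I.freeze F t 0 g) t).card ≤ 2 * I.Δ := by
  classical
  set N := I.unk (I.freeze F t 0 g) t with hN
  -- Double counting of missing entries: a coordinate that stays unknown is missing in at least half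
  -- of the samples, while each sample misses at most `Δ` coordinates.
  have h1 : ∀ i ∈ N, I.m ≤ 2 * (univ.filter fun j => I.pt (F.act (g j)) i = none).card := by
    intro i hi
    obtain ⟨hi1, hi2⟩ := I.mem_unk_freeze.1 hi
    have h2 : ¬ I.m ≤ 2 * I.cnt F g i := fun h => hi2 ⟨(I.mem_unk.1 hi1).2, Or.inl ⟨rfl, h⟩⟩
    have h3 := Finset.card_filter_add_card_filter_not (s := (univ : Finset (Fin I.m)))
      (fun j => I.pt (F.act (g j)) i = none)
    rw [Finset.card_univ, Fintype.card_fin] at h3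
    have h4 : I.cnt F g i = (univ.filter fun j => ¬ I.pt (F.act (g j)) i = none).card := by
      unfold cnt
      congr
    omega
  have h2 : N.card * I.m ≤ ∑ i ∈ N, 2 * (univ.filter fun j => I.pt (F.act (g j)) i = none).card := by
    rw [← smul_eq_mul]
    exact Finset.card_nsmul_le_sum _ _ _ h1
  have h3 : ∑ i ∈ N, (univ.filter fun j => I.pt (F.act (g j)) i = none).card
      = ∑ j : Fin I.m, (N.filter fun i => I.pt (F.act (g j)) i = none).card := by
    simp only [Finset.card_filter]
    exact Finset.sum_comm
  have h4 : ∑ j : Fin I.m, (N.filter fun i => I.pt (F.act (g j)) i = none).card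
      ≤ ∑ _j : Fin I.m, I.Δ := by
    refine Finset.sum_le_sum fun j _ => le_trans (Finset.card_le_card fun i hi => ?_)
      (hmiss (F.act (g j)))
    simp only [Finset.mem_filter, Finset.mem_range] at hi ⊢
    exact ⟨(I.mem_unk.1 (I.mem_unk_freeze.1 hi.1).1).1, hi.2⟩
  rw [Finset.sum_const, Finset.card_univ, Fintype.card_fin, smul_eq_mul] at h4
  rw [← Finset.mul_sum, h3] at h2
  have : N.card * I.m ≤ 2 * I.Δ * I.m := by nlinarith
  exact Nat.le_of_mul_le_mul_right this hm

/-- Most tuples of samples have a small error. -/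
theorem card_tuples_le_err {F : Frame} {t : ℕ} {U Q : Finset ℕ} (hm : 0 < I.m)
    (hQ : ∀ i ∈ U, I.spos l F t i = Q.filter fun p => I.pt (F.act p) i ≠ none) :
    (tuples Q I.m).card ≤ 2 * ((tuples Q I.m).filter fun g =>
      I.err l F t U g ≤ 8 / I.m * I.var l F t U).card := by
  classical
  have h := card_le_two_mul_card_filter (tuples Q I.m) (I.err l F t U)
    (fun g _ => I.err_nonneg l F t U g) (b := 4 / I.m * I.var l F t U)
    (mul_nonneg (by positivity) (Finset.sum_nonneg fun _ _ => Finset.sum_nonneg fun _ _ =>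
      sq_nonneg _)) ?_
  · have h8 : (8 : ℝ) / I.m * I.var l F t U = 2 * (4 / I.m * I.var l F t U) := by ring
    rw [h8]
    convert h
  · unfold err var
    rw [Finset.sum_comm, Finset.mul_sum, Finset.mul_sum]
    refine Finset.sum_le_sum fun i hi => ?_
    have := sum_tuples_mean_sq_le Q (fun p => I.pt (F.act p) i) hm (μ := I.mean l F t i) (by
      unfold mean val
      rw [hQ i hi])
    unfold val cnt tot
    rw [hQ i hi]
    exact this

/-- If there are many unfinished points, then a good part of all draws leads to a child that is
as good and has less unknown coordinates. -/
theorem exists_good_draws {F : Frame} (hm : 0 < I.m) (hΔ : 1 ≤ I.Δ) (hl : ∀ x, l x < I.k)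
    (hmiss : ∀ x, ((range I.d).filter fun i => I.pt x i = none).card ≤ I.Δ)
    (hne : (I.unfin l F).Nonempty) (hX : F.A.length ≤ I.D * (I.unfin l F).card) :
    ∃ t < I.k, ∃ e < 2 * I.Δ + 1, ∃ G ⊆ tuples (range F.A.length) I.m,
      F.A.length ^ I.m ≤ 2 * (2 * I.Δ * I.k * I.D) ^ I.m * G.card ∧
      ∀ g ∈ G, I.Ref l c (I.child F t e g) ≤ I.Ref l c F ∧
        I.rank (I.child F t e g).u + 1 ≤ I.rank F.u := by
  classical
  obtain ⟨t, ht, hcard⟩ := exists_card_le_mul_fiber (I.unfin l F) (fun p => l (F.act p)) (range I.k)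
    (fun p _ => Finset.mem_range.2 (hl _)) hne
  rw [Finset.mem_range] at ht
  rw [Finset.card_range] at hcard
  set Xt := (I.unfin l F).filter fun p => l (F.act p) = t with hXt
  have hXtne : Xt.Nonempty := by
    rw [← Finset.card_pos]
    have := hne.card_pos
    by_contra h0
    have : Xt.card = 0 := by omega
    rw [this] at hcard
    omega
  have hmem : ∀ p, p ∈ Xt ↔ (p < F.A.length ∧ ¬ I.Avail F.u (l (F.act p)) (F.act p)) ∧
      l (F.act p) = t := by
    intro p
    rw [hXt, Finset.mem_filter, unfin, Finset.mem_filter, Finset.mem_range]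
  -- the common part of the two cases
  have main : ∀ (Q U : Finset ℕ) (e : ℕ), Q ⊆ Xt → Xt.card ≤ 2 * I.Δ * Q.card →
      U ⊆ I.unk F.u t → (∀ i ∈ U, I.spos l F t i = Q.filter fun p => I.pt (F.act p) i ≠ none) →
      e < 2 * I.Δ + 1 →
      (∀ g ∈ tuples Q I.m, (∀ i, i < I.d → I.Fix F t e g i → i ∈ U ∧ I.m ≤ 2 * I.cnt F g i) ∧
        min (2 * I.Δ + 1) (I.unk (I.freeze F t e g) t).card + 1
          ≤ min (2 * I.Δ + 1) (I.unk F.u t).card ∧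
        ((2 * I.Δ < (I.unk F.u t).card ∧ (I.unk (I.freeze F t e g) t).card ≤ 2 * I.Δ) ∨
          ((I.unk F.u t).card ≤ 2 * I.Δ ∧ ∀ i ∈ U, I.Fix F t e g i))) →
      ∃ t < I.k, ∃ e < 2 * I.Δ + 1, ∃ G ⊆ tuples (range F.A.length) I.m,
        F.A.length ^ I.m ≤ 2 * (2 * I.Δ * I.k * I.D) ^ I.m * G.card ∧
        ∀ g ∈ G, I.Ref l c (I.child F t e g) ≤ I.Ref l c F ∧
          I.rank (I.child F t e g).u + 1 ≤ I.rank F.u := by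
    intro Q U e hQX hQc hU hQ he hg
    refine ⟨t, ht, e, he, (tuples Q I.m).filter fun g =>
      I.err l F t U g ≤ 8 / I.m * I.var l F t U, ?_, ?_, ?_⟩
    · refine (Finset.filter_subset _ _).trans (Fintype.piFinset_subset _ _ fun _ p hp => ?_)
      exact Finset.mem_range.2 ((hmem p).1 (hQX hp)).1.1
    · have h1 := I.card_tuples_le_err l (F := F) (t := t) hm hQ
      rw [card_tuples] at h1
      have h2 : F.A.length ≤ 2 * I.Δ * I.k * I.D * Q.card := by
        calc F.A.length ≤ I.D * (I.unfin l F).card := hX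
          _ ≤ I.D * (I.k * (2 * I.Δ * Q.card)) := by gcongr; exact hcard.trans (by gcongr)
          _ = _ := by ring
      calc F.A.length ^ I.m ≤ (2 * I.Δ * I.k * I.D * Q.card) ^ I.m := by gcongr
        _ = (2 * I.Δ * I.k * I.D) ^ I.m * Q.card ^ I.m := by rw [mul_pow]
        _ ≤ (2 * I.Δ * I.k * I.D) ^ I.m * (2 * ((tuples Q I.m).filter fun g =>
            I.err l F t U g ≤ 8 / I.m * I.var l F t U).card) := by gcongr
        _ = _ := by ring
    · intro g hgG
      rw [Finset.mem_filter] at hgG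
      obtain ⟨h1, h2, h3⟩ := hg g hgG.1
      exact ⟨I.Ref_child_le l c hU h1 hgG.2 h3, I.rank_freeze_lt ht h2⟩
  -- Many unknown coordinates call for mode `0`, with samples from all unfinished points of label
  -- `t`.
  by_cases hbig : 2 * I.Δ < (I.unk F.u t).card
  · refine main Xt (I.unk F.u t) 0 (subset_refl _) ?_ (subset_refl _) ?_ (by omega) ?_
    · have : 1 * Xt.card ≤ 2 * I.Δ * Xt.card := Nat.mul_le_mul_right _ (by omega)
      omega
    -- A point that specifies an unknown coordinate of its center is unfinished. So the points of
    -- `Xt` that specify `i` are all the active points on which the coordinate `i` of this center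
    -- depends, and the estimate is aimed at the right mean.
    · intro i hi
      ext p
      rw [mem_unk] at hi
      simp only [spos, Finset.mem_filter, Finset.mem_range, hmem]
      constructor
      · rintro ⟨h1, h2, h3⟩
        refine ⟨⟨⟨h1, fun hA => ?_⟩, h2⟩, h3⟩
        exact hA i hi.1 h3 (by rw [h2]; exact hi.2)
      · rintro ⟨⟨⟨h1, _⟩, h2⟩, h3⟩
        exact ⟨h1, h2, h3⟩
    · intro g _
      have hle := I.card_unk_freeze_le (F := F) (t := t) (g := g) hm hmiss
      refine ⟨fun i hi hf => ⟨I.mem_unk.2 ⟨hi, hf.1⟩, ?_⟩, by omega, Or.inl ⟨hbig, hle⟩⟩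
      rcases hf.2 with h | h
      · exact h.2
      · exact absurd rfl h.1
  -- With at most `2 Δ` unknown coordinates, each unfinished point of the label specifies one of
  -- them. One coordinate `i₀` is hence specified by a fraction `1 / (2 Δ)` of these points, and it
  -- is estimated alone from them.
  · have hbig' : (I.unk F.u t).card ≤ 2 * I.Δ := not_lt.1 hbig
    have hex : ∀ p ∈ Xt, ∃ i, i ∈ I.unk F.u t ∧ I.pt (F.act p) i ≠ none := by
      intro p hp
      obtain ⟨⟨_, h2⟩, h3⟩ := (hmem p).1 hp
      rw [h3] at h2
      unfold Avail at h2
      push Not at h2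
      obtain ⟨i, hi, h4, h5⟩ := h2
      exact ⟨i, I.mem_unk.2 ⟨hi, h5⟩, h4⟩
    choose! f hf using hex
    obtain ⟨i₀, hi₀, hcard₀⟩ := exists_card_le_mul_fiber Xt f (I.unk F.u t)
      (fun p hp => (hf p hp).1) hXtne
    have hi₀' := I.mem_unk.1 hi₀
    refine main (Xt.filter fun p => I.pt (F.act p) i₀ ≠ none) {i₀} (pos F.u t i₀)
      (Finset.filter_subset _ _) ?_ (Finset.singleton_subset_iff.2 hi₀) ?_ ?_ ?_
    · refine hcard₀.trans (Nat.mul_le_mul hbig' (Finset.card_le_card fun p hp => ?_))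
      rw [Finset.mem_filter] at hp ⊢
      refine ⟨hp.1, ?_⟩
      have := (hf p hp.1).2
      rwa [hp.2] at this
    · intro i hi
      rw [Finset.mem_singleton] at hi
      subst hi
      ext p
      simp only [spos, Finset.mem_filter, Finset.mem_range, hmem]
      constructor
      · rintro ⟨h1, h2, h3⟩
        refine ⟨⟨⟨⟨h1, fun hA => ?_⟩, h2⟩, h3⟩, h3⟩
        exact hA i hi₀'.1 h3 (by rw [h2]; exact hi₀'.2)
      · rintro ⟨⟨⟨⟨h1, _⟩, h2⟩, h3⟩, _⟩
        exact ⟨h1, h2, h3⟩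
    · have := I.pos_le_card_unk (u := F.u) (t := t) hi₀'.1
      omega
    · intro g hgQ
      have hcnt : I.cnt F g i₀ = I.m := by
        have : (univ.filter fun j => I.pt (F.act (g j)) i₀ ≠ none) = univ := by
          refine Finset.filter_true_of_mem fun j _ => ?_
          exact (Finset.mem_filter.1 (Fintype.mem_piFinset.1 hgQ j)).2
        unfold cnt
        rw [this, Finset.card_univ, Fintype.card_fin]
      have hfix₀ : I.Fix F t (pos F.u t i₀) g i₀ :=
        ⟨hi₀'.2, Or.inr ⟨Nat.one_le_iff_ne_zero.1 (one_le_pos hi₀'.2), rfl, by omega⟩⟩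
      have hne0 := one_le_pos hi₀'.2
      refine ⟨fun i hi hfi => ?_, ?_, Or.inr ⟨hbig', fun i hi => ?_⟩⟩
      · rcases hfi.2 with h | h
        · omega
        · obtain rfl : i₀ = i := pos_inj hi₀'.2 hfi.1 h.2.1
          exact ⟨Finset.mem_singleton_self _, by omega⟩
      · have : I.unk (I.freeze F t (pos F.u t i₀) g) t ⊆ (I.unk F.u t).erase i₀ := by
          intro i hi
          obtain ⟨h1, h2⟩ := I.mem_unk_freeze.1 hi
          refine Finset.mem_erase.2 ⟨fun h => h2 (h ▸ hfix₀), h1⟩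
        have h1 := Finset.card_le_card this
        rw [Finset.card_erase_of_mem hi₀] at h1
        have h2 := Finset.card_pos.2 ⟨i₀, hi₀⟩
        omega
      · rw [Finset.mem_singleton] at hi
        exact hi ▸ hfix₀

end Inst

end MissingKMeans

namespace MissingKMeans

open Finset

namespace Inst

variable (I : Inst) (l : ℕ → ℕ) (c : ℕ → ℕ → ℝ)

/-! ### Promising nodes -/

/-- The node `F` at depth `r` of the search tree is promising: completing its centers by the
reference centers `c` gives a good solution. The bound `B` is slightly larger than the cost of the
reference solution, and `T` is the distance of the last pivot. -/
def Lucky (B : ℝ) (r : ℕ) (F : Frame) : Prop :=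
  I.rank F.u + r ≤ I.R ∧ I.Ref l c F ≤ B ∧ ∃ T : ℝ, 0 ≤ T ∧
    (∀ p < F.A.length, I.Has F.u (F.act p) → T ≤ I.dv F.u (F.act p)) ∧
    F.A.length * T ≤ 8 * I.Ref l c F ∧
    F.acc + (1 + 32 / I.D) * I.Ref l c F - 4 / I.D * (F.A.length * T)
      ≤ B * (1 + 32 / I.D * (1 + r))

/-- The bound for the cost of the solutions that are found. -/
noncomputable def thr (B : ℝ) : ℝ := B * (1 + 32 / I.D * (I.R + 2))

variable {l c}

theorem Ref_nonneg (F : Frame) : 0 ≤ I.Ref l c F :=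
  Finset.sum_nonneg fun _ _ => I.refp_nonneg l c _ _

/-- Without unfinished points, every active point costs at most its reference cost. Dropping the
subtracted term of the accounting costs `32 / D * B`, the allowance of one more level; together with
`1 + r ≤ 1 + R` this explains `R + 2` in `thr`. -/
theorem Lucky.cand {B : ℝ} {r : ℕ} {F : Frame} (hl : ∀ x, l x < I.k) (hF : I.Lucky l c B r F)
    (hX : I.unfin l F = ∅) :
    (∀ p < F.A.length, I.Has F.u (F.act p)) ∧
      F.acc + ∑ p ∈ range F.A.length, I.dv F.u (F.act p) ≤ I.thr B := by
  obtain ⟨hrank, hB, T, hT, hdv, haT, hE⟩ := hF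
  have hav : ∀ p < F.A.length, I.Avail F.u (l (F.act p)) (F.act p) := by
    intro p hp
    by_contra h
    have : p ∈ I.unfin l F := by simp [unfin, hp, h]
    rw [hX] at this
    simp at this
  refine ⟨fun p hp => I.has_of_avail (hl _) (hav p hp), ?_⟩
  have h1 : ∑ p ∈ range F.A.length, I.dv F.u (F.act p) ≤ I.Ref l c F :=
    Finset.sum_le_sum fun p hp => I.dv_le_refp l c (hl _) (hav p (Finset.mem_range.1 hp))
  have h0 := I.Ref_nonneg (l := l) (c := c) F
  have hD : (0 : ℝ) ≤ 4 / I.D := by positivity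
  have h2 := mul_le_mul_of_nonneg_left haT hD
  have h3 : (0 : ℝ) ≤ 32 / I.D * I.Ref l c F := by positivity
  have h32 : (32 : ℝ) / I.D = 8 * (4 / I.D) := by ring
  have hr : (r : ℝ) ≤ I.R := by exact_mod_cast (Nat.le_add_left _ _).trans hrank
  have hBn : 0 ≤ B := h0.trans hB
  have h4 : B * (1 + 32 / I.D * (1 + r)) + 4 / I.D * (8 * B) ≤ I.thr B := by
    unfold thr
    have : 4 / I.D * (8 * B) = B * (32 / I.D) := by ring
    rw [this, ← mul_add]
    refine mul_le_mul_of_nonneg_left ?_ hBn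
    have : (0 : ℝ) ≤ 32 / I.D := by positivity
    nlinarith
  have h5 := mul_le_mul_of_nonneg_left hB hD
  linarith

/-- New centers may come closer than the last pivot, so the child restarts with `T = 0`. The
subtracted term that is given up is at most `32 / D * B`, exactly what one more level adds to the
right-hand side. -/
theorem Lucky.child {B : ℝ} {r t e : ℕ} {F : Frame} {g : Fin I.m → ℕ} (hF : I.Lucky l c B r F)
    (hRef : I.Ref l c (I.child F t e g) ≤ I.Ref l c F)
    (hrk : I.rank (I.child F t e g).u + 1 ≤ I.rank F.u) :
    I.Lucky l c B (r + 1) (I.child F t e g) := by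
  obtain ⟨hrank, hB, T, hT, hdv, haT, hE⟩ := hF
  have hD : (0 : ℝ) ≤ 4 / I.D := by positivity
  refine ⟨by omega, hRef.trans hB, 0, le_rfl, fun p _ _ => I.dv_nonneg _ _, ?_, ?_⟩
  · have := I.Ref_nonneg (l := l) (c := c) (I.child F t e g)
    simp only [mul_zero]
    linarith
  · have hacc : (I.child F t e g).acc = F.acc := rfl
    rw [hacc]
    have h1 : (1 + 32 / I.D) * I.Ref l c (I.child F t e g) ≤ (1 + 32 / (I.D : ℝ)) * I.Ref l c F :=
      mul_le_mul_of_nonneg_left hRef (by positivity)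
    have h2 := mul_le_mul_of_nonneg_left haT hD
    have h5 := mul_le_mul_of_nonneg_left hB hD
    push_cast
    have h6 : B * (1 + 32 / I.D * (1 + (r + 1))) = B * (1 + 32 / I.D * (1 + r)) + 4 / I.D * (8 * B) := by
      ring
    rw [h6]
    simp only [mul_zero, sub_zero]
    linarith

open Classical in
theorem length_up (F : Frame) (z : ℕ) :
    (I.up F z).length + ((range F.A.length).filter (I.Low F z)).card = F.A.length := by
  unfold up
  rw [length_filter_range]
  have := Finset.card_filter_add_card_filter_not (s := range F.A.length) (I.Low F z)
  rw [Finset.card_range] at this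
  exact (add_comm _ _).trans this

open Classical in
theorem sum_pivot_of_accept {F : Frame} {z : ℕ} (h : I.Accept F z) (f : ℕ → ℝ) :
    ∑ p ∈ range (I.pivot F z).A.length, f ((I.pivot F z).act p)
      + ∑ p ∈ (range F.A.length).filter (I.Low F z), f (F.act p)
      = ∑ p ∈ range F.A.length, f (F.act p) := by
  have hA : (I.pivot F z).A = (I.up F z).map F.act := by rw [pivot, if_pos h]
  unfold Frame.act at *
  rw [sum_range_getD, hA, List.map_map]
  unfold up
  rw [sum_filter_range]
  rw [add_comm]
  have := Finset.sum_filter_add_sum_filter_not (range F.A.length) (I.Low F z)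
    (fun p => f (F.A.getD p 0))
  exact this

theorem exists_of_act_pivot {F : Frame} {z p : ℕ} (h : I.Accept F z)
    (hp : p < (I.pivot F z).A.length) :
    ∃ q < F.A.length, ¬ I.Low F z q ∧ (I.pivot F z).act p = F.act q := by
  classical
  have hA : (I.pivot F z).A = (I.up F z).map F.act := by rw [pivot, if_pos h]
  have h1 : (I.pivot F z).act p ∈ (I.pivot F z).A := by
    unfold Frame.act
    rw [List.getD_eq_getElem _ _ hp]
    exact List.getElem_mem hp
  rw [hA, List.mem_map] at h1
  obtain ⟨q, hq, hq'⟩ := h1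
  unfold up at hq
  rw [List.mem_filter, List.mem_range] at hq
  exact ⟨q, hq.1, by simpa using hq.2, hq'.symm⟩

/-- At most `a / D` of the removed points are unfinished, and they are charged at most `T'` each;
the new subtracted term `4 / D * (a' * T')` covers this since `a ≤ 4 * a'`. The old subtracted term
is paid by the removed finished points: there are at least `a / 8` of them, of cost at least `T`,
and each leaves a reserve of `32 / D` times its reference cost. -/
theorem Lucky.pivot_of_accept {B : ℝ} {r z : ℕ} {F : Frame} (hl : ∀ x, l x < I.k)
    (hD8 : 8 ≤ I.D)
    (hF : I.Lucky l c B r F) (hX : I.D * (I.unfin l F).card < F.A.length)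
    (h : I.Accept F z) : I.Lucky l c B r (I.pivot F z) := by
  classical
  obtain ⟨hrank, hB, T, hT, hdv, haT, hE⟩ := hF
  set a : ℝ := (F.A.length : ℝ) with ha
  set a' : ℝ := ((I.pivot F z).A.length : ℝ) with ha'
  set T' := I.dv F.u (F.act z) with hT'
  have hT'0 : 0 ≤ T' := I.dv_nonneg _ _
  have hu : (I.pivot F z).u = F.u := by rw [pivot, if_pos h]
  have hacc : (I.pivot F z).acc
      = F.acc + ∑ p ∈ (range F.A.length).filter (I.Low F z), I.dv F.u (F.act p) := by
    rw [pivot, if_pos h]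
  have hlen : (I.pivot F z).A.length = (I.up F z).length := by
    rw [pivot, if_pos h, List.length_map]
  set Lo := (range F.A.length).filter (I.Low F z) with hLo
  set X := I.unfin l F with hXdef
  have hD0 : (0 : ℝ) < I.D := by
    have : (8 : ℝ) ≤ I.D := by exact_mod_cast hD8
    linarith
  have hXc : (X.card : ℝ) ≤ a / I.D := by
    rw [le_div_iff₀ hD0, mul_comm, ha]
    exact_mod_cast hX.le
  have hXc8 : 8 * (X.card : ℝ) ≤ a := by
    have h1 : 8 * X.card ≤ F.A.length :=
      (Nat.mul_le_mul_right _ hD8).trans hX.le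
    rw [ha]
    exact_mod_cast h1
  have hcount : a' + Lo.card = a := by
    have := I.length_up F z
    rw [← hlen] at this
    rw [ha, ha']
    exact_mod_cast this
  have ha4 : a ≤ 4 * a' := by
    have := h.2.1
    rw [← hlen] at this
    rw [ha, ha']
    exact_mod_cast this
  have ha3 : 4 * a' ≤ 3 * a := by
    have := h.2.2
    rw [← hlen] at this
    rw [ha, ha']
    exact_mod_cast this
  have hRsplit : I.Ref l c (I.pivot F z) + ∑ p ∈ Lo, I.refp l c F.u (F.act p) = I.Ref l c F := by
    have := I.sum_pivot_of_accept h (I.refp l c F.u)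
    unfold Ref
    rw [hu]
    exact this
  have hmemX : ∀ p, p < F.A.length → p ∉ X → I.Avail F.u (l (F.act p)) (F.act p) := by
    intro p hp hpX
    by_contra hA
    exact hpX (by simp [hXdef, unfin, hp, hA])
  have hdvref : ∀ p, p < F.A.length → p ∉ X → I.dv F.u (F.act p) ≤ I.refp l c F.u (F.act p) :=
    fun p hp hpX => I.dv_le_refp l c (hl _) (hmemX p hp hpX)
  have hLodv : ∀ p ∈ Lo, I.dv F.u (F.act p) ≤ T' := by
    intro p hp
    rcases (Finset.mem_filter.1 hp).2.2 with h | h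
    · exact h.le
    · exact h.1.le
  -- the finished points that are removed
  set S := ∑ p ∈ Lo.filter (· ∉ X), I.dv F.u (F.act p) with hS
  have hSref : S ≤ ∑ p ∈ Lo, I.refp l c F.u (F.act p) := by
    calc S ≤ ∑ p ∈ Lo.filter (· ∉ X), I.refp l c F.u (F.act p) := by
          refine Finset.sum_le_sum fun p hp => ?_
          rw [Finset.mem_filter, hLo, Finset.mem_filter, Finset.mem_range] at hp
          exact hdvref p hp.1.1 hp.2
      _ ≤ _ := Finset.sum_le_sum_of_subset_of_nonneg (Finset.filter_subset _ _)
          fun _ _ _ => I.refp_nonneg l c _ _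
  have hcardLo : (Lo.card : ℝ) ≤ (Lo.filter (· ∉ X)).card + X.card := by
    have h1 : (Lo.filter (· ∈ X)).card + (Lo.filter (· ∉ X)).card = Lo.card :=
      Finset.card_filter_add_card_filter_not _
    have h2 : (Lo.filter (· ∈ X)).card ≤ X.card :=
      Finset.card_le_card fun p hp => (Finset.mem_filter.1 hp).2
    have : Lo.card ≤ (Lo.filter (· ∉ X)).card + X.card := by omega
    exact_mod_cast this
  -- At least a quarter of the active points is removed, and at most an eighth is unfinished.
  have hST : a / 8 * T ≤ S := by
    have h1 : ((Lo.filter (· ∉ X)).card : ℝ) * T ≤ S := by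
      rw [← nsmul_eq_mul]
      refine Finset.card_nsmul_le_sum _ _ _ fun p hp => ?_
      rw [Finset.mem_filter, hLo, Finset.mem_filter, Finset.mem_range] at hp
      exact hdv p hp.1.1 hp.1.2.1
    refine le_trans (mul_le_mul_of_nonneg_right ?_ hT) h1
    linarith
  -- the unfinished points that are removed
  have hmist : ∑ p ∈ Lo.filter (fun p => ¬ p ∉ X), I.dv F.u (F.act p) ≤ a / I.D * T' := by
    calc ∑ p ∈ Lo.filter (fun p => ¬ p ∉ X), I.dv F.u (F.act p)
        ≤ (Lo.filter fun p => ¬ p ∉ X).card • T' :=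
          Finset.sum_le_card_nsmul _ _ _ fun p hp => hLodv p (Finset.mem_filter.1 hp).1
      _ ≤ X.card * T' := by
          rw [nsmul_eq_mul]
          refine mul_le_mul_of_nonneg_right ?_ hT'0
          exact_mod_cast Finset.card_le_card fun p hp => not_not.1 (Finset.mem_filter.1 hp).2
      _ ≤ _ := mul_le_mul_of_nonneg_right hXc hT'0
  have hLosum : ∑ p ∈ Lo, I.dv F.u (F.act p)
      = S + ∑ p ∈ Lo.filter (fun p => ¬ p ∉ X), I.dv F.u (F.act p) :=
    (Finset.sum_filter_add_sum_filter_not _ _ _).symm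
  have hD4 : (0 : ℝ) ≤ 4 / I.D := by positivity
  have hRle : I.Ref l c (I.pivot F z) ≤ I.Ref l c F := by
    have : 0 ≤ ∑ p ∈ Lo, I.refp l c F.u (F.act p) :=
      Finset.sum_nonneg fun _ _ => I.refp_nonneg l c _ _
    linarith
  have hupT : ∀ q < F.A.length, I.Has F.u (F.act q) → ¬ I.Low F z q → T' ≤ I.dv F.u (F.act q) := by
    intro q _ hq hlow
    by_contra hlt
    exact hlow ⟨hq, Or.inl (not_le.1 hlt)⟩
  refine ⟨by rw [hu]; exact hrank, hRle.trans hB, T', hT'0, ?_, ?_, ?_⟩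
  · intro p hp hhas
    obtain ⟨q, hq, hlow, hpq⟩ := I.exists_of_act_pivot h hp
    rw [hu] at hhas ⊢
    rw [hpq] at hhas ⊢
    exact hupT q hq hhas hlow
  · -- the finished points that stay active
    set Up := (range F.A.length).filter fun p => ¬ I.Low F z p with hUp
    have hupsum : I.Ref l c (I.pivot F z) = ∑ p ∈ Up, I.refp l c F.u (F.act p) := by
      have h1 : ∑ p ∈ Lo, I.refp l c F.u (F.act p) + ∑ p ∈ Up, I.refp l c F.u (F.act p)
          = I.Ref l c F := Finset.sum_filter_add_sum_filter_not _ _ _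
      linarith
    have hcardUp : (Up.card : ℝ) = a' := by
      have h1 : Lo.card + Up.card = F.A.length := by
        have := Finset.card_filter_add_card_filter_not (s := range F.A.length) (I.Low F z)
        rwa [Finset.card_range] at this
      have h2 : (Lo.card : ℝ) + Up.card = a := by
        rw [ha]
        exact_mod_cast h1
      linarith
    have h1 : (Up.card : ℝ) ≤ (Up.filter (· ∉ X)).card + X.card := by
      have h1 : (Up.filter (· ∈ X)).card + (Up.filter (· ∉ X)).card = Up.card :=
        Finset.card_filter_add_card_filter_not _
      have h2 : (Up.filter (· ∈ X)).card ≤ X.card :=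
        Finset.card_le_card fun p hp => (Finset.mem_filter.1 hp).2
      have : Up.card ≤ (Up.filter (· ∉ X)).card + X.card := by omega
      exact_mod_cast this
    have h2 : ((Up.filter (· ∉ X)).card : ℝ) * T' ≤ I.Ref l c (I.pivot F z) := by
      rw [hupsum, ← nsmul_eq_mul]
      refine (Finset.card_nsmul_le_sum _ (fun p => I.refp l c F.u (F.act p)) _ fun p hp => ?_).trans
        (Finset.sum_le_sum_of_subset_of_nonneg (Finset.filter_subset (· ∉ X) Up)
          fun _ _ _ => I.refp_nonneg l c _ _)
      rw [Finset.mem_filter, hUp, Finset.mem_filter, Finset.mem_range] at hp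
      exact (hupT p hp.1.1 (I.has_of_avail (hl _) (hmemX p hp.1.1 hp.2)) hp.1.2).trans
        (hdvref p hp.1.1 hp.2)
    -- The unfinished points number at most `a / 8 ≤ a' / 2`, so at least half of the remaining
    -- points are finished.
    have h3 : a' / 8 ≤ (Up.filter (· ∉ X)).card := by linarith
    have h4 := mul_le_mul_of_nonneg_right h3 hT'0
    linarith
  · rw [hacc]
    have h1 : 4 / I.D * (a * T) ≤ 32 / I.D * S := by
      have := mul_le_mul_of_nonneg_left hST (show (0 : ℝ) ≤ 32 / I.D by positivity)
      calc 4 / I.D * (a * T) = 32 / I.D * (a / 8 * T) := by ring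
        _ ≤ _ := this
    have h2 : a / I.D * T' ≤ 4 / I.D * (a' * T') := by
      have := mul_le_mul_of_nonneg_right ha4 (show 0 ≤ 1 / I.D * T' by positivity)
      calc a / I.D * T' = a * (1 / I.D * T') := by ring
        _ ≤ 4 * a' * (1 / I.D * T') := this
        _ = _ := by ring
    have h3 : 32 / I.D * S ≤ 32 / I.D * ∑ p ∈ Lo, I.refp l c F.u (F.act p) :=
      mul_le_mul_of_nonneg_left hSref (by positivity)
    have h4 : (1 + 32 / I.D) * I.Ref l c (I.pivot F z) = (1 + 32 / I.D) * I.Ref l c F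
        - (1 + 32 / I.D) * ∑ p ∈ Lo, I.refp l c F.u (F.act p) := by
      rw [← hRsplit]
      ring
    rw [h4]
    have h5 : (1 + 32 / (I.D : ℝ)) * ∑ p ∈ Lo, I.refp l c F.u (F.act p)
        = ∑ p ∈ Lo, I.refp l c F.u (F.act p)
          + 32 / I.D * ∑ p ∈ Lo, I.refp l c F.u (F.act p) := by ring
    rw [h5, hLosum]
    linarith

theorem Lucky.pivot {B : ℝ} {r : ℕ} {F : Frame} (hl : ∀ x, l x < I.k) (hD8 : 8 ≤ I.D)
    (hF : I.Lucky l c B r F) (hX : I.D * (I.unfin l F).card < F.A.length) (z : ℕ) :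
    I.Lucky l c B r (I.pivot F z) := by
  by_cases h : I.Accept F z
  · exact Lucky.pivot_of_accept I hl hD8 hF hX h
  · rw [Inst.pivot, if_neg h]
    exact hF

/-- A random pivot shrinks the set of active points by a constant factor on average. -/
theorem sum_length_pivot {F : Frame} (hl : ∀ x, l x < I.k) (hD8 : 8 ≤ I.D)
    (hne : (I.unfin l F).Nonempty) (hX : I.D * (I.unfin l F).card < F.A.length) :
    10 * ∑ z ∈ range F.A.length, (I.pivot F z).A.length ≤ 9 * F.A.length ^ 2 := by
  classical
  set a := F.A.length with ha
  set S := (range a).filter fun p => I.Has F.u (F.act p) with hS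
  -- Ties of the distances are broken by the position. The keys are thus distinct, and `Low` is the
  -- order of the keys.
  set key : ℕ → ℝ ×ₗ ℕ := fun p => toLex (I.dv F.u (F.act p), p) with hkey
  have hinj : Set.InjOn key S := by
    intro p _ q _ h
    exact congrArg (fun x => (ofLex x).2) h
  have hcardX := hne.card_pos
  have ha8 : 8 * (I.unfin l F).card < a := lt_of_le_of_lt (Nat.mul_le_mul_right _ hD8) hX
  have hScard : a ≤ S.card + (I.unfin l F).card := by
    have h1 : range a ⊆ S ∪ I.unfin l F := by
      intro p hp
      rw [Finset.mem_union, hS, Finset.mem_filter]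
      by_cases hA : I.Avail F.u (l (F.act p)) (F.act p)
      · exact Or.inl ⟨hp, I.has_of_avail (hl _) hA⟩
      · right
        simp only [unfin, Finset.mem_filter]
        exact ⟨hp, hA⟩
    have h2 := (Finset.card_le_card h1).trans (Finset.card_union_le _ _)
    rwa [Finset.card_range] at h2
  -- The bounds are `a / 4` rounded up and `3 a / 4` rounded down: a pivot with a rank between them
  -- is accepted.
  have hcount := card_filter_rank S key hinj (lo := (a + 3) / 4) (hi := 3 * a / 4) (by omega)
    (by omega)
  have hlow : ∀ z ∈ S, ((range a).filter (I.Low F z)) = S.filter fun p => key p ≤ key z := by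
    intro z _
    ext p
    simp only [hS, Finset.mem_filter, Low, hkey, Prod.Lex.toLex_le_toLex]
    tauto
  set G := (range a).filter (I.Accept F) with hG
  have hGcard : 3 * a / 4 + 1 - (a + 3) / 4 ≤ G.card := by
    rw [← hcount]
    refine Finset.card_le_card fun z hz => ?_
    rw [Finset.mem_filter] at hz
    have h1 := I.length_up F z
    rw [← ha, hlow z hz.1] at h1
    rw [hG, Finset.mem_filter]
    have hzS := Finset.mem_filter.1 hz.1
    exact ⟨hzS.1, hzS.2, by omega, by omega⟩
  have hlen : ∀ z ∈ range a, 4 * (I.pivot F z).A.length ≤ 4 * a - (if I.Accept F z then a else 0) := by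
    intro z _
    rw [pivot]
    split_ifs with h
    · have := h.2.2
      simp only [List.length_map]
      omega
    · simp [ha]
  have hsum : 4 * ∑ z ∈ range a, (I.pivot F z).A.length + G.card * a ≤ 4 * a * a := by
    rw [Finset.mul_sum, hG, Finset.card_filter, Finset.sum_mul, ← Finset.sum_add_distrib]
    calc _ ≤ ∑ z ∈ range a, 4 * a := by
          refine Finset.sum_le_sum fun z hz => ?_
          have := hlen z hz
          split_ifs at this ⊢ <;> omega
      _ = 4 * a * a := by simp; ring
  -- Two fifths of the pivots are accepted, and each of these removes at least a quarter of the
  -- points, so a tenth is lost on average. The rounding is harmless because `a > 8`.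
  have hG5 : 2 * a ≤ 5 * G.card := by omega
  nlinarith

end Inst

end MissingKMeans

/-! ### The value of a state: a lower bound for the success probability that does not fall on
average -/

namespace MissingKMeans

open Finset

/-- The state of the search: the path to the present node (the top of the stack comes first), the
number of trials that remain, and the cost of the best solution so far. -/
structure State where
  stack : List Frame
  tr : ℕ
  best : Option ℝ

namespace Inst

variable (I : Inst) (l : ℕ → ℕ) (c : ℕ → ℕ → ℝ)

/-- The root of the search tree. -/
noncomputable def root : Frame where
  A := List.range I.n
  u := fun _ _ => none
  acc := 0
  bud := 20 * I.n
  b0 := 20 * I.n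

/-- The cost of the solution at a node all of whose active points have an available center. -/
noncomputable def candCost (F : Frame) : ℝ :=
  F.acc + ∑ p ∈ range F.A.length, I.dv F.u (F.act p)

open Classical in
/-- The best cost after the visit of the node `F`. -/
noncomputable def upd (best : Option ℝ) (F : Frame) : Option ℝ :=
  if (∀ p < F.A.length, I.Has F.u (F.act p)) ∧ ∀ b, best = some b → I.candCost F < b
  then some (I.candCost F) else best

/-- The visit of the node `F` at the top of the stack. -/
noncomputable def visit (F : Frame) (st : List Frame) (tr : ℕ) (best : Option ℝ)
    (t e z : ℕ) (g : Fin I.m → ℕ) : State where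
  stack := if st.length < I.R then I.child F t e g :: I.pivot F z :: st else I.pivot F z :: st
  tr := tr
  best := I.upd best F

/-- The budget of a node is consistent. -/
def Frame.Ok (F : Frame) : Prop := 0 < F.A.length ∧ F.bud ≤ F.b0 ∧ 0 < F.b0

/-- The probability that a node has a good child. -/
noncomputable def q : ℝ := 1 / (2 * I.Bp)

open Classical in
/-- A lower bound for the probability that a node leads to a good solution. -/
noncomputable def vf (B : ℝ) (r : ℕ) (F : Frame) : ℝ :=
  if I.Lucky l c B r F then I.q ^ (I.R - r) * max 0 (((F.bud : ℝ) - 10 * F.A.length) / F.b0) else 0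

/-- A lower bound for the probability that a stack leads to a good solution. -/
noncomputable def sv (B : ℝ) : List Frame → ℝ
  | [] => 0
  | F :: st => max (sv B st) (I.vf l c B st.length F)

/-- A lower bound for the probability that one trial leads to a good solution. -/
noncomputable def Q : ℝ := I.q ^ I.R / 2

/-- A good solution has been found. -/
def Good (B : ℝ) (best : Option ℝ) : Prop := ∃ b, best = some b ∧ b ≤ I.thr B

open Classical in
/-- A lower bound for the probability of success. -/
noncomputable def value (B : ℝ) (σ : State) : ℝ :=
  if I.Good B σ.best then 1 else 1 - (1 - I.sv l c B σ.stack) * (1 - I.Q) ^ σ.tr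

variable {l c}

theorem one_le_Bp (hk : 1 ≤ I.k) (hΔ : 1 ≤ I.Δ) (hm : 1 ≤ I.m) : 1 ≤ I.Bp := by
  have hD : 1 ≤ I.D := by
    unfold D
    nlinarith
  unfold Bp
  have h2 : 1 ≤ (2 * I.Δ * I.k * I.D) ^ I.m := Nat.one_le_pow _ _ (by positivity)
  have h1 : 1 ≤ 2 * I.k * (2 * I.Δ + 1) := by nlinarith
  nlinarith

theorem q_nonneg : 0 ≤ I.q := by unfold q; positivity

theorem q_le_one : I.q ≤ 1 := by
  unfold q
  rcases Nat.eq_zero_or_pos I.Bp with h | h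
  · simp [h]
  · have : (1 : ℝ) ≤ I.Bp := by exact_mod_cast h
    rw [div_le_one (by positivity)]
    linarith

theorem Q_nonneg : 0 ≤ I.Q := by
  have := I.q_nonneg
  unfold Q
  positivity

theorem Q_le_one : I.Q ≤ 1 := by
  have := pow_le_one₀ I.q_nonneg I.q_le_one (n := I.R)
  unfold Q
  linarith

theorem vf_nonneg (B : ℝ) (r : ℕ) (F : Frame) : 0 ≤ I.vf l c B r F := by
  have := I.q_nonneg
  unfold vf
  split_ifs
  · positivity
  · exact le_rfl

theorem vf_le {B : ℝ} {r : ℕ} {F : Frame} (hF : Frame.Ok F) :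
    I.vf l c B r F ≤ I.q ^ (I.R - r) := by
  have h0 := I.q_nonneg
  unfold vf
  split_ifs
  · refine mul_le_of_le_one_right (by positivity) (max_le zero_le_one ?_)
    have hb : (0 : ℝ) < F.b0 := by exact_mod_cast hF.2.2
    rw [div_le_one hb]
    have : (F.bud : ℝ) ≤ F.b0 := by exact_mod_cast hF.2.1
    have : (0 : ℝ) ≤ F.A.length := Nat.cast_nonneg _
    linarith
  · positivity

theorem sv_nonneg (B : ℝ) (st : List Frame) : 0 ≤ I.sv l c B st := by
  cases st with
  | nil => exact le_rfl
  | cons F st => exact le_max_of_le_right (I.vf_nonneg B _ F)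

theorem sv_le_one {B : ℝ} {st : List Frame} (h : ∀ F ∈ st, Frame.Ok F) : I.sv l c B st ≤ 1 := by
  induction st with
  | nil => exact zero_le_one
  | cons F st ih =>
    refine max_le (ih fun F' hF' => h F' (List.mem_cons_of_mem _ hF')) ?_
    exact (I.vf_le (h F List.mem_cons_self)).trans (pow_le_one₀ I.q_nonneg I.q_le_one)

theorem Ok.child {F : Frame} (hF : Frame.Ok F) (t e : ℕ) (g : Fin I.m → ℕ) :
    Frame.Ok (I.child F t e g) := by
  refine ⟨hF.1, le_rfl, ?_⟩
  have := hF.1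
  change 0 < 20 * F.A.length
  omega

theorem Ok.pivot {F : Frame} (hF : Frame.Ok F) (z : ℕ) : Frame.Ok (I.pivot F z) := by
  unfold Inst.pivot
  split_ifs with h
  · refine ⟨?_, (Nat.sub_le _ _).trans hF.2.1, hF.2.2⟩
    have := h.2.1
    have := hF.1
    simp only [List.length_map]
    omega
  · exact ⟨hF.1, (Nat.sub_le _ _).trans hF.2.1, hF.2.2⟩

theorem Good.upd {B : ℝ} {best : Option ℝ} {F : Frame} (h : I.Good B best) :
    I.Good B (I.upd best F) := by
  obtain ⟨b, hb, hbθ⟩ := h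
  unfold Inst.upd
  split_ifs with hc
  · exact ⟨_, rfl, (hc.2 b hb).le.trans hbθ⟩
  · exact ⟨b, hb, hbθ⟩

theorem good_upd_of_cand {B : ℝ} {best : Option ℝ} {F : Frame}
    (h : (∀ p < F.A.length, I.Has F.u (F.act p)) ∧ I.candCost F ≤ I.thr B) :
    I.Good B (I.upd best F) := by
  unfold Inst.upd
  split_ifs with hc
  · exact ⟨_, rfl, h.2⟩
  · have : ∃ b, best = some b ∧ b ≤ I.candCost F := by
      by_contra! hcon
      exact hc ⟨h.1, hcon⟩
    obtain ⟨b, hb, hle⟩ := this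
    exact ⟨b, hb, hle.trans h.2⟩

/-- The sum of a function over all draws at a node with `a` active points. -/
noncomputable def sumDraws (a : ℕ) (f : ℕ → ℕ → ℕ → (Fin I.m → ℕ) → ℝ) : ℝ :=
  ∑ t ∈ range I.k, ∑ e ∈ range (2 * I.Δ + 1), ∑ z ∈ range a, ∑ g ∈ tuples (range a) I.m, f t e z g

/-- The number of draws at a node with `a` active points. -/
noncomputable def numDraws (a : ℕ) : ℝ := I.k * (2 * I.Δ + 1) * a * (a : ℝ) ^ I.m

theorem sumDraws_const (a : ℕ) (v : ℝ) : I.sumDraws a (fun _ _ _ _ => v) = I.numDraws a * v := by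
  unfold sumDraws numDraws
  simp only [Finset.sum_const, card_tuples, Finset.card_range, nsmul_eq_mul]
  push_cast
  ring

theorem sumDraws_mono {a : ℕ} {f f' : ℕ → ℕ → ℕ → (Fin I.m → ℕ) → ℝ}
    (h : ∀ t e z g, z < a → f t e z g ≤ f' t e z g) : I.sumDraws a f ≤ I.sumDraws a f' :=
  Finset.sum_le_sum fun _ _ => Finset.sum_le_sum fun _ _ => Finset.sum_le_sum fun z hz =>
    Finset.sum_le_sum fun _ _ => h _ _ z _ (Finset.mem_range.1 hz)

theorem sumDraws_affine (a : ℕ) (f : ℕ → ℕ → ℕ → (Fin I.m → ℕ) → ℝ) (v w : ℝ) :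
    I.sumDraws a (fun t e z g => v + w * f t e z g) = I.numDraws a * v + w * I.sumDraws a f := by
  rw [← sumDraws_const]
  unfold sumDraws
  simp only [Finset.sum_add_distrib, Finset.mul_sum]

/-- The pivoted node is always on the new stack, with or without the child above it. As `sv` is a
maximum over the stack, the wrong move never does harm. -/
theorem sv_visit_ge {B : ℝ} {F : Frame} {st : List Frame} {tr : ℕ} {best : Option ℝ} {t e z : ℕ}
    {g : Fin I.m → ℕ} :
    max (I.sv l c B st) (I.vf l c B st.length (I.pivot F z))
      ≤ I.sv l c B (I.visit F st tr best t e z g).stack := by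
  unfold visit
  dsimp only
  split_ifs
  · exact le_max_left _ _
  · exact le_rfl

theorem vf_child_le_sv_visit {B : ℝ} {F : Frame} {st : List Frame} {tr : ℕ} {best : Option ℝ}
    {t e z : ℕ} {g : Fin I.m → ℕ} (h : st.length < I.R) :
    I.vf l c B (st.length + 1) (I.child F t e g)
      ≤ I.sv l c B (I.visit F st tr best t e z g).stack := by
  unfold visit
  dsimp only
  rw [if_pos h]
  exact le_max_right _ _

/-- The expected value does not decrease while the pivot is moved. -/
theorem vf_le_sum_pivot {B : ℝ} {r : ℕ} {F : Frame} (hl : ∀ x, l x < I.k) (hD8 : 8 ≤ I.D)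
    (hF : Frame.Ok F) (hbud : F.A.length ≤ F.bud) (hL : I.Lucky l c B r F)
    (hne : (I.unfin l F).Nonempty) (hX : I.D * (I.unfin l F).card < F.A.length) :
    F.A.length * I.vf l c B r F ≤ ∑ z ∈ range F.A.length, I.vf l c B r (I.pivot F z) := by
  have hb : (0 : ℝ) < F.b0 := by exact_mod_cast hF.2.2
  have hq := I.q_nonneg
  have h1 : ∀ z ∈ range F.A.length, I.q ^ (I.R - r) *
      (((F.bud : ℝ) - F.A.length - 10 * (I.pivot F z).A.length) / F.b0)
        ≤ I.vf l c B r (I.pivot F z) := by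
    intro z _
    unfold vf
    rw [if_pos (Lucky.pivot I hl hD8 hL hX z)]
    refine mul_le_mul_of_nonneg_left ?_ (by positivity)
    have hbud' : ((I.pivot F z).bud : ℝ) = F.bud - F.A.length := by
      have : (I.pivot F z).bud = F.bud - F.A.length := by unfold Inst.pivot; split_ifs <;> rfl
      rw [this, Nat.cast_sub hbud]
    have hb0 : (I.pivot F z).b0 = F.b0 := by unfold Inst.pivot; split_ifs <;> rfl
    rw [hbud', hb0]
    exact le_max_right _ _
  have h0 : ∀ z ∈ range F.A.length, 0 ≤ I.vf l c B r (I.pivot F z) := fun z _ => I.vf_nonneg B r _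
  have h2 := Finset.sum_le_sum h1
  have h3 := Finset.sum_nonneg h0
  rw [← Finset.mul_sum, ← Finset.sum_div, Finset.sum_sub_distrib, ← Finset.mul_sum,
    Finset.sum_const, Finset.card_range, nsmul_eq_mul] at h2
  have h4 := I.sum_length_pivot hl hD8 hne hX
  have h4' : (10 : ℝ) * ∑ z ∈ range F.A.length, ((I.pivot F z).A.length : ℝ)
      ≤ 9 * (F.A.length : ℝ) ^ 2 := by exact_mod_cast h4
  -- A visit spends `a` of the budget, while `10 |A|` falls by at least `a` on average.
  have h5 : F.A.length * (I.q ^ (I.R - r) * (((F.bud : ℝ) - 10 * F.A.length) / F.b0))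
      ≤ ∑ z ∈ range F.A.length, I.vf l c B r (I.pivot F z) := by
    refine le_trans ?_ h2
    rw [mul_left_comm, ← mul_div_assoc]
    refine mul_le_mul_of_nonneg_left ?_ (by positivity)
    gcongr
    nlinarith
  have h6 : I.vf l c B r F
      = I.q ^ (I.R - r) * max 0 (((F.bud : ℝ) - 10 * F.A.length) / F.b0) := by
    unfold vf
    rw [if_pos hL]
  rw [h6]
  -- The mean of positive parts is at least zero and at least the mean.
  rcases max_choice 0 (((F.bud : ℝ) - 10 * F.A.length) / F.b0) with h | h <;> rw [h]
  · simpa using h3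
  · exact h5

/-- The expected value of the stack does not decrease, unless a good solution is found. -/
theorem sv_le_sumDraws {B : ℝ} {F : Frame} {st : List Frame} {tr : ℕ} {best : Option ℝ}
    (hm : 1 ≤ I.m) (hk : 1 ≤ I.k) (hΔ : 1 ≤ I.Δ) (hl : ∀ x, l x < I.k)
    (hmiss : ∀ x, ((range I.d).filter fun i => I.pt x i = none).card ≤ I.Δ)
    (hF : Frame.Ok F) (hbud : F.A.length ≤ F.bud) :
    I.Good B (I.upd best F) ∨
    I.numDraws F.A.length * I.sv l c B (F :: st)
      ≤ I.sumDraws F.A.length fun t e z g => I.sv l c B (I.visit F st tr best t e z g).stack := by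
  have hq := I.q_nonneg
  have hD8 : 8 ≤ I.D := by
    unfold D
    nlinarith
  -- If the maximum is attained below the top, the visit leaves that part of the stack untouched.
  by_cases hst : I.vf l c B st.length F ≤ I.sv l c B st
  · right
    rw [sv, max_eq_left hst, ← sumDraws_const]
    exact I.sumDraws_mono fun t e z g _ => (le_max_left _ _).trans I.sv_visit_ge
  have hmax : I.sv l c B (F :: st) = I.vf l c B st.length F := max_eq_right (not_le.1 hst).le
  have hL : I.Lucky l c B st.length F := by
    by_contra hL
    refine hst ?_
    rw [vf, if_neg hL]
    exact I.sv_nonneg B st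
  rcases (I.unfin l F).eq_empty_or_nonempty with hX | hX
  · exact Or.inl (I.good_upd_of_cand (Lucky.cand I hl hL hX))
  right
  rw [hmax]
  by_cases hmany : I.D * (I.unfin l F).card < F.A.length
  · have h1 := I.vf_le_sum_pivot hl hD8 hF hbud hL hX hmany
    calc I.numDraws F.A.length * I.vf l c B st.length F
        = ∑ _t ∈ range I.k, ∑ _e ∈ range (2 * I.Δ + 1), (F.A.length : ℝ) ^ I.m *
            (F.A.length * I.vf l c B st.length F) := by
          simp only [Finset.sum_const, Finset.card_range, nsmul_eq_mul, numDraws]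
          push_cast
          ring
      _ ≤ ∑ _t ∈ range I.k, ∑ _e ∈ range (2 * I.Δ + 1), (F.A.length : ℝ) ^ I.m *
            ∑ z ∈ range F.A.length, I.vf l c B st.length (I.pivot F z) := by gcongr
      _ = I.sumDraws F.A.length fun _ _ z _ => I.vf l c B st.length (I.pivot F z) := by
          unfold sumDraws
          simp only [Finset.sum_const, card_tuples, Finset.card_range, nsmul_eq_mul,
            Finset.mul_sum]
          push_cast
          rfl
      _ ≤ _ := I.sumDraws_mono fun t e z g _ => (le_max_right _ _).trans I.sv_visit_ge
  · obtain ⟨t, ht, e, he, G, hG, hcard, hgood⟩ := I.exists_good_draws l c hm hΔ hl hmiss hX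
      (not_lt.1 hmany)
    -- A good draw lowers the rank, so the rank is positive, and `rank + depth ≤ R` leaves room for
    -- a child.
    have hr : st.length < I.R := by
      obtain ⟨hrank, -⟩ := hL
      have hGne : G.Nonempty := by
        rw [← Finset.card_pos]
        by_contra h0
        have h0' : G.card = 0 := by omega
        rw [h0', mul_zero] at hcard
        have := Nat.pow_pos (n := I.m) hF.1
        omega
      obtain ⟨g, hg⟩ := hGne
      have := (hgood g hg).2
      omega
    -- A fresh node has `bud = b0 = 20 |A|`, hence the ratio `(20 - 10) / 20 = 1 / 2`.
    have hch : ∀ g ∈ G, I.q ^ (I.R - (st.length + 1)) * (1 / 2)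
        ≤ I.vf l c B (st.length + 1) (I.child F t e g) := by
      intro g hg
      unfold vf
      rw [if_pos (Lucky.child I hL (hgood g hg).1 (hgood g hg).2)]
      refine mul_le_mul_of_nonneg_left (le_max_of_le_right ?_) (by positivity)
      have hA : (I.child F t e g).A = F.A := rfl
      have hbu : (I.child F t e g).bud = 20 * F.A.length := rfl
      have hb0 : (I.child F t e g).b0 = 20 * F.A.length := rfl
      rw [hA, hbu, hb0]
      have : (0 : ℝ) < F.A.length := by exact_mod_cast hF.1
      rw [le_div_iff₀ (by push_cast; positivity)]
      push_cast
      linarith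
    have hnn : ∀ t e z g, 0 ≤ I.sv l c B (I.visit F st tr best t e z g).stack :=
      fun t e z g => I.sv_nonneg B _
    have h1 : (F.A.length : ℝ) * (G.card * (I.q ^ (I.R - (st.length + 1)) * (1 / 2)))
        ≤ I.sumDraws F.A.length fun t e z g => I.sv l c B (I.visit F st tr best t e z g).stack := by
      unfold sumDraws
      refine le_trans ?_ (Finset.single_le_sum (fun t _ => Finset.sum_nonneg fun e _ =>
        Finset.sum_nonneg fun z _ => Finset.sum_nonneg fun g _ => hnn t e z g)
        (Finset.mem_range.2 ht))
      refine le_trans ?_ (Finset.single_le_sum (fun e _ =>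
        Finset.sum_nonneg fun z _ => Finset.sum_nonneg fun g _ => hnn t e z g)
        (Finset.mem_range.2 he))
      have h2 : ∀ z ∈ range F.A.length, G.card * (I.q ^ (I.R - (st.length + 1)) * (1 / 2))
          ≤ ∑ g ∈ tuples (range F.A.length) I.m,
            I.sv l c B (I.visit F st tr best t e z g).stack := by
        intro z _
        refine le_trans ?_ (Finset.sum_le_sum_of_subset_of_nonneg hG fun g _ _ => hnn t e z g)
        rw [← nsmul_eq_mul]
        exact Finset.card_nsmul_le_sum _ _ _ fun g hg =>
          (hch g hg).trans (I.vf_child_le_sv_visit hr)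
      have h3 := Finset.sum_le_sum h2
      rwa [Finset.sum_const, Finset.card_range, nsmul_eq_mul] at h3
    refine le_trans ?_ h1
    have hvf := I.vf_le (l := l) (c := c) (B := B) (r := st.length) hF
    have hpow : I.q ^ (I.R - st.length) = I.q ^ (I.R - (st.length + 1)) * I.q := by
      rw [← pow_succ]
      congr 1
      omega
    have hBp : (1 : ℝ) ≤ I.Bp := by exact_mod_cast I.one_le_Bp hk hΔ hm
    have hcard' : (F.A.length : ℝ) ^ I.m ≤ 2 * (2 * I.Δ * I.k * I.D) ^ I.m * G.card := by
      exact_mod_cast hcard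
    -- The good draws have one label, one mode, any pivot and samples in `G`; they make up a share
    -- of at least `1 / Bp`. The initial ratio `1 / 2` of the child accounts for the `2` in `q = 1 /
    -- (2 Bp)`.
    have hnum : I.numDraws F.A.length * I.q ≤ F.A.length * (G.card * (1 / 2)) := by
      unfold numDraws q
      rw [mul_one_div, div_le_iff₀ (by positivity)]
      have hBpe : (I.Bp : ℝ) = 2 * I.k * (2 * I.Δ + 1) * (2 * I.Δ * I.k * I.D) ^ I.m := by
        unfold Bp
        push_cast
        ring
      rw [hBpe]
      calc (I.k : ℝ) * (2 * I.Δ + 1) * F.A.length * (F.A.length : ℝ) ^ I.m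
          ≤ (I.k : ℝ) * (2 * I.Δ + 1) * F.A.length *
            (2 * (2 * I.Δ * I.k * I.D) ^ I.m * G.card) := by gcongr
        _ = _ := by ring
    have hnd : 0 ≤ I.numDraws F.A.length := by unfold numDraws; positivity
    calc I.numDraws F.A.length * I.vf l c B st.length F
        ≤ I.numDraws F.A.length * (I.q ^ (I.R - (st.length + 1)) * I.q) := by
          rw [← hpow]
          gcongr
      _ = I.q ^ (I.R - (st.length + 1)) * (I.numDraws F.A.length * I.q) := by ring
      _ ≤ I.q ^ (I.R - (st.length + 1)) * (F.A.length * (G.card * (1 / 2))) := by gcongr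
      _ = _ := by ring

/-- The expected value does not decrease. -/
theorem value_le_sumDraws {B : ℝ} {F : Frame} {st : List Frame} {tr : ℕ} {best : Option ℝ}
    (hm : 1 ≤ I.m) (hk : 1 ≤ I.k) (hΔ : 1 ≤ I.Δ) (hl : ∀ x, l x < I.k)
    (hmiss : ∀ x, ((range I.d).filter fun i => I.pt x i = none).card ≤ I.Δ)
    (hst : ∀ F' ∈ F :: st, Frame.Ok F') (hbud : F.A.length ≤ F.bud) :
    I.numDraws F.A.length * I.value l c B ⟨F :: st, tr, best⟩
      ≤ I.sumDraws F.A.length fun t e z g => I.value l c B (I.visit F st tr best t e z g) := by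
  have hF := hst F List.mem_cons_self
  have hnd : 0 ≤ I.numDraws F.A.length := by unfold numDraws; positivity
  have hw0 : 0 ≤ (1 - I.Q) ^ tr := pow_nonneg (sub_nonneg.2 I.Q_le_one) _
  have hval1 : I.value l c B ⟨F :: st, tr, best⟩ ≤ 1 := by
    unfold value
    split_ifs
    · exact le_rfl
    · have := I.sv_le_one (l := l) (c := c) (B := B) hst
      have := mul_nonneg (sub_nonneg.2 this) hw0
      dsimp only
      linarith
  by_cases hg : I.Good B (I.upd best F)
  · have h1 : ∀ t e z g, I.value l c B (I.visit F st tr best t e z g) = 1 := by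
      intro t e z g
      unfold value
      exact if_pos hg
    simp only [h1, sumDraws_const]
    gcongr
  · have hg' : ¬ I.Good B best := fun h => hg (Good.upd I h)
    have h1 := (I.sv_le_sumDraws (l := l) (c := c) (B := B) (st := st) (tr := tr) (best := best)
      hm hk hΔ hl hmiss hF hbud).resolve_left hg
    -- The best cost and the number of trials after a visit do not depend on the draws, so the value
    -- is an affine function of `sv` with the slope `(1 - Q) ^ tr ≥ 0`.
    have h2 : ∀ t e z g, I.value l c B (I.visit F st tr best t e z g)
        = (1 - (1 - I.Q) ^ tr) + (1 - I.Q) ^ tr *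
          I.sv l c B (I.visit F st tr best t e z g).stack := by
      intro t e z g
      unfold value
      refine (if_neg hg).trans ?_
      change 1 - (1 - _) * (1 - I.Q) ^ tr = _
      ring
    simp only [h2]
    rw [sumDraws_affine]
    have h3 : I.value l c B ⟨F :: st, tr, best⟩
        = (1 - (1 - I.Q) ^ tr) + (1 - I.Q) ^ tr * I.sv l c B (F :: st) := by
      unfold value
      rw [if_neg hg']
      ring
    rw [h3]
    have h4 := mul_le_mul_of_nonneg_left h1 hw0
    linarith

/-- The value does not change if a new trial is started. -/
theorem value_push {B : ℝ} {tr : ℕ} {best : Option ℝ} (hn : 1 ≤ I.n)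
    (hroot : I.Lucky l c B 0 I.root) :
    I.value l c B ⟨[], tr + 1, best⟩ ≤ I.value l c B ⟨[I.root], tr, best⟩ := by
  unfold value
  dsimp only
  split_ifs
  · exact le_rfl
  · have h : I.sv l c B [I.root] = I.Q := by
      have hn' : (0 : ℝ) < I.n := by exact_mod_cast hn
      have h1 : I.vf l c B 0 I.root = I.Q := by
        rw [vf, if_pos hroot, Q, Nat.sub_zero, div_eq_mul_inv (I.q ^ I.R)]
        congr 1
        have hA : I.root.A.length = I.n := List.length_range
        have hbu : I.root.bud = 20 * I.n := rfl
        have hb0 : I.root.b0 = 20 * I.n := rfl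
        rw [hA, hbu, hb0]
        push_cast
        rw [show (20 * (I.n : ℝ) - 10 * I.n) / (20 * I.n) = 2⁻¹ by field_simp; norm_num]
        exact max_eq_right (by norm_num)
      change max (I.sv l c B []) (I.vf l c B 0 I.root) = I.Q
      rw [h1]
      exact max_eq_right I.Q_nonneg
    rw [h]
    simp only [sv, sub_zero, one_mul, pow_succ]
    linarith

/-- The value does not change if a node without budget is left. -/
theorem value_pop {B : ℝ} {F : Frame} {st : List Frame} {tr : ℕ} {best : Option ℝ}
    (hbud : F.bud < F.A.length) :
    I.value l c B ⟨F :: st, tr, best⟩ ≤ I.value l c B ⟨st, tr, best⟩ := by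
  have h : I.vf l c B st.length F = 0 := by
    unfold vf
    split_ifs
    · rw [max_eq_left, mul_zero]
      refine div_nonpos_of_nonpos_of_nonneg ?_ (Nat.cast_nonneg _)
      have : (F.bud : ℝ) ≤ F.A.length := by exact_mod_cast hbud.le
      have : (0 : ℝ) ≤ F.A.length := Nat.cast_nonneg _
      linarith
    · rfl
  have h2 : I.sv l c B (F :: st) = I.sv l c B st := by
    rw [sv, h]
    exact max_eq_left (I.sv_nonneg B st)
  unfold value
  rw [h2]

theorem value_end {B : ℝ} {best : Option ℝ} (h : ¬ I.Good B best) :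
    I.value l c B ⟨[], 0, best⟩ = 0 := by
  simp [value, h, sv]

/-- The initial value is at least `1 / 2` if there are sufficiently many trials. -/
theorem half_le_value {B : ℝ} {N : ℕ} (hk : 1 ≤ I.k) (hΔ : 1 ≤ I.Δ) (hm : 1 ≤ I.m)
    (hN : 2 * (2 * I.Bp) ^ I.R ≤ N) : 1 / 2 ≤ I.value l c B ⟨[], N, none⟩ := by
  have hg : ¬ I.Good B none := by rintro ⟨b, hb, _⟩; simp at hb
  unfold value
  rw [if_neg hg]
  simp only [sv, sub_zero, one_mul]
  have hQ0 := I.Q_nonneg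
  have hQ1 := I.Q_le_one
  have hBp : (1 : ℝ) ≤ I.Bp := by exact_mod_cast I.one_le_Bp hk hΔ hm
  have hNQ : 1 ≤ N * I.Q := by
    have h1 : (2 * (2 * I.Bp) ^ I.R : ℝ) ≤ N := by exact_mod_cast hN
    have h2 : (2 * (2 * I.Bp) ^ I.R : ℝ) * I.Q = 1 := by
      unfold Q q
      rw [div_pow, one_pow]
      field_simp
    calc (1 : ℝ) = (2 * (2 * I.Bp) ^ I.R : ℝ) * I.Q := h2.symm
      _ ≤ _ := by gcongr
  -- Bernoulli's inequality yields `(1 + Q) ^ N ≥ 2`, and `(1 - Q) (1 + Q) ≤ 1` turns this into `(1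
  -- - Q) ^ N ≤ 1 / 2`.
  have h1 : 1 + N * I.Q ≤ (1 + I.Q) ^ N := one_add_mul_le_pow (by linarith) N
  have h2 : (1 - I.Q) ^ N * (1 + I.Q) ^ N ≤ 1 := by
    rw [← mul_pow]
    refine pow_le_one₀ ?_ ?_
    · exact mul_nonneg (by linarith) (by linarith)
    · nlinarith
  have h3 : 0 ≤ (1 - I.Q) ^ N := pow_nonneg (by linarith) _
  have h4 : (1 - I.Q) ^ N * 2 ≤ 1 := by
    refine le_trans ?_ h2
    gcongr
    linarith
  linarith

end Inst

end MissingKMeans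

namespace MissingKMeans

open Finset

namespace Inst

variable (I : Inst) {l : ℕ → ℕ} {c : ℕ → ℕ → ℝ}

/-! ### The root -/

/-- The cost of a clustering. -/
noncomputable def cost (l : ℕ → ℕ) (c : ℕ → ℕ → ℝ) : ℝ :=
  ∑ x ∈ range I.n, ∑ i ∈ range I.d, sqd (I.pt x i) (some (c (l x) i))

theorem act_root {p : ℕ} (hp : p < I.n) : I.root.act p = p := by
  unfold Frame.act root
  rw [List.getD_eq_getElem _ _ (by simpa using hp), List.getElem_range]

theorem length_root : I.root.A.length = I.n := List.length_range

/-- At the root no coordinate is known and all weights are at most `1 + 16 / m`. This is the reason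
for the choice of `B`. -/
theorem lucky_root : I.Lucky l c ((1 + 16 / I.m) * I.cost l c) 0 I.root := by
  have hm0 : (0 : ℝ) ≤ 16 / I.m := by positivity
  have hRef : I.Ref l c I.root ≤ (1 + 16 / I.m) * I.cost l c := by
    unfold Ref cost
    rw [Finset.mul_sum, I.length_root]
    refine Finset.sum_le_sum fun x hx => ?_
    rw [I.act_root (Finset.mem_range.1 hx), refp, Finset.mul_sum]
    refine Finset.sum_le_sum fun i _ => ?_
    unfold term
    cases I.pt x i with
    | none => simp [sqd]
    | some y =>
      refine mul_le_mul_of_nonneg_right ?_ (sq_nonneg _)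
      unfold wt
      split_ifs
      · gcongr
        norm_num
      · exact le_rfl
  refine ⟨?_, hRef, 0, le_rfl, fun p _ _ => I.dv_nonneg _ _, ?_, ?_⟩
  · unfold rank R
    rw [add_zero]
    calc ∑ t ∈ range I.k, min (2 * I.Δ + 1) (I.unk I.root.u t).card
        ≤ ∑ _t ∈ range I.k, (2 * I.Δ + 1) := Finset.sum_le_sum fun _ _ => min_le_left _ _
      _ = _ := by simp
  · have := I.Ref_nonneg (l := l) (c := c) I.root
    rw [mul_zero]
    linarith
  · have hacc : I.root.acc = 0 := rfl
    rw [hacc]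
    have h32 : (0 : ℝ) ≤ 32 / I.D := by positivity
    have := mul_le_mul_of_nonneg_right hRef (show (0 : ℝ) ≤ 1 + 32 / I.D by linarith)
    simp only [mul_zero, sub_zero, zero_add, Nat.cast_zero, add_zero, mul_one]
    linarith

theorem ok_root (hn : 1 ≤ I.n) : Frame.Ok I.root := by
  refine ⟨by rw [I.length_root]; exact hn, le_rfl, ?_⟩
  change 0 < 20 * I.n
  omega

/-- The threshold is at most `1 + 33 / m` times the cost of the reference solution. -/
theorem thr_le (hm : 1 ≤ I.m) {o : ℝ} (ho : 0 ≤ o) :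
    I.thr ((1 + 16 / I.m) * o) ≤ (1 + 33 / I.m) * o := by
  have hmR : (1 : ℝ) ≤ I.m := by exact_mod_cast hm
  unfold thr
  -- The value of `D` is chosen so that the losses of all levels add up to a relative error of `1 /
  -- m`.
  have h1 : (32 : ℝ) / I.D * (I.R + 2) = 1 / I.m := by
    unfold D
    push_cast
    have : (0 : ℝ) < I.R + 2 := by positivity
    field_simp
  rw [h1, mul_right_comm]
  refine mul_le_mul_of_nonneg_right ?_ ho
  have h2 : (1 : ℝ) / I.m ≤ 1 := by rw [div_le_one (by linarith)]; exact hmR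
  have h3 : (0 : ℝ) ≤ 1 / I.m := by positivity
  have h4 : (16 : ℝ) / I.m = 16 * (1 / I.m) := by ring
  have h5 : (33 : ℝ) / I.m = 33 * (1 / I.m) := by ring
  rw [h4, h5]
  nlinarith

/-! ### The costs are upper bounds -/

/-- Completely known centers. -/
def full (v : ℕ → ℕ → ℝ) : Centers := fun t i => some (v t i)

/-- The centers `v` extend the partial centers `u`. -/
def Ext (v : ℕ → ℕ → ℝ) (u : Centers) : Prop :=
  ∀ t < I.k, ∀ i < I.d, ∀ w, u t i = some w → v t i = w

/-- The active points are points, and the cost of the other points is at most `acc`. -/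
def Safe (F : Frame) : Prop :=
  (∀ p < F.A.length, F.act p < I.n) ∧ ∀ v, I.Ext v F.u →
    ∑ x ∈ range I.n, I.dv (full v) x
      ≤ F.acc + ∑ p ∈ range F.A.length, I.dv (full v) (F.act p)

/-- An available center is already final on all entries of `x`, so an extension keeps its distance
to `x`; further available centers can only lower the minimum. -/
theorem dv_full_le {v : ℕ → ℕ → ℝ} {u : Centers} (hv : I.Ext v u) {x : ℕ} (h : I.Has u x) :
    I.dv (full v) x ≤ I.dv u x := by
  obtain ⟨t, ht⟩ := Option.ne_none_iff_exists'.1 h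
  obtain ⟨h1, h2, -⟩ := I.near_some ht
  have h3 : I.Avail (full v) t x := fun i _ _ => by simp [full]
  refine (I.dv_le_of_avail h1 h3).trans ?_
  unfold dv
  rw [ht]
  refine Finset.sum_le_sum fun i hi => ?_
  have hi' := Finset.mem_range.1 hi
  cases hp : I.pt x i with
  | none => simp [sqd]
  | some y =>
    obtain ⟨w, hw⟩ := Option.ne_none_iff_exists'.1 (h2 i hi' (by simp [hp]))
    rw [hw, full, hv t h1 i hi' w hw]

theorem Safe.root : I.Safe I.root := by
  refine ⟨fun p hp => ?_, fun v _ => ?_⟩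
  · rw [I.length_root] at hp
    rwa [I.act_root hp]
  · rw [I.length_root]
    have : I.root.acc = 0 := rfl
    rw [this, zero_add]
    refine Finset.sum_le_sum fun x hx => ?_
    rw [I.act_root (Finset.mem_range.1 hx)]

/-- Only unknown coordinates are filled in, so every extension of the new centers extends the old
ones. -/
theorem Safe.child {F : Frame} (h : I.Safe F) (t e : ℕ) (g : Fin I.m → ℕ) :
    I.Safe (I.child F t e g) := by
  refine ⟨h.1, fun v hv => h.2 v fun t' ht' i hi w hw => hv t' ht' i hi w ?_⟩
  change I.freeze F t e g t' i = some w
  unfold freeze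
  rw [if_neg]
  · exact hw
  · rintro ⟨rfl, h', -⟩
    rw [h'] at hw
    simp at hw

/-- Only points with an available center are removed, and the distance they are charged stays an
upper bound by `dv_full_le`. -/
theorem Safe.pivot {F : Frame} (h : I.Safe F) (z : ℕ) : I.Safe (I.pivot F z) := by
  classical
  by_cases ha : I.Accept F z
  · have hu : (I.pivot F z).u = F.u := by rw [Inst.pivot, if_pos ha]
    have hacc : (I.pivot F z).acc
        = F.acc + ∑ p ∈ (range F.A.length).filter (I.Low F z), I.dv F.u (F.act p) := by
      rw [Inst.pivot, if_pos ha]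
    refine ⟨fun p hp => ?_, fun v hv => ?_⟩
    · obtain ⟨q, hq, -, hpq⟩ := I.exists_of_act_pivot ha hp
      rw [hpq]
      exact h.1 q hq
    · rw [hu] at hv
      have h1 := h.2 v hv
      have h2 := I.sum_pivot_of_accept ha (I.dv (full v))
      have h3 : ∑ p ∈ (range F.A.length).filter (I.Low F z), I.dv (full v) (F.act p)
          ≤ ∑ p ∈ (range F.A.length).filter (I.Low F z), I.dv F.u (F.act p) :=
        Finset.sum_le_sum fun p hp => I.dv_full_le hv (Finset.mem_filter.1 hp).2.1
      rw [hacc]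
      linarith
  · rw [Inst.pivot, if_neg ha]
    exact h

theorem Safe.cand {F : Frame} (h : I.Safe F) (hh : ∀ p < F.A.length, I.Has F.u (F.act p))
    {v : ℕ → ℕ → ℝ} (hv : I.Ext v F.u) :
    ∑ x ∈ range I.n, I.dv (full v) x ≤ I.candCost F := by
  refine (h.2 v hv).trans ?_
  unfold candCost
  gcongr with p hp
  exact I.dv_full_le hv (hh p (Finset.mem_range.1 hp))

/-! ### The bound for the running time -/

/-- The bound for the number of steps that the nodes of a stack take. -/
def spot (κ : ℕ) : List Frame → ℕ
  | [] => 0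
  | F :: st => spot κ st + F.bud * (κ * 22 ^ (I.R - st.length)) + κ

/-- The bound for the number of steps of the search. -/
def potential (κ : ℕ) (σ : State) : ℕ :=
  I.spot κ σ.stack + σ.tr * (κ * I.n + 20 * I.n * (κ * 22 ^ I.R) + κ)

theorem potential_push (κ tr : ℕ) (best : Option ℝ) :
    I.potential κ ⟨[I.root], tr, best⟩ + κ * I.n ≤ I.potential κ ⟨[], tr + 1, best⟩ := by
  unfold potential
  have h : I.root.bud = 20 * I.n := rfl
  simp only [spot, h, List.length_nil, Nat.sub_zero]
  rw [add_mul tr 1]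
  omega

theorem potential_pop (κ : ℕ) (F : Frame) (st : List Frame) (tr : ℕ) (best : Option ℝ) :
    I.potential κ ⟨st, tr, best⟩ + κ ≤ I.potential κ ⟨F :: st, tr, best⟩ := by
  unfold potential
  simp only [spot]
  omega

theorem bud_pivot (F : Frame) (z : ℕ) : (I.pivot F z).bud = F.bud - F.A.length := by
  unfold pivot
  split_ifs <;> rfl

/-- With `w = κ * 22 ^ (R - depth - 1)`, spending the budget `|A|` frees `22 |A| w`. The budget of
the child takes `20 |A| w`, its extra `κ` at most `|A| w`, and the last `|A| w` pays for the visit.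
-/
theorem potential_visit {κ : ℕ} {F : Frame} {st : List Frame} {tr : ℕ} {best : Option ℝ}
    (hF : Frame.Ok F) (hbud : F.A.length ≤ F.bud) (t e z : ℕ) (g : Fin I.m → ℕ) :
    I.potential κ (I.visit F st tr best t e z g) + κ * F.A.length
      ≤ I.potential κ ⟨F :: st, tr, best⟩ := by
  have ha := hF.1
  obtain ⟨b, hb⟩ := Nat.exists_eq_add_of_le hbud
  unfold potential visit
  dsimp only
  have hp : (I.pivot F z).bud = b := by
    rw [bud_pivot]
    omega
  split_ifs with h
  · have hc : (I.child F t e g).bud = 20 * F.A.length := rfl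
    obtain ⟨j, hj⟩ := Nat.exists_eq_add_of_lt h
    have h1 : I.R - st.length = j + 1 := by omega
    have h2 : I.R - (st.length + 1) = j := by omega
    simp only [spot, hp, hc, List.length_cons, h1, h2, hb]
    have h3 : 1 ≤ 22 ^ j := Nat.one_le_pow _ _ (by norm_num)
    have h4 : κ ≤ F.A.length * (κ * 22 ^ j) := by
      calc κ = 1 * (κ * 1) := by ring
        _ ≤ F.A.length * (κ * 22 ^ j) := by gcongr; exact ha
    have h5 : κ * F.A.length ≤ F.A.length * (κ * 22 ^ j) := by
      calc κ * F.A.length = F.A.length * (κ * 1) := by ring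
        _ ≤ F.A.length * (κ * 22 ^ j) := by gcongr
    have h6 : (F.A.length + b) * (κ * 22 ^ (j + 1))
        = 22 * (F.A.length * (κ * 22 ^ j)) + b * (κ * 22 ^ (j + 1)) := by
      rw [pow_succ]
      ring
    have h7 : 20 * F.A.length * (κ * 22 ^ j) = 20 * (F.A.length * (κ * 22 ^ j)) := by ring
    omega
  · simp only [spot, hp, hb]
    have h3 : 1 ≤ 22 ^ (I.R - st.length) := Nat.one_le_pow _ _ (by norm_num)
    have h5 : κ * F.A.length ≤ F.A.length * (κ * 22 ^ (I.R - st.length)) := by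
      calc κ * F.A.length = F.A.length * (κ * 1) := by ring
        _ ≤ F.A.length * (κ * 22 ^ (I.R - st.length)) := by gcongr
    rw [add_mul]
    omega

end Inst

end MissingKMeans

namespace RealRAM

/-! ### Symbolic execution -/

attribute [simp] IExp.eval RExp.eval BExp.Holds

@[simp]
theorem Store.writeI_ints (s : Store) (a i v b j : ℕ) :
    (s.writeI a i v).ints b j = if b = a then (if j = i then v else s.ints a j) else s.ints b j := by
  by_cases h : b = a
  · subst h
    simp [Store.writeI, Function.update_apply]
  · simp [Store.writeI, h]

@[simp]
theorem Store.writeI_reals (s : Store) (a i v : ℕ) : (s.writeI a i v).reals = s.reals := rfl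

@[simp]
theorem Store.writeR_ints (s : Store) (a i : ℕ) (v : ℝ) : (s.writeR a i v).ints = s.ints := rfl

@[simp]
theorem Store.writeR_reals (s : Store) (a i b j : ℕ) (v : ℝ) :
    (s.writeR a i v).reals b j
      = if b = a then (if j = i then v else s.reals a j) else s.reals b j := by
  by_cases h : b = a
  · subst h
    simp [Store.writeR, Function.update_apply]
  · simp [Store.writeR, h]

instance Cmd.decidableKeepsI (a : ℕ) : (c : Cmd) → Decidable (c.KeepsI a)
  | .skip => .isTrue trivial
  | .setI b _ _ => inferInstanceAs (Decidable (b ≠ a))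
  | .setR _ _ _ => .isTrue trivial
  | .rand b _ _ => inferInstanceAs (Decidable (b ≠ a))
  | .seq c c' => @instDecidableAnd _ _ (decidableKeepsI a c) (decidableKeepsI a c')
  | .ite _ c c' => @instDecidableAnd _ _ (decidableKeepsI a c) (decidableKeepsI a c')
  | .loop _ c => decidableKeepsI a c

instance Cmd.decidableKeepsR (a : ℕ) : (c : Cmd) → Decidable (c.KeepsR a)
  | .skip => .isTrue trivial
  | .setI _ _ _ => .isTrue trivial
  | .setR b _ _ => inferInstanceAs (Decidable (b ≠ a))
  | .rand _ _ _ => .isTrue trivial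
  | .seq c c' => @instDecidableAnd _ _ (decidableKeepsR a c) (decidableKeepsR a c')
  | .ite _ c c' => @instDecidableAnd _ _ (decidableKeepsR a c) (decidableKeepsR a c')
  | .loop _ c => decidableKeepsR a c

theorem Keeps.writeI (s : Store) (a i v : ℕ) :
    Keeps (.setI a (.lit 0) (.lit 0)) s (s.writeI a i v) :=
  ⟨fun _ hb => Function.update_of_ne (Ne.symm hb) _ _, fun _ _ => rfl⟩

theorem Keeps.writeR (s : Store) (a i : ℕ) (v : ℝ) :
    Keeps (.setR a (.lit 0) (.ofInt (.lit 0))) s (s.writeR a i v) :=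
  ⟨fun _ _ => rfl, fun _ hb => Function.update_of_ne (Ne.symm hb) _ _⟩

/-- The rule for sequences, with the information which arrays are kept by the first program. -/
theorem Ens.seq_of {c c' : Cmd} {s : Store} {τ τ' T : ℕ} {P P₁ : Store → Prop} (h : Ens c s τ P₁)
    (h' : ∀ s₁, Keeps c s s₁ → P₁ s₁ → Ens c' s₁ τ' P) (hT : τ + τ' + 1 ≤ T) :
    Ens (.seq c c') s T P :=
  (Ens.seq (h.conseq le_rfl h')).mono hT fun _ h => h

theorem Ens.le {c : Cmd} {s : Store} {τ T : ℕ} {P : Store → Prop} (h : Ens c s τ P)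
    (hT : τ ≤ T) : Ens c s T P :=
  h.mono hT fun _ h => h

/-- The address of the cell with offset `o` in the block with number `b` if the blocks have
length `w`. -/
def adr (w b o : ℕ) : ℕ := o + w * b

theorem adr_inj {w b o b' o' : ℕ} (ho : o < w) (ho' : o' < w) :
    adr w b o = adr w b' o' ↔ b = b' ∧ o = o' := by
  constructor
  · intro h
    unfold adr at h
    have hw : 0 < w := by omega
    have h1 := congrArg (· / w) h
    have h2 := congrArg (· % w) h
    simp only [Nat.add_mul_div_left _ _ hw, Nat.add_mul_mod_self_left, Nat.div_eq_of_lt ho,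
      Nat.div_eq_of_lt ho', Nat.mod_eq_of_lt ho, Nat.mod_eq_of_lt ho', zero_add] at h1 h2
    exact ⟨h1, h2⟩
  · rintro ⟨rfl, rfl⟩
    rfl

theorem adr_lt {w b o k : ℕ} (ho : o < w) (hb : b < k) : adr w b o < k * w := by
  unfold adr
  calc o + w * b < w + w * b := by omega
    _ = (b + 1) * w := by ring
    _ ≤ k * w := Nat.mul_le_mul_right _ hb

@[simp]
theorem adr_zero (w o : ℕ) : adr w 0 o = o := by simp [adr]

/-- The address of the cell `o` in the block `b` of length `w`. -/
def ix (w b o : IExp) : IExp := .add o (.mul w b)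

@[simp]
theorem eval_ix (s : Store) (w b o : IExp) :
    (ix w b o).eval s = adr (w.eval s) (b.eval s) (o.eval s) := rfl

end RealRAM

namespace MissingKMeans

open Finset RealRAM

/-! ### The program

The memory is used as follows.
Integer arrays: `0` the parameters, `1` the input, `2` the labels of the nearest centers, `3` the
number of samples, `4` the maximal depth, `5` the trials left, `6` the size of the stack, `7` the
numbers of active points of the frames, `8` their budgets, `9` their active points, `10` the flags
of their known center coordinates, `11` whether a center is available, `12` the samples, `13` to
`15` the other random choices, `16` to `19` loop counters, `20` to `26` auxiliary variables
(`25`: whether a solution is known), `27` the index of the top frame, `28` its number of active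
points.
Real arrays: `0` and `1` the input, `2` the best centers, `3` the accumulated costs of the frames,
`4` their center coordinates, `5` the squared distances to the nearest centers, `6` and `7`
auxiliary variables, `8` the cost of the best solution. -/

namespace Program

/-- The number of points. -/
abbrev nE : IExp := .get 0 (.lit 0)
/-- The dimension. -/
abbrev dE : IExp := .get 0 (.lit 1)
/-- The number of clusters. -/
abbrev kE : IExp := .get 0 (.lit 2)
/-- The bound for the number of missing entries. -/
abbrev ΔE : IExp := .get 0 (.lit 3)
/-- The active point at the position `p` of the frame `r`. -/
abbrev actE (r p : IExp) : IExp := .get 9 (ix nE r p)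
/-- The address of a coordinate of a center of the frame `r`. -/
abbrev cenA (r t i : IExp) : IExp := ix (.mul kE dE) r (ix dE t i)

/-- Compute the availability of the center `t` for the point at the position `p`, and the squared
distance. -/
def distCode : Cmd :=
  .seq (setIv 20 (.lit 1)) (.seq (setRv 6 (.ofInt (.lit 0)))
    (forTo 18 dE (.ite (.ltI (.lit 0) (.get 1 (ix dE (actE (iv 27) (iv 16)) (iv 18))))
      (.ite (.ltI (.lit 0) (.get 10 (cenA (iv 27) (iv 17) (iv 18))))
        (setRv 6 (.add (rv 6) (.mul
          (.sub (.get 1 (ix dE (actE (iv 27) (iv 16)) (iv 18))) (.get 4 (cenA (iv 27) (iv 17) (iv 18))))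
          (.sub (.get 1 (ix dE (actE (iv 27) (iv 16)) (iv 18)))
            (.get 4 (cenA (iv 27) (iv 17) (iv 18)))))))
        (setIv 20 (.lit 0)))
      .skip)))

/-- Compute the nearest available centers of all active points of the top frame. -/
def nearCode : Cmd :=
  forTo 16 (iv 28) (.seq (.setI 11 (iv 16) (.lit 0)) (.seq (.setR 5 (iv 16) (.ofInt (.lit 0)))
    (forTo 17 kE (.seq distCode
      (.ite (.and (.ltI (.lit 0) (iv 20))
          (.not (.and (.ltI (.lit 0) (.get 11 (iv 16))) (.not (.ltR (rv 6) (.get 5 (iv 16)))))))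
        (.seq (.setI 11 (iv 16) (.lit 1)) (.seq (.setR 5 (iv 16) (rv 6)) (.setI 2 (iv 16) (iv 17))))
        .skip)))))

/-- Compare the solution of the top frame with the best one. -/
def candCode : Cmd :=
  .seq (setIv 23 (.lit 1)) (.seq (setRv 7 (.get 3 (iv 27)))
    (.seq (forTo 16 (iv 28) (.seq (setRv 7 (.add (rv 7) (.get 5 (iv 16))))
        (.ite (.ltI (.lit 0) (.get 11 (iv 16))) .skip (setIv 23 (.lit 0)))))
      (.ite (.and (.ltI (.lit 0) (iv 23))
          (.not (.and (.ltI (.lit 0) (iv 25)) (.not (.ltR (rv 7) (rv 8))))))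
        (.seq (setIv 25 (.lit 1)) (.seq (setRv 8 (rv 7))
          (forTo 19 (.mul kE dE) (.setR 2 (iv 19) (.get 4 (ix (.mul kE dE) (iv 27) (iv 19)))))))
        .skip)))

/-- Write a copy of the top frame above it. -/
def copyCode : Cmd :=
  .seq (.setI 7 (.add (iv 27) (.lit 1)) (iv 28))
    (.seq (.setI 8 (.add (iv 27) (.lit 1)) (.mul (.lit 20) (iv 28)))
      (.seq (.setR 3 (.add (iv 27) (.lit 1)) (.get 3 (iv 27)))
        (.seq (forTo 16 (iv 28)
            (.setI 9 (ix nE (.add (iv 27) (.lit 1)) (iv 16)) (actE (iv 27) (iv 16))))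
          (forTo 19 (.mul kE dE)
            (.seq (.setI 10 (ix (.mul kE dE) (.add (iv 27) (.lit 1)) (iv 19))
                (.get 10 (ix (.mul kE dE) (iv 27) (iv 19))))
              (.setR 4 (ix (.mul kE dE) (.add (iv 27) (.lit 1)) (iv 19))
                (.get 4 (ix (.mul kE dE) (iv 27) (iv 19)))))))))

/-- The number of samples that specify the coordinate `i`, and their sum. -/
def sumCode : Cmd :=
  .seq (setIv 22 (.lit 0)) (.seq (setRv 7 (.ofInt (.lit 0)))
    (forTo 19 (iv 3) (.seq
      (setIv 22 (.add (iv 22) (.get 1 (ix dE (actE (iv 27) (.get 12 (iv 19))) (iv 18)))))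
      (setRv 7 (.add (rv 7) (.get 1 (ix dE (actE (iv 27) (.get 12 (iv 19))) (iv 18))))))))

/-- The condition under which a coordinate is estimated. -/
def fixE : BExp :=
  .not (.and (.not (.and (.ltI (iv 14) (.lit 1)) (.not (.ltI (.mul (.lit 2) (iv 22)) (iv 3)))))
    (.not (.and (.ltI (.lit 0) (iv 14)) (.and (.not (.ltI (iv 14) (iv 21)))
      (.and (.not (.ltI (iv 21) (iv 14))) (.ltI (.lit 0) (iv 22)))))))

/-- Estimate coordinates of a center in the frame above the top frame. -/
def freezeCode : Cmd :=
  .seq (setIv 21 (.lit 0)) (forTo 18 dE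
    (.ite (.ltI (.lit 0) (.get 10 (cenA (iv 27) (iv 13) (iv 18)))) .skip
      (.seq (setIv 21 (.add (iv 21) (.lit 1))) (.seq sumCode
        (.ite fixE
          (.seq (.setI 10 (cenA (.add (iv 27) (.lit 1)) (iv 13) (iv 18)) (.lit 1))
            (.setR 4 (cenA (.add (iv 27) (.lit 1)) (iv 13) (iv 18)) (.div (rv 7) (.ofInt (iv 22)))))
          .skip)))))

/-- The position `p` is not above the pivot. -/
def lowE : BExp :=
  .and (.ltI (.lit 0) (.get 11 (iv 16)))
    (.and (.not (.ltR (.get 5 (iv 15)) (.get 5 (iv 16))))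
      (.not (.and (.not (.ltR (.get 5 (iv 16)) (.get 5 (iv 15)))) (.ltI (iv 15) (iv 16)))))

/-- Count the positions above the pivot. -/
def countCode : Cmd :=
  .seq (setIv 24 (.lit 0))
    (forTo 16 (iv 28) (.ite lowE .skip (setIv 24 (.add (iv 24) (.lit 1)))))

/-- Remove the positions that are not above the pivot. -/
def compactCode : Cmd :=
  .seq (setIv 26 (.lit 0)) (.seq
    (forTo 16 (iv 28) (.ite lowE
      (.setR 3 (iv 27) (.add (.get 3 (iv 27)) (.get 5 (iv 16))))
      (.seq (.setI 9 (ix nE (iv 27) (iv 26)) (actE (iv 27) (iv 16)))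
        (setIv 26 (.add (iv 26) (.lit 1))))))
    (.setI 7 (iv 27) (iv 26)))

/-- Remove points from the top frame if the pivot is good. -/
def pivotCode : Cmd :=
  .seq countCode (.seq
    (.ite (.and (.ltI (.lit 0) (.get 11 (iv 15)))
        (.and (.not (.ltI (.mul (.lit 4) (iv 24)) (iv 28)))
          (.not (.ltI (.mul (.lit 3) (iv 28)) (.mul (.lit 4) (iv 24))))))
      compactCode .skip)
    (.setI 8 (iv 27) (.sub (.get 8 (iv 27)) (iv 28))))

/-- The deterministic part of the visit of a node. -/
def workCode : Cmd :=
  .seq nearCode (.seq candCode (.seq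
    (.ite (.ltI (iv 27) (iv 4))
      (.seq copyCode (.seq freezeCode (setIv 6 (.add (iv 6) (.lit 1))))) .skip)
    pivotCode))

/-- Draw the samples. -/
def sampleCode : Cmd := forTo 19 (iv 3) (.rand 12 (iv 19) (.sub (iv 28) (.lit 1)))

/-- The visit of a node. -/
def visitCode : Cmd :=
  .seq (.rand 13 (.lit 0) (.sub kE (.lit 1))) (.seq (.rand 14 (.lit 0) (.mul (.lit 2) ΔE))
    (.seq (.rand 15 (.lit 0) (.sub (iv 28) (.lit 1))) (.seq sampleCode workCode)))

/-- Start a trial. -/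
def pushCode : Cmd :=
  .seq (setIv 5 (.sub (iv 5) (.lit 1))) (.seq (setIv 7 nE) (.seq (setIv 8 (.mul (.lit 20) nE))
    (.seq (setRv 3 (.ofInt (.lit 0))) (.seq (forTo 16 nE (.setI 9 (iv 16) (iv 16)))
      (.seq (forTo 19 (.mul kE dE) (.seq (.setI 10 (iv 19) (.lit 0))
          (.setR 4 (iv 19) (.ofInt (.lit 0)))))
        (setIv 6 (.lit 1)))))))

/-- One pass of the search. -/
def bodyCode : Cmd :=
  .ite (.ltI (.lit 0) (iv 6))
    (.seq (setIv 27 (.sub (iv 6) (.lit 1))) (.seq (setIv 28 (.get 7 (iv 27)))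
      (.ite (.ltI (.get 8 (iv 27)) (iv 28)) (setIv 6 (.sub (iv 6) (.lit 1))) visitCode)))
    pushCode

/-- The search. -/
def searchCode : Cmd := .loop (.ltI (.lit 0) (.add (iv 6) (iv 5))) bodyCode

end Program

open Program

/-! ### The representation of the state in the memory -/

/-- A flag and a value represent an entry. -/
def RepO (f : ℕ) (v : ℝ) (o : Option ℝ) : Prop := f = (o.elim 0 fun _ => 1) ∧ v = o.getD 0

/-- The memory contains the instance. -/
structure Consts (I : Inst) (s : Store) : Prop where
  n : s.ints 0 0 = I.n
  d : s.ints 0 1 = I.d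
  k : s.ints 0 2 = I.k
  Δ : s.ints 0 3 = I.Δ
  m : s.ints 3 0 = I.m
  R : s.ints 4 0 = I.R
  pt : ∀ x < I.n, ∀ i < I.d,
    RepO (s.ints 1 (adr I.d x i)) (s.reals 1 (adr I.d x i)) (I.pt x i)

theorem Consts.keeps {I : Inst} {s s' : Store} {c : Cmd} (h : Consts I s) (hk : Keeps c s s')
    (hc : (c.KeepsI 0 ∧ c.KeepsI 1 ∧ c.KeepsI 3 ∧ c.KeepsI 4 ∧ c.KeepsR 1) := by decide) :
    Consts I s' := by
  have h0 := hk.1 0 hc.1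
  have h1 := hk.1 1 hc.2.1
  have h3 := hk.1 3 hc.2.2.1
  have h4 := hk.1 4 hc.2.2.2.1
  have h5 := hk.2 1 hc.2.2.2.2
  constructor <;> try simp only [h0, h1, h3, h4, h5]
  exacts [h.n, h.d, h.k, h.Δ, h.m, h.R, h.pt]

/-- The address of a coordinate of a center of the frame `r`. -/
abbrev Inst.cen (I : Inst) (r t i : ℕ) : ℕ := adr (I.k * I.d) r (adr I.d t i)

/-- The memory contains the frame `F` with the index `r`. -/
structure RepFrame (I : Inst) (s : Store) (r : ℕ) (F : Frame) : Prop where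
  cnt : s.ints 7 r = F.A.length
  bud : s.ints 8 r = F.bud
  acc : s.reals 3 r = F.acc
  act : ∀ p < F.A.length, s.ints 9 (adr I.n r p) = F.act p
  cen : ∀ t < I.k, ∀ i < I.d, RepO (s.ints 10 (I.cen r t i)) (s.reals 4 (I.cen r t i)) (F.u t i)
  le : F.A.length ≤ I.n
  lt : ∀ p < F.A.length, F.act p < I.n

theorem RepFrame.keeps {I : Inst} {s s' : Store} {r : ℕ} {F : Frame} {c : Cmd}
    (h : RepFrame I s r F) (hk : Keeps c s s')
    (hc : (c.KeepsI 7 ∧ c.KeepsI 8 ∧ c.KeepsI 9 ∧ c.KeepsI 10 ∧ c.KeepsR 3 ∧ c.KeepsR 4) := by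
      decide) :
    RepFrame I s' r F := by
  have h7 := hk.1 7 hc.1
  have h8 := hk.1 8 hc.2.1
  have h9 := hk.1 9 hc.2.2.1
  have h10 := hk.1 10 hc.2.2.2.1
  have h3 := hk.2 3 hc.2.2.2.2.1
  have h4 := hk.2 4 hc.2.2.2.2.2
  constructor <;> try simp only [h7, h8, h9, h10, h3, h4]
  exacts [h.cnt, h.bud, h.acc, h.act, h.cen, h.le, h.lt]

/-- The frame `F` with the index `r` is the top frame. -/
structure Cur (I : Inst) (s : Store) (r : ℕ) (F : Frame) : Prop extends
    Consts I s, RepFrame I s r F where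
  top : s.ints 27 0 = r
  len : s.ints 28 0 = F.A.length

theorem Cur.keeps {I : Inst} {s s' : Store} {r : ℕ} {F : Frame} {c : Cmd}
    (h : Cur I s r F) (hk : Keeps c s s')
    (hc : (c.KeepsI 0 ∧ c.KeepsI 1 ∧ c.KeepsI 3 ∧ c.KeepsI 4 ∧ c.KeepsR 1) := by decide)
    (hc' : (c.KeepsI 7 ∧ c.KeepsI 8 ∧ c.KeepsI 9 ∧ c.KeepsI 10 ∧ c.KeepsR 3 ∧ c.KeepsR 4) := by
      decide)
    (hc'' : (c.KeepsI 27 ∧ c.KeepsI 28) := by decide) :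
    Cur I s' r F where
  toConsts := h.toConsts.keeps hk hc
  toRepFrame := h.toRepFrame.keeps hk hc'
  top := by rw [hk.1 27 hc''.1, h.top]
  len := by rw [hk.1 28 hc''.2, h.len]

end MissingKMeans

set_option linter.unusedSimpArgs false

namespace MissingKMeans

open Finset RealRAM Program

/-! ### Nearest centers -/

theorem ens_distCode {I : Inst} {s : Store} {r p t : ℕ} {F : Frame} (h : Cur I s r F)
    (hp : s.ints 16 0 = p) (ht : s.ints 17 0 = t) (hpa : p < F.A.length) (htk : t < I.k) :
    Ens distCode s (I.d * 6 + 7) fun s' =>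
      (0 < s'.ints 20 0 ↔ I.Avail F.u t (F.act p)) ∧ s'.reals 6 0 = I.dist F.u t (F.act p) := by
  refine Ens.mono (Ens.seq (Ens.setI (Ens.seq (Ens.setR (Ens.forTo (M := I.d) (τ := 3)
    (fun j s' => (0 < s'.ints 20 0 ↔ ∀ i < j, I.pt (F.act p) i ≠ none → F.u t i ≠ none) ∧
      s'.reals 6 0 = ∑ i ∈ range j, sqd (I.pt (F.act p) i) (F.u t i))
    (by decide) ?_ ?_ ?_ ?_))))) (by omega) fun _ h => h
  · intro s' hk
    have hC : Cur I s' r F :=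
      ((h.keeps (.writeI _ _ _ _)).keeps (.writeR _ _ _ _)).keeps hk
    exact hC.d
  · simp
  · intro j s' hj hk hjs hI
    have hC : Cur I s' r F :=
      ((h.keeps (.writeI _ _ _ _)).keeps (.writeR _ _ _ _)).keeps hk
    have e16 : s'.ints 16 0 = p := by simp [hk.1 16 (by decide), hp]
    have e17 : s'.ints 17 0 = t := by simp [hk.1 17 (by decide), ht]
    obtain ⟨ha, hb⟩ := hC.pt (F.act p) (h.lt p hpa) j hj
    obtain ⟨hc, hd⟩ := hC.cen t htk j hj
    have hact := hC.act p hpa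
    obtain ⟨h1, h2⟩ := hI
    refine Ens.ite (fun hs => Ens.ite (fun hs' => Ens.setR ?_) fun hs' => Ens.setI ?_)
      fun hs => (Ens.skip ?_).mono (by norm_num) fun _ h => h
    rotate_left 2
    · simp only [BExp.Holds, IExp.eval, eval_ix, hC.n, hC.d, hC.top, e16, hjs, hact, ha] at hs
      cases hx : I.pt (F.act p) j <;> simp [hx] at hs
      simp [h2, hx, sum_range_succ, sqd, h1, Nat.forall_lt_succ_right, -Order.lt_add_one_iff]
    all_goals
      simp only [BExp.Holds, IExp.eval, eval_ix, hC.n, hC.d, hC.k, hC.top, e16, e17, hjs, hact,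
        ha, hc] at hs hs'
      cases hx : I.pt (F.act p) j <;> cases hu : F.u t j <;> simp [hx, hu] at hs hs' hb hd
      simp [h2, hx, hu, hC.n, hC.d, hC.k, hC.top, e16, e17, hjs, hact, hb, hd, sum_range_succ,
        sqd, h1, Nat.forall_lt_succ_right, sq, -Order.lt_add_one_iff]
  · intro s' hk hI
    exact hI

/-- The entry for the position `p` describes the nearest one of the first `t` centers. -/
def NearRep (I : Inst) (s : Store) (F : Frame) (p t : ℕ) : Prop :=
  s.ints 11 p = ((I.near F.u (F.act p) t).elim 0 fun _ => 1) ∧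
    s.reals 5 p = ((I.near F.u (F.act p) t).elim 0 fun t' => I.dist F.u t' (F.act p)) ∧
    ∀ t', I.near F.u (F.act p) t = some t' → s.ints 2 p = t'

theorem ens_nearCode {I : Inst} {s : Store} {r : ℕ} {F : Frame} (h : Cur I s r F) :
    Ens nearCode s (F.A.length * (I.k * (I.d * 6 + 17) + 10) + 3) fun s' =>
      ∀ p < F.A.length, NearRep I s' F p I.k := by
  refine Ens.mono (Ens.forTo (M := F.A.length) (τ := I.k * (I.d * 6 + 17) + 7)
    (fun j s' => ∀ p < j, NearRep I s' F p I.k)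
    (by decide) ?_ ?_ ?_ ?_) (le_of_eq (by ring)) fun _ h => h
  · intro s' hk
    exact (h.keeps hk).len
  · simp
  · intro p s' hp hk hps hI
    have hC : Cur I s' r F := h.keeps hk
    refine Ens.mono (Ens.seq (Ens.setI (Ens.seq (Ens.setR (Ens.forTo (M := I.k)
      (τ := I.d * 6 + 7 + (5 + 1) + 1)
      (fun j s' => NearRep I s' F p j ∧ ∀ p' < p, NearRep I s' F p' I.k)
      (by decide) ?_ ?_ ?_ ?_))))) (le_of_eq (by ring)) fun _ h => h
    · intro s'' hk'
      exact (((hC.keeps (.writeI _ _ _ _)).keeps (.writeR _ _ _ _)).keeps hk').k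
    · refine ⟨by simp [NearRep, Inst.near, hps], fun p' hp' => ?_⟩
      have := hI p' hp'
      simpa [NearRep, hps, hp'.ne] using this
    · intro t s'' ht hk' hts hI'
      have hC' : Cur I s'' r F :=
        ((hC.keeps (.writeI _ _ _ _)).keeps (.writeR _ _ _ _)).keeps hk'
      have e16 : s''.ints 16 0 = p := by simp [hk'.1 16 (by decide), hps]
      refine Ens.seq_of (ens_distCode hC' e16 hts hp ht) (τ' := 5 + 1) ?_ le_rfl
      rintro s₁ hk₁ ⟨ha, hd⟩
      have f16 : s₁.ints 16 0 = p := by rw [hk₁.1 16 (by decide), e16]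
      have f17 : s₁.ints 17 0 = t := by rw [hk₁.1 17 (by decide), hts]
      have f11 := hk₁.1 11 (by decide)
      have f2 := hk₁.1 2 (by decide)
      have f5 := hk₁.2 5 (by decide)
      obtain ⟨⟨i1, i2, i3⟩, i4⟩ := hI'
      -- The implication is coded as a negated conjunction; while the flag in the array `11` is `0`,
      -- it holds vacuously.
      have hcond : (I.Avail F.u t (F.act p) ∧ ∀ t', I.near F.u (F.act p) t = some t' →
          I.dist F.u t (F.act p) < I.dist F.u t' (F.act p)) ↔
          BExp.Holds s₁ (.and (.ltI (.lit 0) (iv 20))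
          (.not (.and (.ltI (.lit 0) (.get 11 (iv 16))) (.not (.ltR (rv 6) (.get 5 (iv 16))))))) := by
        simp only [BExp.Holds, IExp.eval, RExp.eval, ha, hd, f16, f11, f5, i1, i2]
        cases I.near F.u (F.act p) t <;> simp
      refine Ens.ite (τ := 5) (fun hs => ?_) fun hs => ?_
      · rw [← hcond] at hs
        refine Ens.seq (Ens.setI (Ens.seq (Ens.setR (Ens.setI ?_))))
        refine ⟨?_, fun p' hp' => ?_⟩
        · have hn : I.near F.u (F.act p) (t + 1) = some t := by rw [Inst.near, if_pos hs]
          simp [NearRep, hn, f16, f17, hd]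
        · have := i4 p' hp'
          simpa [NearRep, f16, f17, hp'.ne, f11, f2, f5] using this
      · rw [← hcond] at hs
        refine (Ens.skip ?_).mono (by norm_num) fun _ h => h
        refine ⟨?_, fun p' hp' => ?_⟩
        · have hn : I.near F.u (F.act p) (t + 1) = I.near F.u (F.act p) t := by
            rw [Inst.near, if_neg hs]
          simp only [NearRep, hn]
          simpa [f11, f2, f5, i1, i2] using i3
        · have := i4 p' hp'
          simpa [NearRep, f11, f2, f5] using this
    · intro s'' hk' hI' p' hp'
      rcases Nat.lt_succ_iff_lt_or_eq.1 hp' with h' | rfl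
      · simpa [NearRep] using hI'.2 p' h'
      · simpa [NearRep] using hI'.1
  · intro s' hk hI
    exact hI

theorem NearRep.has_iff {I : Inst} {s : Store} {F : Frame} {p : ℕ} (h : NearRep I s F p I.k) :
    0 < s.ints 11 p ↔ I.Has F.u (F.act p) := by
  rw [h.1, Inst.Has]
  cases I.near F.u (F.act p) I.k <;> simp

theorem NearRep.dv_eq {I : Inst} {s : Store} {F : Frame} {p : ℕ} (h : NearRep I s F p I.k) :
    s.reals 5 p = I.dv F.u (F.act p) := h.2.1

end MissingKMeans

namespace MissingKMeans

open Finset RealRAM Program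

/-! ### The best solution -/

/-- The memory contains the best solution, and `best` is an upper bound for its cost. -/
def RepBest (I : Inst) (s : Store) (best : Option ℝ) : Prop :=
  s.ints 25 0 = (best.elim 0 fun _ => 1) ∧ ∀ b, best = some b → s.reals 8 0 = b ∧
    ∑ x ∈ range I.n, I.dv (Inst.full fun t i => s.reals 2 (adr I.d t i)) x ≤ b

theorem RepBest.keeps {I : Inst} {s s' : Store} {best : Option ℝ} {c : Cmd}
    (h : RepBest I s best) (hk : Keeps c s s')
    (hc : (c.KeepsI 25 ∧ c.KeepsR 8 ∧ c.KeepsR 2) := by decide) : RepBest I s' best := by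
  unfold RepBest
  rw [hk.1 25 hc.1, hk.2 8 hc.2.1, hk.2 2 hc.2.2]
  exact h

/-- The stored centers are copied whole, unknown coordinates included. Whatever number stands there,
the copy extends the partial centers, and `Safe.cand` bounds its true cost by the candidate cost. -/
theorem ens_candCode {I : Inst} {s : Store} {r : ℕ} {F : Frame} {best : Option ℝ}
    (h : Cur I s r F) (hS : I.Safe F) (hnear : ∀ p < F.A.length, NearRep I s F p I.k)
    (hb : RepBest I s best) :
    Ens candCode s (F.A.length * 7 + I.k * I.d * 4 + 16) fun s' => RepBest I s' (I.upd best F) := by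
  refine Ens.seq_of (Ens.setI (P := fun s' => s' = _) rfl) ?_
    (τ' := F.A.length * 7 + I.k * I.d * 4 + 14) (by omega)
  rintro _ - rfl
  refine Ens.seq_of (Ens.setR (P := fun s' => s' = _) rfl) ?_
    (τ' := F.A.length * 7 + I.k * I.d * 4 + 12) (by omega)
  rintro _ - rfl
  have hC0 := (h.keeps (.writeI s 23 0 1)).keeps (.writeR _ 7 0 F.acc)
  have hloop : Ens (forTo 16 (iv 28) (.seq (setRv 7 (.add (rv 7) (.get 5 (iv 16))))
        (.ite (.ltI (.lit 0) (.get 11 (iv 16))) .skip (setIv 23 (.lit 0)))))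
        ((s.writeI 23 0 1).writeR 7 0 F.acc) (F.A.length * 7 + 3)
      fun s' => (0 < s'.ints 23 0 ↔ ∀ p < F.A.length, I.Has F.u (F.act p)) ∧
        s'.reals 7 0 = I.candCost F := by
    refine Ens.forTo (M := F.A.length) (τ := 4)
      (fun j s' => (0 < s'.ints 23 0 ↔ ∀ p < j, I.Has F.u (F.act p)) ∧
        s'.reals 7 0 = F.acc + ∑ p ∈ range j, I.dv F.u (F.act p))
      (by decide) ?_ ?_ ?_ ?_
    · intro s' hk
      exact (hC0.keeps hk).len
    · simp
    · rintro p s' hp hk hps ⟨h1, h2⟩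
      have e11 : s'.ints 11 p = s.ints 11 p := by simp [hk.1 11 (by decide)]
      have e5 : s'.reals 5 p = s.reals 5 p := by simp [hk.2 5 (by decide)]
      have hh := (hnear p hp).has_iff
      have hd := (hnear p hp).dv_eq
      refine Ens.seq_of (τ' := 2) (Ens.setR (P := fun s' => s' = _) rfl) ?_ le_rfl
      rintro _ - rfl
      refine Ens.ite (fun hs => Ens.skip ?_) fun hs => Ens.setI ?_
      · simp only [BExp.Holds, IExp.eval, Store.writeR_ints, hps, e11, hh] at hs
        simp [h1, h2, hps, e5, hd, sum_range_succ, add_assoc, Nat.forall_lt_succ_right, hs,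
          -Order.lt_add_one_iff]
      · simp only [BExp.Holds, IExp.eval, Store.writeR_ints, hps, e11, hh] at hs
        simp [h1, h2, hps, e5, hd, sum_range_succ, add_assoc, Nat.forall_lt_succ_right, hs,
          -Order.lt_add_one_iff]
    · exact fun s' _ h => h
  have hacc : RExp.eval (s.writeI 23 0 1) (.get 3 (iv 27)) = F.acc := by
    simp [h.top, h.acc]
  have hst : ((s.writeI 23 (IExp.eval s (.lit 0)) (IExp.eval s (.lit 1))).writeR 7
      (IExp.eval (s.writeI 23 0 1) (.lit 0)) (RExp.eval (s.writeI 23 0 1) (.get 3 (iv 27))))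
      = (s.writeI 23 0 1).writeR 7 0 F.acc := by rw [hacc]; rfl
  refine Ens.seq_of (τ' := I.k * I.d * 4 + 8) (hst ▸ hloop) ?_ (by omega)
  rintro s₁ hk₁ ⟨h1, h2⟩
  have hst' : Keeps (forTo 16 (iv 28) (.seq (setRv 7 (.add (rv 7) (.get 5 (iv 16))))
        (.ite (.ltI (.lit 0) (.get 11 (iv 16))) .skip (setIv 23 (.lit 0)))))
        ((s.writeI 23 0 1).writeR 7 0 F.acc) s₁ := hst ▸ hk₁
  have hC1 := hC0.keeps hst'
  have hb1 := ((hb.keeps (.writeI s 23 0 1)).keeps (.writeR _ 7 0 F.acc)).keeps hst'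
  have hcond : BExp.Holds s₁ (.and (.ltI (.lit 0) (iv 23))
          (.not (.and (.ltI (.lit 0) (iv 25)) (.not (.ltR (rv 7) (rv 8)))))) ↔
      (∀ p < F.A.length, I.Has F.u (F.act p)) ∧ ∀ b, best = some b → I.candCost F < b := by
    simp only [BExp.Holds, IExp.eval, RExp.eval, h1, h2, hb1.1]
    cases best with
    | none => simp
    | some b => simp [(hb1.2 b rfl).1]
  refine Ens.le (Ens.ite (τ := I.k * I.d * 4 + 7) (fun hs => ?_) fun hs => ?_) (by omega)
  · rw [hcond] at hs
    refine Ens.seq_of (Ens.setI (P := fun s' => s' = _) rfl) ?_ (τ' := I.k * I.d * 4 + 5)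
      (by omega)
    rintro _ - rfl
    refine Ens.seq_of (Ens.setR (P := fun s' => s' = _) rfl) ?_ (τ' := I.k * I.d * 4 + 3)
      (by omega)
    rintro _ - rfl
    have hC2 := (hC1.keeps (.writeI _ 25 0 1)).keeps (.writeR _ 8 0 (s₁.reals 7 0))
    refine Ens.forTo (M := I.k * I.d) (τ := 1)
      (fun j s' => ∀ j' < j, s'.reals 2 j' = s₁.reals 4 (adr (I.k * I.d) r j'))
      (by decide) ?_ ?_ ?_ ?_
    · intro s' hk
      have := hC2.keeps hk
      simp [this.k, this.d]
    · simp
    · intro j s' hj hk hjs hI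
      have hC3 := hC2.keeps hk
      have e4 : s'.reals 4 = s₁.reals 4 := by
        rw [hk.2 4 (by decide)]
        funext x
        simp
      refine Ens.setR ?_
      intro j' hj'
      simp only [Store.writeI_reals, Store.writeR_reals, if_true, IExp.eval, RExp.eval, hjs,
        eval_ix, hC3.k, hC3.d, hC3.top, e4]
      split_ifs with hjj
      · rw [hjj]
      · exact hI j' (by omega)
    · intro s' hk hI
      have hu : I.upd best F = some (I.candCost F) := by
        unfold Inst.upd
        rw [if_pos hs]
      have e25 : s'.ints 25 0 = 1 := by simp [hk.1 25 (by decide)]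
      have e8 : s'.reals 8 0 = I.candCost F := by simp [hk.2 8 (by decide), h2]
      rw [hu]
      refine ⟨e25, fun b hb' => ?_⟩
      obtain rfl : I.candCost F = b := by simpa using hb'
      refine ⟨e8, hS.cand I hs.1 fun t ht i hi w hw => ?_⟩
      rw [hI _ (adr_lt hi ht), (hC1.cen t ht i hi).2, hw]
      rfl
  · rw [hcond] at hs
    have hu : I.upd best F = best := by
      unfold Inst.upd
      rw [if_neg hs]
    rw [hu]
    exact (Ens.skip hb1).le (by omega)

end MissingKMeans

namespace MissingKMeans

open Finset RealRAM Program

/-! ### The pivot step -/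

/-- The frame with the index `r` is the same in both memories. -/
structure SameFrame (I : Inst) (s s' : Store) (r : ℕ) : Prop where
  cnt : s'.ints 7 r = s.ints 7 r
  bud : s'.ints 8 r = s.ints 8 r
  acc : s'.reals 3 r = s.reals 3 r
  act : ∀ p < I.n, s'.ints 9 (adr I.n r p) = s.ints 9 (adr I.n r p)
  frz : ∀ j < I.k * I.d, s'.ints 10 (adr (I.k * I.d) r j) = s.ints 10 (adr (I.k * I.d) r j)
  val : ∀ j < I.k * I.d, s'.reals 4 (adr (I.k * I.d) r j) = s.reals 4 (adr (I.k * I.d) r j)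

theorem SameFrame.trans {I : Inst} {s s' s'' : Store} {r : ℕ} (h : SameFrame I s s' r)
    (h' : SameFrame I s' s'' r) : SameFrame I s s'' r where
  cnt := h'.cnt.trans h.cnt
  bud := h'.bud.trans h.bud
  acc := h'.acc.trans h.acc
  act p hp := (h'.act p hp).trans (h.act p hp)
  frz j hj := (h'.frz j hj).trans (h.frz j hj)
  val j hj := (h'.val j hj).trans (h.val j hj)

theorem SameFrame.of_keeps {I : Inst} {s s' : Store} {r : ℕ} {c : Cmd} (hk : Keeps c s s')
    (hc : (c.KeepsI 7 ∧ c.KeepsI 8 ∧ c.KeepsI 9 ∧ c.KeepsI 10 ∧ c.KeepsR 3 ∧ c.KeepsR 4) := by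
      decide) : SameFrame I s s' r where
  cnt := by rw [hk.1 7 hc.1]
  bud := by rw [hk.1 8 hc.2.1]
  acc := by rw [hk.2 3 hc.2.2.2.2.1]
  act _ _ := by rw [hk.1 9 hc.2.2.1]
  frz _ _ := by rw [hk.1 10 hc.2.2.2.1]
  val _ _ := by rw [hk.2 4 hc.2.2.2.2.2]

/-- All frames share the same arrays, so `Keeps` is too coarse when another frame is written;
agreement on the cells of the one block is what counts. -/
theorem RepFrame.same {I : Inst} {s s' : Store} {r : ℕ} {F : Frame} (h : RepFrame I s r F)
    (hs : SameFrame I s s' r) : RepFrame I s' r F where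
  cnt := hs.cnt.trans h.cnt
  bud := hs.bud.trans h.bud
  acc := hs.acc.trans h.acc
  act p hp := (hs.act p (hp.trans_le h.le)).trans (h.act p hp)
  cen t ht i hi := by
    rw [hs.frz _ (adr_lt hi ht), hs.val _ (adr_lt hi ht)]
    exact h.cen t ht i hi
  le := h.le
  lt := h.lt

theorem holds_lowE {I : Inst} {s : Store} {F : Frame} {z p : ℕ}
    (hnear : ∀ p < F.A.length, NearRep I s F p I.k) (hz : s.ints 15 0 = z)
    (hza : z < F.A.length) (hp : s.ints 16 0 = p) (hpa : p < F.A.length) :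
    lowE.Holds s ↔ I.Low F z p := by
  simp only [lowE, BExp.Holds, IExp.eval, RExp.eval, hz, hp, (hnear p hpa).dv_eq,
    (hnear z hza).dv_eq, (hnear p hpa).has_iff, Inst.Low]
  refine and_congr_right fun _ => ?_
  constructor
  · rintro ⟨h1, h2⟩
    rcases (not_lt.1 h1).lt_or_eq with h | h
    · exact Or.inl h
    · refine Or.inr ⟨h, ?_⟩
      by_contra hlt
      exact h2 ⟨by rw [h]; exact lt_irrefl _, not_le.1 hlt⟩
  · rintro (h | ⟨h, h'⟩)
    · exact ⟨not_lt.2 h.le, fun hh => hh.1 h⟩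
    · exact ⟨by rw [h]; exact lt_irrefl _, fun hh => by omega⟩

theorem NearRep.keeps {I : Inst} {s s' : Store} {F : Frame} {p t : ℕ} {c : Cmd}
    (h : NearRep I s F p t) (hk : Keeps c s s')
    (hc : (c.KeepsI 11 ∧ c.KeepsI 2 ∧ c.KeepsR 5) := by decide) : NearRep I s' F p t := by
  unfold NearRep
  rw [hk.1 11 hc.1, hk.1 2 hc.2.1, hk.2 5 hc.2.2]
  exact h

open Classical in
/-- The positions above the pivot among the first ones. -/
noncomputable def upTo (I : Inst) (F : Frame) (z j : ℕ) : List ℕ :=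
  (List.range j).filter fun p => ¬ I.Low F z p

theorem upTo_succ_of_low {I : Inst} {F : Frame} {z j : ℕ} (h : I.Low F z j) :
    upTo I F z (j + 1) = upTo I F z j := by
  simp [upTo, List.range_succ, h]

theorem upTo_succ_of_not_low {I : Inst} {F : Frame} {z j : ℕ} (h : ¬ I.Low F z j) :
    upTo I F z (j + 1) = upTo I F z j ++ [j] := by
  simp [upTo, List.range_succ, h]

theorem length_upTo_le (I : Inst) (F : Frame) (z j : ℕ) : (upTo I F z j).length ≤ j := by
  exact (List.length_filter_le _ _).trans (by simp)

theorem ens_countCode {I : Inst} {s : Store} {r z : ℕ} {F : Frame} (h : Cur I s r F)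
    (hnear : ∀ p < F.A.length, NearRep I s F p I.k) (hz : s.ints 15 0 = z)
    (hza : z < F.A.length) :
    Ens countCode s (F.A.length * 5 + 5) fun s' => s'.ints 24 0 = (I.up F z).length := by
  refine Ens.seq_of (Ens.setI (P := fun s' => s' = _) rfl) ?_ (τ' := F.A.length * 5 + 3)
    (by omega)
  rintro _ - rfl
  have hC := h.keeps (.writeI s 24 0 0)
  refine Ens.forTo (M := F.A.length) (τ := 2) (fun j s' => s'.ints 24 0 = (upTo I F z j).length)
    (by decide) ?_ ?_ ?_ ?_
  · intro s' hk
    exact (hC.keeps hk).len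
  · simp [upTo]
  · intro p s' hp hk hps hI
    have hl := holds_lowE (s := s') (fun p hp => ((hnear p hp).keeps (.writeI s 24 0 0)).keeps hk)
      (z := z) (by simp [hk.1 15 (by decide), hz]) hza hps hp
    refine Ens.ite (fun hs => Ens.skip ?_) fun hs => Ens.setI ?_
    · simp [upTo_succ_of_low (hl.1 hs), hI]
    · simp [upTo_succ_of_not_low (fun h => hs (hl.2 h)), hI]
  · exact fun s' _ h => h

-- The compaction works in place: the number of positions kept so far never exceeds the current
-- position, so only cells that have been read are overwritten. The invariant therefore lists the
-- unread cells separately.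
open Classical in
theorem ens_compactCode {I : Inst} {s : Store} {r z : ℕ} {F : Frame} (h : Cur I s r F)
    (hnear : ∀ p < F.A.length, NearRep I s F p I.k) (hz : s.ints 15 0 = z)
    (hza : z < F.A.length) :
    Ens compactCode s (F.A.length * 7 + 7) fun s' =>
      s'.ints 7 r = (I.up F z).length ∧ (∀ r' ≠ r, s'.ints 7 r' = s.ints 7 r') ∧
      s'.reals 3 r = F.acc + ∑ p ∈ (range F.A.length).filter (I.Low F z), I.dv F.u (F.act p) ∧
      (∀ r' ≠ r, s'.reals 3 r' = s.reals 3 r') ∧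
      (∀ q < (I.up F z).length, s'.ints 9 (adr I.n r q) = ((I.up F z).map F.act).getD q 0) ∧
      ∀ r' ≠ r, ∀ q < I.n, s'.ints 9 (adr I.n r' q) = s.ints 9 (adr I.n r' q) := by
  refine Ens.seq_of (Ens.setI (P := fun s' => s' = _) rfl) ?_ (τ' := F.A.length * 7 + 5)
    (by omega)
  rintro _ - rfl
  have hC := h.keeps (.writeI s 26 0 0)
  have hloop : Ens (forTo 16 (iv 28) (.ite lowE
      (.setR 3 (iv 27) (.add (.get 3 (iv 27)) (.get 5 (iv 16))))
      (.seq (.setI 9 (ix nE (iv 27) (iv 26)) (actE (iv 27) (iv 16)))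
        (setIv 26 (.add (iv 26) (.lit 1)))))) (s.writeI 26 0 0) (F.A.length * 7 + 3) fun s' =>
      s'.ints 26 0 = (I.up F z).length ∧
      s'.reals 3 r = F.acc + ∑ p ∈ (range F.A.length).filter (I.Low F z), I.dv F.u (F.act p) ∧
      (∀ r' ≠ r, s'.reals 3 r' = s.reals 3 r') ∧
      (∀ q < (I.up F z).length, s'.ints 9 (adr I.n r q) = ((I.up F z).map F.act).getD q 0) ∧
      ∀ r' ≠ r, ∀ q < I.n, s'.ints 9 (adr I.n r' q) = s.ints 9 (adr I.n r' q) := by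
    refine Ens.forTo (M := F.A.length) (τ := 4) (fun j s' =>
      s'.ints 26 0 = (upTo I F z j).length ∧
      s'.reals 3 r = F.acc + ∑ p ∈ (range j).filter (I.Low F z), I.dv F.u (F.act p) ∧
      (∀ r' ≠ r, s'.reals 3 r' = s.reals 3 r') ∧
      (∀ q < (upTo I F z j).length, s'.ints 9 (adr I.n r q) = ((upTo I F z j).map F.act).getD q 0) ∧
      (∀ q < F.A.length, j ≤ q → s'.ints 9 (adr I.n r q) = F.act q) ∧
      ∀ r' ≠ r, ∀ q < I.n, s'.ints 9 (adr I.n r' q) = s.ints 9 (adr I.n r' q))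
      (by decide) ?_ ?_ ?_ ?_
    · intro s' hk
      rw [show IExp.eval s' (iv 28) = s'.ints 28 0 from rfl, hk.1 28 (by decide)]
      exact hC.len
    · refine ⟨by simp [upTo], by simp [h.acc], by simp, by simp [upTo], fun q hq _ => ?_,
        fun r' hr' q hq => by simp⟩
      simp [h.act q hq]
    · rintro p s' hp hk hps ⟨i1, i2, i3, i4, i5, i6⟩
      have hl := holds_lowE (s := s') (fun p hp => ((hnear p hp).keeps (.writeI s 26 0 0)).keeps hk)
        (z := z) (by simp [hk.1 15 (by decide), hz]) hza hps hp
      have e27 : s'.ints 27 0 = r := by rw [hk.1 27 (by decide)]; exact hC.top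
      have e0 : s'.ints 0 0 = I.n := by rw [hk.1 0 (by decide)]; exact hC.n
      have e5 : s'.reals 5 p = I.dv F.u (F.act p) := by
        rw [hk.2 5 (by decide)]; exact (hnear p hp).dv_eq
      refine Ens.ite (fun hs => ?_) fun hs => ?_
      · rw [hl] at hs
        refine Ens.le (Ens.setR ?_) (by norm_num)
        rw [upTo_succ_of_low hs]
        simp only [IExp.eval, RExp.eval, e27, hps, Store.writeI_ints, Store.writeI_reals,
          Store.writeR_ints, Store.writeR_reals, if_true, i1, i2, e5]
        refine ⟨by simp, ?_, fun r' hr' => ?_, ?_, ?_, ?_⟩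
        · rw [range_add_one, filter_insert, if_pos hs, sum_insert (by simp)]
          ring
        · rw [if_neg hr']
          exact i3 r' hr'
        · simpa using i4
        · simpa using fun q hq hpq => i5 q hq (by omega)
        · simpa using i6
      · rw [hl] at hs
        have hlen := length_upTo_le I F z p
        have hn := h.le
        refine Ens.seq_of (Ens.setI (P := fun s' => s' = _) rfl) ?_ (τ' := 1) (by norm_num)
        rintro _ - rfl
        refine Ens.setI ?_
        rw [upTo_succ_of_not_low hs]
        simp only [IExp.eval, RExp.eval, eval_ix, e27, e0, hps, Store.writeI_ints,
          Store.writeI_reals, i1, i2, i5 p hp le_rfl]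
        refine ⟨by simp, ?_, i3, fun q hq => ?_, fun q hq hpq => ?_, fun r' hr' q hq => ?_⟩
        · rw [range_add_one, filter_insert, if_neg hs]
        · have hq' : q ≤ (upTo I F z p).length := by simpa [Nat.lt_succ_iff] using hq
          have hinj : adr I.n r q = adr I.n r (upTo I F z p).length ↔ q = (upTo I F z p).length := by
            rw [adr_inj (by omega) (by omega)]
            simp
          simp only [hinj]
          rcases hq'.lt_or_eq with hlt | heq
          · have := i4 q hlt
            simp only [List.map_append]
            rw [List.getD_append _ _ _ _ (by simpa using hlt), ← this]
            simp [hlt.ne]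
          · subst heq
            simp
        · have hinj : adr I.n r q = adr I.n r (upTo I F z p).length ↔ q = (upTo I F z p).length := by
            rw [adr_inj (by omega) (by omega)]
            simp
          simp only [hinj]
          have hne : q ≠ (upTo I F z p).length := by omega
          simpa [hne] using i5 q hq (by omega)
        · have hinj : adr I.n r' q ≠ adr I.n r (upTo I F z p).length := by
            rw [Ne, adr_inj hq (by omega)]
            exact fun h => hr' h.1
          simpa [hinj] using i6 r' hr' q hq
    · rintro s' - ⟨i1, i2, i3, i4, i5, i6⟩
      exact ⟨i1, i2, i3, i4, i6⟩
  refine Ens.seq_of (τ' := 1) hloop ?_ (by omega)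
  rintro s₁ hk ⟨i1, i2, i3, i4, i6⟩
  have e27 : s₁.ints 27 0 = r := by rw [hk.1 27 (by decide)]; exact hC.top
  have e7 : s₁.ints 7 = s.ints 7 := by
    rw [hk.1 7 (by decide)]
    funext x
    simp
  refine Ens.setI ?_
  simp only [IExp.eval, e27, i1]
  refine ⟨by simp, fun r' hr' => by simp [hr', e7], by simpa using i2, by simpa using i3,
    by simpa using i4, by simpa using i6⟩

theorem ens_pivotCode {I : Inst} {s : Store} {r z : ℕ} {F : Frame} (h : Cur I s r F)
    (hnear : ∀ p < F.A.length, NearRep I s F p I.k) (hz : s.ints 15 0 = z)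
    (hza : z < F.A.length) :
    Ens pivotCode s (F.A.length * 12 + 16) fun s' =>
      RepFrame I s' r (I.pivot F z) ∧ ∀ r' ≠ r, SameFrame I s s' r' := by
  classical
  refine Ens.seq_of (ens_countCode h hnear hz hza) ?_ (τ' := F.A.length * 7 + 10) (by omega)
  intro s₁ hk₁ h24
  have hC := h.keeps hk₁
  have hnear' : ∀ p < F.A.length, NearRep I s₁ F p I.k := fun p hp => (hnear p hp).keeps hk₁
  have hz' : s₁.ints 15 0 = z := by rw [hk₁.1 15 (by decide), hz]
  have hcond : BExp.Holds s₁ (.and (.ltI (.lit 0) (.get 11 (iv 15)))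
        (.and (.not (.ltI (.mul (.lit 4) (iv 24)) (iv 28)))
          (.not (.ltI (.mul (.lit 3) (iv 28)) (.mul (.lit 4) (iv 24)))))) ↔ I.Accept F z := by
    simp only [BExp.Holds, IExp.eval, hz', (hnear' z hza).has_iff, h24, hC.len, not_lt,
      Inst.Accept]
  have hbud : (I.pivot F z).bud = F.bud - F.A.length := I.bud_pivot F z
  by_cases ha : I.Accept F z
  · have hp : I.pivot F z = { A := (I.up F z).map F.act
                              u := F.u
                              acc := F.acc + ∑ p ∈ (range F.A.length).filter (I.Low F z),
                                I.dv F.u (F.act p)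
                              bud := F.bud - F.A.length
                              b0 := F.b0 } := by rw [Inst.pivot, if_pos ha]
    refine Ens.seq_of (Ens.ite (fun _ => ens_compactCode hC hnear' hz' hza)
      fun hs => absurd (hcond.2 ha) hs) ?_ (τ' := 1) (by omega)
    rintro s₂ hk₂ ⟨i1, i2, i3, i4, i5, i6⟩
    have e27 : s₂.ints 27 0 = r := by rw [hk₂.1 27 (by decide)]; exact hC.top
    have e28 : s₂.ints 28 0 = F.A.length := by rw [hk₂.1 28 (by decide)]; exact hC.len
    have e8 := hk₂.1 8 (by decide)
    have e8' := hk₁.1 8 (by decide)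
    have e10 := hk₂.1 10 (by decide)
    have e4 := hk₂.2 4 (by decide)
    refine Ens.setI ?_
    simp only [IExp.eval, e27, e28]
    refine ⟨?_, fun r' hr' => ?_⟩
    · have hlen : (I.up F z).length ≤ F.A.length := length_upTo_le I F z F.A.length
      rw [hp]
      refine ⟨?_, ?_, ?_, ?_, ?_, ?_, ?_⟩
      · simpa using i1
      · simp [e8, hC.bud]
      · simpa using i3
      · intro p hp'
        simpa [Frame.act] using i5 p (by simpa using hp')
      · intro t ht i hi
        simpa [e10, e4] using hC.cen t ht i hi
      · simpa using hlen.trans h.le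
      · intro p hp'
        have hp'' : p < (I.pivot F z).A.length := by rw [hp]; exact hp'
        obtain ⟨q, hq, -, hpq⟩ := I.exists_of_act_pivot ha hp''
        rw [hp] at hpq
        rw [hpq]
        exact h.lt q hq
    · have hsame : SameFrame I s s₁ r' := .of_keeps hk₁
      refine hsame.trans ⟨?_, ?_, ?_, ?_, ?_, ?_⟩
      · simpa using i2 r' hr'
      · simp [hr', e8]
      · simpa using i4 r' hr'
      · simpa using i6 r' hr'
      · simp [e10]
      · simp [e4]
  · have hp : I.pivot F z = { F with bud := F.bud - F.A.length } := by rw [Inst.pivot, if_neg ha]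
    refine Ens.seq_of (τ := 2) (P₁ := fun s' => s₁ = s') (Ens.ite (fun hs => absurd (hcond.1 hs) ha)
      fun hs => Ens.skip rfl) ?_ (τ' := 1) (by omega)
    rintro _ - rfl
    refine Ens.setI ?_
    simp only [IExp.eval, hC.top, hC.len]
    refine ⟨?_, fun r' hr' => ?_⟩
    · rw [hp]
      refine ⟨?_, ?_, ?_, ?_, ?_, h.le, h.lt⟩
      · simpa using hC.cnt
      · simp [hC.bud]
      · simpa using hC.acc
      · simpa [Frame.act] using hC.act
      · simpa using hC.cen
    · have hsame : SameFrame I s s₁ r' := .of_keeps hk₁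
      exact hsame.trans ⟨by simp, by simp [hr'], by simp, by simp, by simp, by simp⟩

end MissingKMeans

namespace MissingKMeans

open Finset RealRAM Program

/-! ### The child of a node -/

theorem ens_copyCode {I : Inst} {s : Store} {r : ℕ} {F : Frame} (h : Cur I s r F) :
    Ens copyCode s (F.A.length * 4 + I.k * I.d * 6 + 13) fun s' =>
      RepFrame I s' (r + 1) { F with bud := 20 * F.A.length, b0 := 20 * F.A.length } ∧
        ∀ r' ≠ r + 1, SameFrame I s s' r' := by
  refine Ens.seq_of (Ens.setI (P := fun s' => s' = _) rfl) ?_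
    (τ' := F.A.length * 4 + I.k * I.d * 6 + 11) (by omega)
  rintro _ - rfl
  refine Ens.seq_of (Ens.setI (P := fun s' => s' = _) rfl) ?_
    (τ' := F.A.length * 4 + I.k * I.d * 6 + 9) (by omega)
  rintro _ - rfl
  refine Ens.seq_of (Ens.setR (P := fun s' => s' = _) rfl) ?_
    (τ' := F.A.length * 4 + I.k * I.d * 6 + 7) (by omega)
  rintro _ - rfl
  simp only [IExp.eval, RExp.eval, Store.writeI_ints, Store.writeI_reals, h.top, h.len, h.acc]
  simp only [Nat.reduceEqDiff, if_false, h.top, h.len, h.acc]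
  generalize hs1 : ((s.writeI 7 (r + 1) F.A.length).writeI 8 (r + 1)
    (20 * F.A.length)).writeR 3 (r + 1) F.acc = s1
  have a7 : ∀ x, s1.ints 7 x = if x = r + 1 then F.A.length else s.ints 7 x := by
    intro x; simp [← hs1]
  have a8 : ∀ x, s1.ints 8 x = if x = r + 1 then 20 * F.A.length else s.ints 8 x := by
    intro x; simp [← hs1]
  have a3 : ∀ x, s1.reals 3 x = if x = r + 1 then F.acc else s.reals 3 x := by
    intro x; simp [← hs1]
  have a9 : s1.ints 9 = s.ints 9 := by funext x; simp [← hs1]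
  have a10 : s1.ints 10 = s.ints 10 := by funext x; simp [← hs1]
  have a4 : s1.reals 4 = s.reals 4 := by funext x; simp [← hs1]
  have hC1 : Consts I s1 := by
    rw [← hs1]
    exact ((h.toConsts.keeps (.writeI _ _ _ _)).keeps (.writeI _ _ _ _)).keeps (.writeR _ _ _ _)
  have a27 : s1.ints 27 0 = r := by simp [← hs1, h.top]
  have a28 : s1.ints 28 0 = F.A.length := by simp [← hs1, h.len]
  have hloop : Ens (forTo 16 (iv 28)
      (.setI 9 (ix nE (.add (iv 27) (.lit 1)) (iv 16)) (actE (iv 27) (iv 16)))) s1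
      (F.A.length * 4 + 3) fun s' =>
      (∀ p < F.A.length, s'.ints 9 (adr I.n (r + 1) p) = F.act p) ∧
        ∀ r' ≠ r + 1, ∀ p < I.n, s'.ints 9 (adr I.n r' p) = s.ints 9 (adr I.n r' p) := by
    refine Ens.forTo (M := F.A.length) (τ := 1) (fun j s' =>
      (∀ p < j, s'.ints 9 (adr I.n (r + 1) p) = F.act p) ∧
        ∀ r' ≠ r + 1, ∀ p < I.n, s'.ints 9 (adr I.n r' p) = s.ints 9 (adr I.n r' p))
      (by decide) ?_ ?_ ?_ ?_
    · intro s' hk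
      rw [show IExp.eval s' (iv 28) = s'.ints 28 0 from rfl, hk.1 28 (by decide), a28]
    · exact ⟨by simp, fun r' _ p _ => by simp [a9]⟩
    · rintro p s' hp hk hps ⟨i1, i2⟩
      have hn := h.le
      have e27 : s'.ints 27 0 = r := by rw [hk.1 27 (by decide), a27]
      have e0 : s'.ints 0 0 = I.n := by rw [hk.1 0 (by decide), hC1.n]
      have e9 : s'.ints 9 (adr I.n r p) = F.act p := by
        rw [i2 r (by omega) p (by omega), h.act p hp]
      refine Ens.setI ?_
      simp only [IExp.eval, eval_ix, e27, e0, hps, e9]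
      refine ⟨fun q hq => ?_, fun r' hr' q hq => ?_⟩
      · have hinj : adr I.n (r + 1) q = adr I.n (r + 1) p ↔ q = p := by
          rw [adr_inj (by omega) (by omega)]
          simp
        rcases Nat.lt_succ_iff_lt_or_eq.1 hq with h' | rfl
        · simpa [hinj, h'.ne] using i1 q h'
        · simp
      · have hinj : adr I.n r' q ≠ adr I.n (r + 1) p := by
          rw [Ne, adr_inj hq (by omega)]
          exact fun h => hr' h.1
        simpa [hinj] using i2 r' hr' q hq
    · exact fun s' _ h => h
  refine Ens.seq_of hloop ?_ (τ' := I.k * I.d * 6 + 3) (by omega)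
  rintro s2 hk2 ⟨j1, j2⟩
  have hC2 := hC1.keeps hk2
  have b27 : s2.ints 27 0 = r := by rw [hk2.1 27 (by decide), a27]
  have b10 : s2.ints 10 = s.ints 10 := by rw [hk2.1 10 (by decide), a10]
  have b4 : s2.reals 4 = s.reals 4 := by rw [hk2.2 4 (by decide), a4]
  refine Ens.forTo (M := I.k * I.d) (τ := 3) (fun j s' =>
      (∀ p < j, s'.ints 10 (adr (I.k * I.d) (r + 1) p) = s.ints 10 (adr (I.k * I.d) r p) ∧
        s'.reals 4 (adr (I.k * I.d) (r + 1) p) = s.reals 4 (adr (I.k * I.d) r p)) ∧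
      ∀ r' ≠ r + 1, ∀ p < I.k * I.d,
        s'.ints 10 (adr (I.k * I.d) r' p) = s.ints 10 (adr (I.k * I.d) r' p) ∧
        s'.reals 4 (adr (I.k * I.d) r' p) = s.reals 4 (adr (I.k * I.d) r' p))
      (by decide) ?_ ?_ ?_ ?_
  · intro s' hk
    have := hC2.keeps hk
    simp [this.k, this.d]
  · exact ⟨by simp, fun r' _ p _ => by simp [b10, b4]⟩
  · rintro p s' hp hk hps ⟨i1, i2⟩
    have hC3 := hC2.keeps hk
    have e27 : s'.ints 27 0 = r := by rw [hk.1 27 (by decide), b27]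
    have e := i2 r (by omega) p hp
    refine Ens.seq_of (Ens.setI (P := fun s' => s' = _) rfl) ?_ (τ' := 1) le_rfl
    rintro _ - rfl
    refine Ens.setR ?_
    simp only [IExp.eval, RExp.eval, eval_ix, e27, hC3.k, hC3.d, hps, e.1, e.2,
      Store.writeI_ints, Store.writeI_reals]
    simp only [Nat.reduceEqDiff, if_false, e27, hC3.k, hC3.d, hps, e.1, e.2,
      OfNat.zero_ne_ofNat]
    refine ⟨fun q hq => ?_, fun r' hr' q hq => ?_⟩
    · have hinj : adr (I.k * I.d) (r + 1) q = adr (I.k * I.d) (r + 1) p ↔ q = p := by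
        rw [adr_inj (by omega) (by omega)]
        simp
      rcases Nat.lt_succ_iff_lt_or_eq.1 hq with h' | rfl
      · simpa [hinj, h'.ne] using i1 q h'
      · simp
    · have hinj : adr (I.k * I.d) r' q ≠ adr (I.k * I.d) (r + 1) p := by
        rw [Ne, adr_inj hq (by omega)]
        exact fun h => hr' h.1
      simpa [hinj] using i2 r' hr' q hq
  · rintro s' hk ⟨i1, i2⟩
    have e7 : s'.ints 7 = s1.ints 7 := by rw [hk.1 7 (by decide), hk2.1 7 (by decide)]
    have e8 : s'.ints 8 = s1.ints 8 := by rw [hk.1 8 (by decide), hk2.1 8 (by decide)]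
    have e3 : s'.reals 3 = s1.reals 3 := by rw [hk.2 3 (by decide), hk2.2 3 (by decide)]
    have e9 : s'.ints 9 = s2.ints 9 := hk.1 9 (by decide)
    refine ⟨⟨?_, ?_, ?_, ?_, ?_, h.le, h.lt⟩, fun r' hr' => ⟨?_, ?_, ?_, ?_, ?_, ?_⟩⟩
    · simp [e7, a7]
    · simp [e8, a8]
    · simp [e3, a3]
    · simpa [e9, Frame.act] using j1
    · intro t ht i hi
      obtain ⟨k1, k2⟩ := i1 _ (adr_lt hi ht)
      rw [k1, k2]
      exact h.cen t ht i hi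
    · simp [e7, a7, hr']
    · simp [e8, a8, hr']
    · simp [e3, a3, hr']
    · rw [e9]
      exact j2 r' hr'
    · exact fun p hp => (i2 r' hr' p hp).1
    · exact fun p hp => (i2 r' hr' p hp).2

/-- The flags are `0` or `1` and missing entries are stored as `0`, so plain sums over the samples
yield `cnt` and `tot` without any test. -/
theorem ens_sumCode {I : Inst} {s : Store} {r i : ℕ} {F : Frame} {g : Fin I.m → ℕ}
    (h : Cur I s r F) (hi : s.ints 18 0 = i) (hid : i < I.d) (hg : ∀ j, g j < F.A.length)
    (hsmp : ∀ j : Fin I.m, s.ints 12 j = g j) :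
    Ens sumCode s (I.m * 6 + 7) fun s' =>
      s'.ints 22 0 = I.cnt F g i ∧ s'.reals 7 0 = I.tot F g i := by
  refine Ens.seq_of (Ens.setI (P := fun s' => s' = _) rfl) ?_ (τ' := I.m * 6 + 5) (by omega)
  rintro _ - rfl
  refine Ens.seq_of (Ens.setR (P := fun s' => s' = _) rfl) ?_ (τ' := I.m * 6 + 3) (by omega)
  rintro _ - rfl
  have hC := (h.keeps (.writeI s 22 0 0)).keeps (.writeR _ 7 0 ((0 : ℕ) : ℝ))
  refine Ens.forTo (M := I.m) (τ := 3) (fun j s' =>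
    s'.ints 22 0 = ∑ j' ∈ range j, ((I.pt (F.act (s.ints 12 j')) i).elim 0 fun _ => 1) ∧
    s'.reals 7 0 = ∑ j' ∈ range j, (I.pt (F.act (s.ints 12 j')) i).getD 0)
    (by decide) ?_ ?_ ?_ ?_
  · intro s' hk
    exact (hC.keeps hk).m
  · simp
  · rintro j s' hj hk hjs ⟨i1, i2⟩
    have hC' := hC.keeps hk
    have e12 : s'.ints 12 = s.ints 12 := by
      rw [hk.1 12 (by decide)]
      funext x
      simp
    have e18 : s'.ints 18 0 = i := by simp [hk.1 18 (by decide), hi]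
    have ha : s.ints 12 j < F.A.length := by
      rw [hsmp ⟨j, hj⟩]
      exact hg _
    have hact := hC'.act _ ha
    obtain ⟨k1, k2⟩ := hC'.pt _ (h.lt _ ha) i hid
    refine Ens.seq_of (Ens.setI (P := fun s' => s' = _) rfl) ?_ (τ' := 1) le_rfl
    rintro _ - rfl
    refine Ens.setR ?_
    simp [hC'.n, hC'.d, hC'.top, hjs, e12, e18, hact, k1, k2, i1, i2, sum_range_succ]
  · rintro s' - ⟨i1, i2⟩
    rw [i1, i2, Finset.sum_range, Finset.sum_range, Inst.cnt, Inst.tot, card_filter]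
    constructor
    · refine sum_congr rfl fun j _ => ?_
      rw [hsmp]
      cases I.pt (F.act (g j)) i <;> simp
    · exact sum_congr rfl fun j _ => by rw [hsmp]

open Classical in
theorem holds_fixE {I : Inst} {s : Store} {F : Frame} {t e i : ℕ} {g : Fin I.m → ℕ}
    (hm : s.ints 3 0 = I.m) (he : s.ints 14 0 = e) (hpos : s.ints 21 0 = Inst.pos F.u t i)
    (hcnt : s.ints 22 0 = I.cnt F g i) (hu : F.u t i = none) :
    fixE.Holds s ↔ I.Fix F t e g i := by
  simp only [fixE, BExp.Holds, IExp.eval, hm, he, hpos, hcnt, Inst.Fix, hu, true_and]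
  omega

end MissingKMeans

/-! ### Estimation of a center in the memory, and the visit of a node -/

namespace MissingKMeans

open Finset RealRAM Program

open Classical in
/-- The centers after the estimation of the coordinates below `j`. -/
noncomputable def freezeTo (I : Inst) (F : Frame) (t e : ℕ) (g : Fin I.m → ℕ) (j : ℕ) : Centers :=
  fun t' i => if t' = t ∧ i < j ∧ I.Fix F t e g i then some (I.tot F g i / I.cnt F g i)
    else F.u t' i

open Classical in
theorem freezeTo_succ_of_not {I : Inst} {F : Frame} {t e j : ℕ} {g : Fin I.m → ℕ}
    (h : ¬ I.Fix F t e g j) : freezeTo I F t e g (j + 1) = freezeTo I F t e g j := by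
  funext t' i
  unfold freezeTo
  refine if_congr (and_congr_right fun _ => and_congr_left fun h' => ?_) rfl rfl
  have : i ≠ j := fun hij => h (hij ▸ h')
  omega

open Classical in
theorem freezeTo_succ_of_fix {I : Inst} {F : Frame} {t e j : ℕ} {g : Fin I.m → ℕ}
    (h : I.Fix F t e g j) (t' i : ℕ) : freezeTo I F t e g (j + 1) t' i =
      if t' = t ∧ i = j then some (I.tot F g j / I.cnt F g j) else freezeTo I F t e g j t' i := by
  unfold freezeTo
  by_cases hij : i = j
  · subst hij
    by_cases ht : t' = t <;> simp [ht, h]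
  · have : i < j + 1 ↔ i < j := by omega
    simp [hij, this]

/-- The flags are read in the block of the parent and written in the block of the child, so the
counter of unknown coordinates refers to the parent throughout, as `pos` does. -/
theorem ens_freezeCode {I : Inst} {s : Store} {r t e : ℕ} {F : Frame} {g : Fin I.m → ℕ}
    (h : Cur I s r F)
    (hcopy : RepFrame I s (r + 1) { F with bud := 20 * F.A.length, b0 := 20 * F.A.length })
    (ht : s.ints 13 0 = t) (he : s.ints 14 0 = e) (htk : t < I.k)
    (hg : ∀ j, g j < F.A.length) (hsmp : ∀ j : Fin I.m, s.ints 12 j = g j) :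
    Ens freezeCode s (I.d * (I.m * 6 + 18) + 5) fun s' =>
      RepFrame I s' (r + 1) (I.child F t e g) ∧ ∀ r' ≠ r + 1, SameFrame I s s' r' := by
  classical
  refine Ens.seq_of (Ens.setI (P := fun s' => s' = _) rfl) ?_ (τ' := I.d * (I.m * 6 + 18) + 3)
    (by omega)
  rintro _ - rfl
  simp only [IExp.eval]
  have hC0 := h.keeps (.writeI s 21 0 0)
  refine Ens.forTo (M := I.d) (τ := I.m * 6 + 15) (fun j s' =>
    s'.ints 21 0 = ((range j).filter fun i => F.u t i = none).card ∧
    (∀ t' < I.k, ∀ i < I.d, RepO (s'.ints 10 (I.cen (r + 1) t' i))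
      (s'.reals 4 (I.cen (r + 1) t' i)) (freezeTo I F t e g j t' i)) ∧
    ∀ r' ≠ r + 1, ∀ p < I.k * I.d,
        s'.ints 10 (adr (I.k * I.d) r' p) = s.ints 10 (adr (I.k * I.d) r' p) ∧
        s'.reals 4 (adr (I.k * I.d) r' p) = s.reals 4 (adr (I.k * I.d) r' p))
    (by decide) ?_ ?_ ?_ ?_
  · intro s' hk
    exact (hC0.toConsts.keeps hk).d
  · refine ⟨by simp, fun t' ht' i hi => ?_, fun r' _ p _ => by simp⟩
    simpa [freezeTo] using hcopy.cen t' ht' i hi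
  · rintro j s' hj hk hjs ⟨i1, i2, i3⟩
    have hsame : SameFrame I (s.writeI 21 0 0) s' r :=
      { cnt := by rw [hk.1 7 (by decide)]
        bud := by rw [hk.1 8 (by decide)]
        acc := by rw [hk.2 3 (by decide)]
        act := fun p _ => by rw [hk.1 9 (by decide)]
        frz := fun p hp => by simpa using (i3 r (by omega) p hp).1
        val := fun p hp => by simpa using (i3 r (by omega) p hp).2 }
    have hC : Cur I s' r F :=
      { toConsts := hC0.toConsts.keeps hk
        toRepFrame := hC0.toRepFrame.same hsame
        top := by rw [hk.1 27 (by decide)]; exact hC0.top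
        len := by rw [hk.1 28 (by decide)]; exact hC0.len }
    have e13 : s'.ints 13 0 = t := by simp [hk.1 13 (by decide), ht]
    have e14 : s'.ints 14 0 = e := by simp [hk.1 14 (by decide), he]
    have e12 : s'.ints 12 = s.ints 12 := by
      rw [hk.1 12 (by decide)]
      funext x
      simp
    have hflag := (hC.cen t htk j hj).1
    refine Ens.le (τ := I.m * 6 + 14 + 1) (Ens.ite (fun hs => ?_) fun hs => ?_) le_rfl
    · refine Ens.le (Ens.skip ?_) (by omega)
      have hu : F.u t j ≠ none := by
        simp only [BExp.Holds, IExp.eval, eval_ix, hC.k, hC.d, hC.top, e13, hjs, hflag] at hs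
        intro hu
        simp [hu] at hs
      rw [freezeTo_succ_of_not fun hf => hu hf.1, range_add_one, filter_insert, if_neg hu]
      simpa [i1] using ⟨i2, i3⟩
    · have hu : F.u t j = none := by
        simp only [BExp.Holds, IExp.eval, eval_ix, hC.k, hC.d, hC.top, e13, hjs, hflag] at hs
        cases hu : F.u t j with
        | none => rfl
        | some v => simp [hu] at hs
      have hcard : ((range (j + 1)).filter fun i => F.u t i = none).card
          = ((range j).filter fun i => F.u t i = none).card + 1 := by
        rw [range_add_one, filter_insert, if_pos hu, card_insert_of_notMem (by simp)]
      refine Ens.seq_of (Ens.setI (P := fun s' => s' = _) rfl) ?_ (τ' := I.m * 6 + 12) (by omega)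
      rintro _ - rfl
      simp only [IExp.eval, i1]
      generalize hs1 : s'.writeI 21 0 (((range j).filter fun i => F.u t i = none).card + 1) = s1
      have hC1 : Cur I s1 r F := by
        rw [← hs1]
        exact hC.keeps (.writeI _ _ _ _)
      have hkeep1 : Keeps (.setI 21 (.lit 0) (.lit 0)) s' s1 := by
        rw [← hs1]
        exact .writeI _ _ _ _
      refine Ens.seq_of (ens_sumCode hC1 (by rw [hkeep1.1 18 (by decide), hjs]) hj hg
        (by rw [hkeep1.1 12 (by decide), e12]; exact hsmp)) ?_ (τ' := 4) (by omega)
      rintro s2 hk2 ⟨c1, c2⟩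
      have hC2 := hC1.keeps hk2
      have f13 : s2.ints 13 0 = t := by rw [hk2.1 13 (by decide), hkeep1.1 13 (by decide), e13]
      have f14 : s2.ints 14 0 = e := by rw [hk2.1 14 (by decide), hkeep1.1 14 (by decide), e14]
      have f18 : s2.ints 18 0 = j := by rw [hk2.1 18 (by decide), hkeep1.1 18 (by decide), hjs]
      have f21 : s2.ints 21 0 = ((range (j + 1)).filter fun i => F.u t i = none).card := by
        rw [hk2.1 21 (by decide), ← hs1, hcard]
        simp
      have f10 : s2.ints 10 = s'.ints 10 := by
        rw [hk2.1 10 (by decide), hkeep1.1 10 (by decide)]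
      have f4 : s2.reals 4 = s'.reals 4 := by
        rw [hk2.2 4 (by decide), hkeep1.2 4 (by decide)]
      -- The counter has been raised before the test and includes `j`, in accordance with `range (i
      -- + 1)` in `pos`.
      have hfix : fixE.Holds s2 ↔ I.Fix F t e g j :=
        holds_fixE hC2.m f14 (by rw [f21, Inst.pos]) c1 hu
      refine Ens.ite (fun hs => ?_) fun hs => ?_
      · rw [hfix] at hs
        refine Ens.seq_of (Ens.setI (P := fun s' => s' = _) rfl) ?_ (τ' := 1) le_rfl
        rintro _ - rfl
        refine Ens.setR ?_
        have hlt := adr_lt hj htk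
        simp only [IExp.eval, RExp.eval, eval_ix, Store.writeI_ints, Store.writeI_reals,
          OfNat.zero_ne_ofNat, OfNat.one_ne_ofNat, Nat.reduceEqDiff, if_false, hC2.k, hC2.d, hC2.top, f13, f18, c1, c2]
        refine ⟨by simp [f21], fun t' ht' i hi => ?_, fun r' hr' p hp => ?_⟩
        · rw [freezeTo_succ_of_fix hs]
          have hinj : adr (I.k * I.d) (r + 1) (adr I.d t' i) = adr (I.k * I.d) (r + 1) (adr I.d t j)
              ↔ t' = t ∧ i = j := by
            rw [adr_inj (adr_lt hi ht') hlt, adr_inj hi hj]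
            simp
          by_cases hti : t' = t ∧ i = j
          · rw [if_pos hti]
            obtain ⟨rfl, rfl⟩ := hti
            simp [RepO]
          · rw [if_neg hti]
            have := i2 t' ht' i hi
            rw [← hinj] at hti
            simpa [hti, f10, f4] using this
        · have hinj : adr (I.k * I.d) r' p ≠ adr (I.k * I.d) (r + 1) (adr I.d t j) := by
            rw [Ne, adr_inj hp hlt]
            exact fun h => hr' h.1
          simpa [hinj, f10, f4] using i3 r' hr' p hp
      · rw [hfix] at hs
        refine Ens.le (Ens.skip ?_) (by norm_num)
        rw [freezeTo_succ_of_not hs]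
        simp only [Store.writeI_ints, Store.writeI_reals, Nat.reduceEqDiff, if_false, f21, f10, f4]
        exact ⟨trivial, i2, i3⟩
  · rintro s' hk ⟨i1, i2, i3⟩
    have e7 : s'.ints 7 = s.ints 7 := by rw [hk.1 7 (by decide)]; funext x; simp
    have e8 : s'.ints 8 = s.ints 8 := by rw [hk.1 8 (by decide)]; funext x; simp
    have e9 : s'.ints 9 = s.ints 9 := by rw [hk.1 9 (by decide)]; funext x; simp
    have e3 : s'.reals 3 = s.reals 3 := by rw [hk.2 3 (by decide)]; funext x; simp
    refine ⟨⟨?_, ?_, ?_, ?_, ?_, h.le, h.lt⟩, fun r' hr' => ⟨?_, ?_, ?_, ?_, ?_, ?_⟩⟩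
    · rw [e7]; exact hcopy.cnt
    · rw [e8]; exact hcopy.bud
    · rw [e3]; exact hcopy.acc
    · rw [e9]; exact hcopy.act
    · intro t' ht' i hi
      have : (I.child F t e g).u t' i = freezeTo I F t e g I.d t' i := by
        change I.freeze F t e g t' i = _
        simp only [Inst.freeze, freezeTo, hi, true_and]
      rw [this]
      exact i2 t' ht' i hi
    · rw [e7]
    · rw [e8]
    · rw [e3]
    · simp [e9]
    · exact fun p hp => (i3 r' hr' p hp).1
    · exact fun p hp => (i3 r' hr' p hp).2

/-! ### The representation of the state -/

/-- The memory contains the stack. -/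
def RepStack (I : Inst) (s : Store) : List Frame → Prop
  | [] => True
  | F :: st => RepFrame I s st.length F ∧ RepStack I s st

theorem RepStack.same {I : Inst} {s s' : Store} {st : List Frame} (h : RepStack I s st)
    (hs : ∀ r < st.length, SameFrame I s s' r) : RepStack I s' st := by
  induction st with
  | nil => trivial
  | cons F st ih =>
    exact ⟨h.1.same (hs _ (by simp)), ih h.2 fun r hr => hs r (by simp; omega)⟩

/-- The memory contains the state, which satisfies the invariants of the search. -/
structure Rep (I : Inst) (s : Store) (σ : State) : Prop extends Consts I s where
  stack : RepStack I s σ.stack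
  dep : s.ints 6 0 = σ.stack.length
  tr : s.ints 5 0 = σ.tr
  best : RepBest I s σ.best
  ok : ∀ F ∈ σ.stack, Inst.Frame.Ok F ∧ I.Safe F
  le : σ.stack.length ≤ I.R + 1

/-- The order matters: the child is copied from block `r` to block `r + 1` before the pivot compacts
block `r`, so both arise from the same `F`. The distances computed first remain valid for the pivot.
-/
theorem ens_workCode {I : Inst} {s : Store} {r t e z : ℕ} {F : Frame} {st : List Frame} {T : ℕ}
    {best : Option ℝ} {g : Fin I.m → ℕ} (h : Rep I s ⟨F :: st, T, best⟩) (hC : Cur I s r F)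
    (hr : st.length = r)
    (ht : s.ints 13 0 = t) (he : s.ints 14 0 = e) (hz : s.ints 15 0 = z) (htk : t < I.k)
    (hza : z < F.A.length)
    (hg : ∀ j, g j < F.A.length) (hsmp : ∀ j : Fin I.m, s.ints 12 j = g j) :
    Ens workCode s (F.A.length * (I.k * (I.d * 6 + 17) + 33) + I.k * I.d * 10 +
      I.d * (I.m * 6 + 18) + 61) fun s' => Rep I s' (I.visit F st T best t e z g) := by
  have hok := h.ok F (by simp)
  refine Ens.seq_of (ens_nearCode hC) ?_ (τ' := F.A.length * 23 + I.k * I.d * 10 +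
      I.d * (I.m * 6 + 18) + 57) (by nlinarith)
  intro s1 hk1 hnear
  have hC1 := hC.keeps hk1
  refine Ens.seq_of (ens_candCode hC1 hok.2 hnear (h.best.keeps hk1)) ?_ (τ' := F.A.length * 16 +
    I.k * I.d * 6 + I.d * (I.m * 6 + 18) + 40) (by nlinarith)
  intro s2 hk2 hbest
  have hC2 := hC1.keeps hk2
  have hnear2 : ∀ p < F.A.length, NearRep I s2 F p I.k := by
    intro p hp
    have e11 := hk2.1 11 (by decide)
    have e2 := hk2.1 2 (by decide)
    have e5 := hk2.2 5 (by decide)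
    unfold NearRep
    rw [e11, e2, e5]
    exact hnear p hp
  have hst2 : RepStack I s2 st := h.stack.2.same fun r' _ =>
    (SameFrame.of_keeps hk1).trans (.of_keeps hk2)
  have e13 : s2.ints 13 0 = t := by rw [hk2.1 13 (by decide), hk1.1 13 (by decide), ht]
  have e14 : s2.ints 14 0 = e := by rw [hk2.1 14 (by decide), hk1.1 14 (by decide), he]
  have e15 : s2.ints 15 0 = z := by rw [hk2.1 15 (by decide), hk1.1 15 (by decide), hz]
  have e12 : s2.ints 12 = s.ints 12 := by rw [hk2.1 12 (by decide), hk1.1 12 (by decide)]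
  have e6 : s2.ints 6 0 = st.length + 1 := by
    rw [hk2.1 6 (by decide), hk1.1 6 (by decide), h.dep]
    simp
  have e5 : s2.ints 5 0 = T := by rw [hk2.1 5 (by decide), hk1.1 5 (by decide), h.tr]
  have hlen : st.length ≤ I.R := by simpa using h.le
  have hmid : Ens (.ite (.ltI (iv 27) (iv 4))
      (.seq copyCode (.seq freezeCode (setIv 6 (.add (iv 6) (.lit 1))))) .skip) s2
      (F.A.length * 4 + I.k * I.d * 6 + I.d * (I.m * 6 + 18) + 23) fun s' =>
      (∀ r' ≤ r, SameFrame I s2 s' r') ∧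
      (r < I.R → RepFrame I s' (r + 1) (I.child F t e g) ∧ s'.ints 6 0 = r + 2) ∧
      (¬ r < I.R → s'.ints 6 0 = r + 1) := by
    refine Ens.le (Ens.ite (τ := F.A.length * 4 + I.k * I.d * 6 + I.d * (I.m * 6 + 18) + 22)
      (fun hs => ?_) fun hs => ?_) le_rfl
    · have hlt : r < I.R := by simpa [hC2.top, hC2.R] using hs
      refine Ens.seq_of (ens_copyCode hC2) ?_ (τ' := I.d * (I.m * 6 + 18) + 7) (by omega)
      rintro s3 hk3 ⟨hcopy, hsame3⟩
      have hC3 : Cur I s3 r F :=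
        { toConsts := hC2.toConsts.keeps hk3
          toRepFrame := hC2.toRepFrame.same (hsame3 r (by omega))
          top := by rw [hk3.1 27 (by decide), hC2.top]
          len := by rw [hk3.1 28 (by decide), hC2.len] }
      refine Ens.seq_of (ens_freezeCode hC3 hcopy (by rw [hk3.1 13 (by decide), e13])
        (by rw [hk3.1 14 (by decide), e14]) htk hg
        (by rw [hk3.1 12 (by decide), e12]; exact hsmp)) ?_ (τ' := 1) (by omega)
      rintro s4 hk4 ⟨hchild, hsame4⟩
      have f6 : s4.ints 6 0 = r + 1 := by
        rw [hk4.1 6 (by decide), hk3.1 6 (by decide), e6, hr]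
      refine Ens.setI ⟨fun r' hr' => ?_, fun _ => ⟨?_, ?_⟩, fun hn => absurd hlt hn⟩
      · exact ((hsame3 r' (by omega)).trans (hsame4 r' (by omega))).trans
          (.of_keeps (.writeI _ _ _ _))
      · exact hchild.keeps (.writeI _ _ _ _)
      · simp [f6]
    · have hlt : ¬ r < I.R := by simpa [hC2.top, hC2.R] using hs
      refine Ens.le (Ens.skip ⟨fun r' _ => ?_, fun hh => absurd hh hlt, fun _ => ?_⟩) (by omega)
      · exact .of_keeps (Keeps.refl .skip s2)
      · rw [e6, hr]
  refine Ens.seq_of hmid ?_ (τ' := F.A.length * 12 + 16) (by omega)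
  rintro s3 hk3 ⟨hsame3, hch, hnch⟩
  have hC3 : Cur I s3 r F :=
    { toConsts := hC2.toConsts.keeps hk3
      toRepFrame := hC2.toRepFrame.same (hsame3 r le_rfl)
      top := by rw [hk3.1 27 (by decide), hC2.top]
      len := by rw [hk3.1 28 (by decide), hC2.len] }
  have hnear3 : ∀ p < F.A.length, NearRep I s3 F p I.k := fun p hp => (hnear2 p hp).keeps hk3
  refine (ens_pivotCode hC3 hnear3 (by rw [hk3.1 15 (by decide), e15]) hza).conseq le_rfl ?_
  rintro s4 hk4 ⟨hpiv, hsame4⟩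
  have hst4 : RepStack I s4 st := hst2.same fun r' hr' =>
    (hsame3 r' (by omega)).trans (hsame4 r' (by omega))
  have f6 := hk4.1 6 (by decide)
  have f5 : s4.ints 5 0 = T := by rw [hk4.1 5 (by decide), hk3.1 5 (by decide), e5]
  have hbest4 : RepBest I s4 (I.upd best F) := (hbest.keeps hk3).keeps hk4
  have hokp : Inst.Frame.Ok (I.pivot F z) ∧ I.Safe (I.pivot F z) :=
    ⟨Inst.Ok.pivot I hok.1 z, Inst.Safe.pivot I hok.2 z⟩
  have hokst : ∀ F' ∈ st, Inst.Frame.Ok F' ∧ I.Safe F' := fun F' hF' =>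
    h.ok F' (List.mem_cons_of_mem _ hF')
  by_cases hlt : r < I.R
  · obtain ⟨hch1, hch2⟩ := hch hlt
    have hstk : (I.visit F st T best t e z g).stack = I.child F t e g :: I.pivot F z :: st := by
      simp [Inst.visit, hr, hlt]
    refine ⟨hC3.toConsts.keeps hk4, ?_, ?_, f5, hbest4, ?_, ?_⟩
    · rw [hstk]
      refine ⟨?_, ?_, hst4⟩
      · simp only [List.length_cons, hr]
        exact hch1.same (hsame4 _ (by omega))
      · rw [hr]
        exact hpiv
    · rw [hstk, f6, hch2]
      simp [hr]
    · rw [hstk]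
      intro F' hF'
      rcases List.mem_cons.1 hF' with rfl | hF'
      · exact ⟨Inst.Ok.child I hok.1 t e g, Inst.Safe.child I hok.2 t e g⟩
      · rcases List.mem_cons.1 hF' with rfl | hF'
        · exact hokp
        · exact hokst F' hF'
    · rw [hstk]
      simp
      omega
  · have hstk : (I.visit F st T best t e z g).stack = I.pivot F z :: st := by
      simp [Inst.visit, hr, hlt]
    refine ⟨hC3.toConsts.keeps hk4, ?_, ?_, f5, hbest4, ?_, ?_⟩
    · rw [hstk]
      refine ⟨?_, hst4⟩
      rw [hr]
      exact hpiv
    · rw [hstk, f6, hnch hlt]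
      simp [hr]
    · rw [hstk]
      intro F' hF'
      rcases List.mem_cons.1 hF' with rfl | hF'
      · exact hokp
      · exact hokst F' hF'
    · rw [hstk]
      simp
      omega

end MissingKMeans

namespace MissingKMeans

open Finset RealRAM Program

/-! ### The random choices -/

/-- The loop that draws the samples. -/
def sampleLoop : Cmd :=
  .loop (.ltI (iv 19) (iv 3))
    (.seq (.rand 12 (iv 19) (.sub (iv 28) (.lit 1))) (setIv 19 (.add (iv 19) (.lit 1))))

/-- Induction on the number of draws that remain: the first draw is the first entry of the tuple,
and the nested averages combine to the average over all tuples by `sum_tuples_succ`. -/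
theorem wins_sampleLoop {S : Set Config} {K : List Cmd} {τ a : ℕ} (ha : 0 < a) (m' : ℕ) :
    ∀ (j : ℕ) (s : Store) (f : (Fin m' → ℕ) → ℝ), s.ints 19 0 = j → s.ints 3 0 = j + m' →
      s.ints 28 0 = a → (∀ g, 0 ≤ f g) →
      (∀ g ∈ tuples (range a) m', ∀ s', Keeps sampleLoop s s' →
        (∀ i < j, s'.ints 12 i = s.ints 12 i) → (∀ i : Fin m', s'.ints 12 (j + i) = g i) →
        Wins S τ (f g) (K, s')) →
      Wins S (τ + m' * 4 + 1) ((∑ g ∈ tuples (range a) m', f g) / (a : ℝ) ^ m')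
        (sampleLoop :: K, s) := by
  induction m' with
  | zero =>
    intro j s f h19 h3 h28 hf h
    have hw := h (fun i => i.elim0) (Fintype.mem_piFinset.2 fun i => i.elim0) s (Keeps.refl _ _) (fun _ _ => rfl)
      (fun i => i.elim0)
    refine (hw.of_step (x := (sampleLoop :: K, s)) ?_).mono (by omega) ?_
    · simp [sampleLoop, step, h19, h3]
    · simp only [pow_zero, div_one]
      rw [Finset.sum_eq_single_of_mem (fun i : Fin 0 => i.elim0 (α := ℕ))
        (Fintype.mem_piFinset.2 fun i => i.elim0)]
      intro g _ hg
      exact absurd (Subsingleton.elim _ _) hg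
  | succ m' ih =>
    intro j s f h19 h3 h28 hf h
    have hstep : ∀ v < a, Wins S (τ + m' * 4 + 1 + 1)
        ((∑ g ∈ tuples (range a) m', f (Fin.cons v g)) / (a : ℝ) ^ m')
        (setIv 19 (.add (iv 19) (.lit 1)) :: sampleLoop :: K, s.writeI 12 (IExp.eval s (iv 19)) v) := by
      intro v hv
      refine Wins.of_step rfl ?_
      simp only [IExp.eval, h19, Store.writeI_ints, Nat.reduceEqDiff, if_false]
      refine ih (j + 1) _ (fun g => f (Fin.cons v g)) (by simp) (by simp [h3]; omega)
        (by simp [h28]) (fun g => hf _) ?_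
      intro g hg s' hk h1 h2
      refine h (Fin.cons v g) ?_ s' ?_ ?_ ?_
      · rw [Fintype.mem_piFinset] at hg ⊢
        intro i
        refine Fin.cases ?_ (fun i => ?_) i
        · simpa using hv
        · simpa using hg i
      · refine ⟨fun b hb => ?_, fun b hb => ?_⟩
        · rw [hk.1 b hb]
          have h12 : 12 ≠ b := hb.1
          have h19' : 19 ≠ b := hb.2
          funext x
          simp [h12.symm, h19'.symm]
        · rw [hk.2 b hb]
          rfl
      · intro i hi
        rw [h1 i (by omega)]
        simp [hi.ne]
      · intro i
        refine Fin.cases ?_ (fun i => ?_) i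
        · have := h1 j (by omega)
          simpa using this
        · have := h2 i
          simp only [Fin.val_succ, Fin.cons_succ]
          rw [← this]
          congr 1
          omega
    have hr := Wins.rand (a := 12) (i := iv 19) (e := .sub (iv 28) (.lit 1)) (N := a)
      (by simp only [IExp.eval, h28]; omega)
      (fun v _ => div_nonneg (Finset.sum_nonneg fun g _ => hf _) (by positivity)) hstep
    have hs1 := Wins.of_step (x := (Cmd.seq (.rand 12 (iv 19) (.sub (iv 28) (.lit 1)))
      (setIv 19 (.add (iv 19) (.lit 1))) :: sampleLoop :: K, s)) rfl hr
    refine (hs1.of_step (x := (sampleLoop :: K, s)) ?_).mono (by omega) (le_of_eq ?_)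
    · conv_lhs => rw [sampleLoop]
      simp [step, h19, h3, sampleLoop]
    · rw [sum_tuples_succ, ← Finset.sum_div, div_div, pow_succ]

/-- The four independent random choices are peeled off from the inside outwards; the nested averages
are one average over all draws because each range is fixed before the visit. -/
theorem wins_visitCode {I : Inst} {S : Set Config} {K : List Cmd} {s : Store} {τ a : ℕ}
    {f : ℕ → ℕ → ℕ → (Fin I.m → ℕ) → ℝ} (h : Consts I s) (ha : 0 < a) (hk : 1 ≤ I.k)
    (h28 : s.ints 28 0 = a) (hf : ∀ t e z g, 0 ≤ f t e z g)
    (hw : ∀ t < I.k, ∀ e z, z < a → ∀ g ∈ tuples (range a) I.m, ∀ s',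
      Keeps (.seq (setIv 13 (.lit 0)) (.seq (setIv 14 (.lit 0)) (.seq (setIv 15 (.lit 0))
        sampleCode))) s s' →
      s'.ints 13 0 = t → s'.ints 14 0 = e → s'.ints 15 0 = z →
      (∀ j : Fin I.m, s'.ints 12 j = g j) → Wins S τ (f t e z g) (workCode :: K, s')) :
    Wins S (τ + I.m * 4 + 10) (I.sumDraws a f / I.numDraws a) (visitCode :: K, s) := by
  have hw4 : ∀ t < I.k, ∀ e z, z < a → Wins S (τ + I.m * 4 + 1 + 1 + 1 + 1)
      ((∑ g ∈ tuples (range a) I.m, f t e z g) / (a : ℝ) ^ I.m)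
      (.seq sampleCode workCode :: K,
        ((s.writeI 13 0 t).writeI 14 0 e).writeI 15 0 z) := by
    intro t ht e z hz
    refine Wins.of_step rfl (Wins.of_step (x := (sampleCode :: workCode :: K, _)) rfl
      (Wins.of_step (x := (setIv 19 (.lit 0) :: sampleLoop :: workCode :: K, _)) rfl ?_))
    refine wins_sampleLoop ha I.m 0 _ (f t e z) (by simp) (by simp [h.m]) (by simp [h28])
      (hf t e z) ?_
    intro g hg s' hk' _ h2
    refine hw t ht e z hz g hg s' ⟨fun b hb => ?_, fun b hb => ?_⟩ ?_ ?_ ?_ ?_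
    · have hb1 : 13 ≠ b := hb.1
      have hb2 : 14 ≠ b := hb.2.1
      have hb3 : 15 ≠ b := hb.2.2.1
      have hb4 : 19 ≠ b := hb.2.2.2.1
      rw [hk'.1 b hb.2.2.2.2]
      funext x
      simp [hb1.symm, hb2.symm, hb3.symm, hb4.symm]
    · rw [hk'.2 b hb.2.2.2.2]
      rfl
    · simp [hk'.1 13 (by decide)]
    · simp [hk'.1 14 (by decide)]
    · simp [hk'.1 15 (by decide)]
    · intro j
      simpa using h2 j
  have hw3 : ∀ t < I.k, ∀ e, Wins S (τ + I.m * 4 + 1 + 1 + 1 + 1 + 1 + 1)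
      ((∑ z ∈ range a, (∑ g ∈ tuples (range a) I.m, f t e z g) / (a : ℝ) ^ I.m) / a)
      (.seq (.rand 15 (.lit 0) (.sub (iv 28) (.lit 1))) (.seq sampleCode workCode) :: K,
        (s.writeI 13 0 t).writeI 14 0 e) := by
    intro t ht e
    refine Wins.of_step rfl (Wins.rand (by simp [h28]; omega)
      (fun z _ => div_nonneg (Finset.sum_nonneg fun g _ => hf _ _ _ _) (by positivity)) ?_)
    exact fun z hz => hw4 t ht e z hz
  have hw2 : ∀ t < I.k, Wins S (τ + I.m * 4 + 1 + 1 + 1 + 1 + 1 + 1 + 1 + 1)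
      ((∑ e ∈ range (2 * I.Δ + 1),
        (∑ z ∈ range a, (∑ g ∈ tuples (range a) I.m, f t e z g) / (a : ℝ) ^ I.m) / a)
          / (2 * I.Δ + 1 : ℕ))
      (.seq (.rand 14 (.lit 0) (.mul (.lit 2) ΔE)) (.seq (.rand 15 (.lit 0)
        (.sub (iv 28) (.lit 1))) (.seq sampleCode workCode)) :: K, s.writeI 13 0 t) := by
    intro t ht
    refine Wins.of_step rfl (Wins.rand (by simp [h.Δ])
      (fun e _ => div_nonneg (Finset.sum_nonneg fun z _ => div_nonneg
        (Finset.sum_nonneg fun g _ => hf _ _ _ _) (by positivity)) (by positivity)) ?_)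
    exact fun e _ => hw3 t ht e
  have hw1 := Wins.of_step (x := (visitCode :: K, s)) rfl
    (Wins.rand (S := S) (a := 13) (i := .lit 0) (e := .sub kE (.lit 1)) (N := I.k)
    (by simp [h.k]; omega)
    (fun t _ => div_nonneg (Finset.sum_nonneg fun e _ => div_nonneg (Finset.sum_nonneg
      fun z _ => div_nonneg (Finset.sum_nonneg fun g _ => hf _ _ _ _) (by positivity))
      (by positivity)) (by positivity)) hw2)
  refine hw1.mono (by omega) (le_of_eq ?_)
  unfold Inst.sumDraws Inst.numDraws
  simp only [← Finset.sum_div, div_div]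
  push_cast
  congr 1
  ring

/-! ### The search -/

theorem Rep.keeps {I : Inst} {s s' : Store} {σ : State} {c : Cmd} (h : Rep I s σ)
    (hk : Keeps c s s')
    (hc : (c.KeepsI 0 ∧ c.KeepsI 1 ∧ c.KeepsI 3 ∧ c.KeepsI 4 ∧ c.KeepsR 1) := by decide)
    (hc' : (c.KeepsI 7 ∧ c.KeepsI 8 ∧ c.KeepsI 9 ∧ c.KeepsI 10 ∧ c.KeepsR 3 ∧ c.KeepsR 4) := by
      decide)
    (hc'' : (c.KeepsI 25 ∧ c.KeepsR 8 ∧ c.KeepsR 2) := by decide)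
    (hst : (c.KeepsI 5 ∧ c.KeepsI 6) := by decide) : Rep I s' σ where
  toConsts := h.toConsts.keeps hk hc
  stack := h.stack.same fun _ _ => .of_keeps hk hc'
  dep := by rw [hk.1 6 hst.2, h.dep]
  tr := by rw [hk.1 5 hst.1, h.tr]
  best := h.best.keeps hk hc''
  ok := h.ok
  le := h.le

theorem ens_pushCode {I : Inst} {s : Store} {T : ℕ} {best : Option ℝ} (hn : 1 ≤ I.n)
    (h : Rep I s ⟨[], T + 1, best⟩) :
    Ens pushCode s (I.n * 4 + I.k * I.d * 6 + 17) fun s' => Rep I s' ⟨[I.root], T, best⟩ := by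
  refine Ens.seq_of (Ens.setI (P := fun s' => s' = _) rfl) ?_
    (τ' := I.n * 4 + I.k * I.d * 6 + 15) (by omega)
  rintro _ - rfl
  refine Ens.seq_of (Ens.setI (P := fun s' => s' = _) rfl) ?_
    (τ' := I.n * 4 + I.k * I.d * 6 + 13) (by omega)
  rintro _ - rfl
  refine Ens.seq_of (Ens.setI (P := fun s' => s' = _) rfl) ?_
    (τ' := I.n * 4 + I.k * I.d * 6 + 11) (by omega)
  rintro _ - rfl
  refine Ens.seq_of (Ens.setR (P := fun s' => s' = _) rfl) ?_
    (τ' := I.n * 4 + I.k * I.d * 6 + 9) (by omega)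
  rintro _ - rfl
  have htr : s.ints 5 0 = T + 1 := h.tr
  simp only [IExp.eval, RExp.eval, Store.writeI_ints, OfNat.zero_ne_ofNat, if_false, h.n, htr,
    Nat.add_sub_cancel, Nat.cast_zero]
  generalize hs1 : (((s.writeI 5 0 T).writeI 7 0 I.n).writeI 8 0 (20 * I.n)).writeR 3 0 0 = s1
  have hC1 : Consts I s1 := by
    rw [← hs1]
    exact (((h.toConsts.keeps (.writeI _ _ _ _)).keeps (.writeI _ _ _ _)).keeps
      (.writeI _ _ _ _)).keeps (.writeR _ _ _ _)
  have hB1 : RepBest I s1 best := by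
    rw [← hs1]
    exact (((h.best.keeps (.writeI _ _ _ _)).keeps (.writeI _ _ _ _)).keeps
      (.writeI _ _ _ _)).keeps (.writeR _ _ _ _)
  have a5 : s1.ints 5 0 = T := by simp [← hs1]
  have a7 : s1.ints 7 0 = I.n := by simp [← hs1]
  have a8 : s1.ints 8 0 = 20 * I.n := by simp [← hs1]
  have a3 : s1.reals 3 0 = 0 := by simp [← hs1]
  have hloop : Ens (forTo 16 nE (.setI 9 (iv 16) (iv 16))) s1 (I.n * 4 + 3)
      fun s' => ∀ p < I.n, s'.ints 9 p = p := by
    refine Ens.forTo (M := I.n) (τ := 1) (fun j s' => ∀ p < j, s'.ints 9 p = p)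
      (by decide) ?_ ?_ ?_ ?_
    · intro s' hk
      exact (hC1.keeps hk).n
    · simp
    · intro p s' hp hk hps hI
      refine Ens.setI fun q hq => ?_
      simp only [IExp.eval, hps, Store.writeI_ints, Nat.reduceEqDiff, if_false, if_true]
      split_ifs with hqp
      · exact hqp.symm
      · exact hI q (by omega)
    · exact fun s' _ h => h
  refine Ens.seq_of hloop ?_ (τ' := I.k * I.d * 6 + 5) (by omega)
  intro s2 hk2 h9
  have hC2 := hC1.keeps hk2
  have hloop' : Ens (forTo 19 (.mul kE dE) (.seq (.setI 10 (iv 19) (.lit 0))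
      (.setR 4 (iv 19) (.ofInt (.lit 0))))) s2 (I.k * I.d * 6 + 3)
      fun s' => ∀ p < I.k * I.d, s'.ints 10 p = 0 ∧ s'.reals 4 p = 0 := by
    refine Ens.forTo (M := I.k * I.d) (τ := 3)
      (fun j s' => ∀ p < j, s'.ints 10 p = 0 ∧ s'.reals 4 p = 0) (by decide) ?_ ?_ ?_ ?_
    · intro s' hk
      have := hC2.keeps hk
      simp [this.k, this.d]
    · simp
    · intro p s' hp hk hps hI
      refine Ens.seq_of (Ens.setI (P := fun s' => s' = _) rfl) ?_ (τ' := 1) le_rfl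
      rintro _ - rfl
      refine Ens.setR fun q hq => ?_
      by_cases hqp : q = p
      · simp [hps, hqp]
      · simpa [hps, hqp] using hI q (by omega)
    · exact fun s' _ h => h
  refine Ens.seq_of hloop' ?_ (τ' := 1) (by omega)
  intro s3 hk3 h10
  have e9 : s3.ints 9 = s2.ints 9 := hk3.1 9 (by decide)
  have e7 : s3.ints 7 0 = I.n := by rw [hk3.1 7 (by decide), hk2.1 7 (by decide), a7]
  have e8 : s3.ints 8 0 = 20 * I.n := by rw [hk3.1 8 (by decide), hk2.1 8 (by decide), a8]
  have e5 : s3.ints 5 0 = T := by rw [hk3.1 5 (by decide), hk2.1 5 (by decide), a5]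
  have e3 : s3.reals 3 0 = 0 := by rw [hk3.2 3 (by decide), hk2.2 3 (by decide), a3]
  refine Ens.setI ?_
  have hF : RepFrame I s3 0 I.root := by
    refine ⟨by rw [e7, I.length_root], e8, e3, fun p hp => ?_, fun t ht i hi => ?_,
      by rw [I.length_root], fun p hp => ?_⟩
    · rw [I.length_root] at hp
      rw [I.act_root hp, adr_zero, e9, h9 p hp]
    · have := h10 _ (adr_lt hi ht)
      simp only [Inst.cen, adr_zero, this]
      exact ⟨rfl, rfl⟩
    · rw [I.length_root] at hp
      rw [I.act_root hp]
      exact hp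
  refine ⟨(hC2.keeps hk3).keeps (.writeI _ _ _ _), ⟨hF.keeps (.writeI _ _ _ _), trivial⟩, ?_, ?_,
    ((hB1.keeps hk2).keeps hk3).keeps (.writeI _ _ _ _), ?_, by simp⟩
  · simp
  · simpa using e5
  · intro F hF
    obtain rfl : F = I.root := by simpa using hF
    exact ⟨I.ok_root hn, Inst.Safe.root I⟩

theorem value_nonneg {I : Inst} {l : ℕ → ℕ} {c : ℕ → ℕ → ℝ} {B : ℝ} (σ : State) :
    0 ≤ I.value l c B σ := by
  unfold Inst.value
  split_ifs
  · exact zero_le_one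
  · have h1 := I.sv_nonneg (l := l) (c := c) B σ.stack
    have h2 : 0 ≤ (1 - I.Q) ^ σ.tr := pow_nonneg (by linarith [I.Q_le_one]) _
    have h3 : (1 - I.Q) ^ σ.tr ≤ 1 :=
      pow_le_one₀ (by linarith [I.Q_le_one]) (by linarith [I.Q_nonneg])
    nlinarith

/-- The number of steps that a visit takes for each active point. -/
def Inst.unit (I : Inst) : ℕ := 200 * (I.k * I.d * I.m)

/-- Strong induction on a bound for the potential. Each pass lowers the potential by at least the
number of its steps, whatever is drawn, while the value does not fall on average. The first fact
bounds the time, the second the probability. -/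
theorem wins_searchCode {I : Inst} {l : ℕ → ℕ} {c : ℕ → ℕ → ℝ} {B : ℝ} {S : Set Config}
    {K : List Cmd} {T₀ : ℕ} (hn : 1 ≤ I.n) (hd : 1 ≤ I.d) (hm : 1 ≤ I.m) (hk : 1 ≤ I.k)
    (hΔ : 1 ≤ I.Δ) (hl : ∀ x, l x < I.k)
    (hmiss : ∀ x, ((range I.d).filter fun i => I.pt x i = none).card ≤ I.Δ)
    (hroot : I.Lucky l c B 0 I.root)
    (hend : ∀ s best, Rep I s ⟨[], 0, best⟩ → Wins S T₀ (I.value l c B ⟨[], 0, best⟩) (K, s))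
    (N : ℕ) : ∀ (s : Store) (σ : State), Rep I s σ → I.potential I.unit σ ≤ N →
      Wins S (N + T₀ + 1) (I.value l c B σ) (searchCode :: K, s) := by
  have hkd : 1 ≤ I.k * I.d := Nat.mul_pos hk hd
  have hkdm : I.k * I.d ≤ I.k * I.d * I.m := Nat.le_mul_of_pos_right _ hm
  have hdm : I.d * I.m ≤ I.k * I.d * I.m := by
    rw [mul_assoc]
    exact Nat.le_mul_of_pos_left _ hk
  have hmm : I.m ≤ I.k * I.d * I.m := Nat.le_mul_of_pos_left _ hkd
  have hkk : I.k ≤ I.k * I.d * I.m := (Nat.le_mul_of_pos_right _ hd).trans hkdm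
  have hdd : I.d ≤ I.k * I.d * I.m := (Nat.le_mul_of_pos_left _ hk).trans hkdm
  induction N using Nat.strong_induction_on with
  | _ N ih =>
    rintro s ⟨st, T, best⟩ h hN
    have hdep := h.dep
    have htr : s.ints 5 0 = T := h.tr
    rcases st with _ | ⟨F, st⟩
    · rcases T with _ | T
      · refine ((hend s best h).of_step (x := (searchCode :: K, s)) ?_).mono (by omega) le_rfl
        have : s.ints 6 0 = 0 := hdep
        simp [searchCode, step, this, htr]
      · have h6 : s.ints 6 0 = 0 := hdep
        have hpot := I.potential_push I.unit T best
        have hunit : 200 * I.n ≤ I.unit * I.n := by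
          unfold Inst.unit
          exact Nat.mul_le_mul_right _ (by omega)
        have hunit' : 200 * (I.k * I.d) ≤ I.unit * I.n := by
          unfold Inst.unit
          calc 200 * (I.k * I.d) ≤ 200 * (I.k * I.d * I.m) * 1 := by omega
            _ ≤ _ := Nat.mul_le_mul_left _ hn
        obtain ⟨t, ht, s', hex, hrep⟩ := ens_pushCode hn h
        have hw := ih (N - I.unit * I.n) (by omega) s' _ hrep (by omega)
        have hw1 := hex.wins hw
        have hw2 := hw1.of_step (x := (bodyCode :: searchCode :: K, s)) (by
          simp [bodyCode, step, h6])
        have hw3 := hw2.of_step (x := (searchCode :: K, s)) (by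
          conv_lhs => rw [searchCode]
          simp [step, h6, htr, searchCode])
        exact hw3.mono (by omega) (I.value_push hn hroot)
    · have h6 : s.ints 6 0 = st.length + 1 := hdep
      have hokF := h.ok F (by simp)
      generalize hs1 : (s.writeI 27 0 st.length).writeI 28 0 F.A.length = s1
      have hk1 : Keeps (.setI 27 (.lit 0) (.lit 0)) s (s.writeI 27 0 st.length) := .writeI _ _ _ _
      have hk2 : Keeps (.setI 28 (.lit 0) (.lit 0)) (s.writeI 27 0 st.length) s1 := by
        rw [← hs1]
        exact .writeI _ _ _ _
      have hrep1 : Rep I s1 ⟨F :: st, T, best⟩ := (h.keeps hk1).keeps hk2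
      have hC : Cur I s1 st.length F :=
        { toConsts := hrep1.toConsts
          toRepFrame := hrep1.stack.1
          top := by simp [← hs1]
          len := by simp [← hs1] }
      have hpre : ∀ {τ : ℕ} {p : ℝ},
          Wins S τ p (.ite (.ltI (.get 8 (iv 27)) (iv 28)) (setIv 6 (.sub (iv 6) (.lit 1)))
            visitCode :: searchCode :: K, s1) → Wins S (τ + 6) p (searchCode :: K, s) := by
        intro τ p hw
        have hw1 := hw.of_step (x := (setIv 28 (.get 7 (iv 27)) ::
          .ite (.ltI (.get 8 (iv 27)) (iv 28)) (setIv 6 (.sub (iv 6) (.lit 1)))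
            visitCode :: searchCode :: K, s.writeI 27 0 st.length)) (by
          have := h.stack.1.cnt
          simp [step, this, hs1])
        have hw2 := hw1.of_step (x := (.seq (setIv 28 (.get 7 (iv 27)))
          (.ite (.ltI (.get 8 (iv 27)) (iv 28)) (setIv 6 (.sub (iv 6) (.lit 1)))
            visitCode) :: searchCode :: K, s.writeI 27 0 st.length)) rfl
        have hw3 := hw2.of_step (x := (setIv 27 (.sub (iv 6) (.lit 1)) ::
          .seq (setIv 28 (.get 7 (iv 27)))
          (.ite (.ltI (.get 8 (iv 27)) (iv 28)) (setIv 6 (.sub (iv 6) (.lit 1)))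
            visitCode) :: searchCode :: K, s)) (by simp [step, h6])
        have hw4 := hw3.of_step (x := (.seq (setIv 27 (.sub (iv 6) (.lit 1)))
          (.seq (setIv 28 (.get 7 (iv 27)))
          (.ite (.ltI (.get 8 (iv 27)) (iv 28)) (setIv 6 (.sub (iv 6) (.lit 1)))
            visitCode)) :: searchCode :: K, s)) rfl
        have hw5 := hw4.of_step (x := (bodyCode :: searchCode :: K, s)) (by
          simp [bodyCode, step, h6])
        exact hw5.of_step (x := (searchCode :: K, s)) (by
          conv_lhs => rw [searchCode]
          simp [step, h6, htr, searchCode])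
      have ha := hokF.1.1
      by_cases hbud : F.bud < F.A.length
      · have hpot := I.potential_pop I.unit F st T best
        have hunit : 200 ≤ I.unit := by
          unfold Inst.unit
          omega
        have hrep2 : Rep I (s1.writeI 6 0 st.length) ⟨st, T, best⟩ :=
          { toConsts := hrep1.toConsts.keeps (.writeI _ _ _ _)
            stack := hrep1.stack.2.same fun _ _ => .of_keeps (.writeI _ _ _ _)
            dep := by simp
            tr := by simpa using hrep1.tr
            best := hrep1.best.keeps (.writeI _ _ _ _)
            ok := fun F' hF' => h.ok F' (List.mem_cons_of_mem _ hF')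
            le := by have := h.le; simp at this ⊢; omega }
        have hw := ih (N - I.unit) (by omega) _ _ hrep2 (by omega)
        have hw1 := hw.of_step (x := (setIv 6 (.sub (iv 6) (.lit 1)) :: searchCode :: K, s1)) (by
          have : s1.ints 6 0 = st.length + 1 := hrep1.dep
          simp [step, this])
        have hw2 := hw1.of_step (x := (.ite (.ltI (.get 8 (iv 27)) (iv 28))
          (setIv 6 (.sub (iv 6) (.lit 1))) visitCode :: searchCode :: K, s1)) (by
          simp [step, hC.top, hC.len, hC.bud, hbud])
        exact (hpre hw2).mono (by omega) (I.value_pop hbud)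
      · rw [not_lt] at hbud
        have hpot := fun t e z g => I.potential_visit (κ := I.unit) (st := st) (tr := T)
          (best := best) hokF.1 hbud t e z g
        -- Each product on the left is at most `k d m |A|`, and the coefficients add up to `175`,
        -- less than the `200` in `unit`.
        have hwork : F.A.length * (I.k * (I.d * 6 + 17) + 33) + I.k * I.d * 10 +
            I.d * (I.m * 6 + 18) + 61 + I.m * 4 + 20 ≤ I.unit * F.A.length := by
          have e1 : F.A.length * (I.k * (I.d * 6 + 17) + 33)
              = 6 * (I.k * I.d * F.A.length) + 17 * (I.k * F.A.length) + 33 * F.A.length := by ring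
          have e2 : I.d * (I.m * 6 + 18) = 6 * (I.d * I.m) + 18 * I.d := by ring
          have e3 : I.unit * F.A.length = 200 * (I.k * I.d * I.m * F.A.length) := by
            unfold Inst.unit
            ring
          have q1 : I.k * I.d * F.A.length ≤ I.k * I.d * I.m * F.A.length :=
            Nat.mul_le_mul_right _ hkdm
          have q2 : I.k * F.A.length ≤ I.k * I.d * I.m * F.A.length :=
            Nat.mul_le_mul_right _ hkk
          have q3 : 1 * F.A.length ≤ I.k * I.d * I.m * F.A.length :=
            Nat.mul_le_mul_right _ (by omega)
          have q4 : I.k * I.d * I.m ≤ I.k * I.d * I.m * F.A.length :=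
            Nat.le_mul_of_pos_right _ ha
          rw [e1, e2, e3]
          omega
        have hmain := wins_visitCode (S := S) (K := searchCode :: K)
          (τ := N - I.unit * F.A.length + T₀ + 1 + (F.A.length * (I.k * (I.d * 6 + 17) + 33) +
            I.k * I.d * 10 + I.d * (I.m * 6 + 18) + 61))
          (f := fun t e z g => I.value l c B (I.visit F st T best t e z g)) hrep1.toConsts ha hk
          hC.len (fun t e z g => value_nonneg _) (by
            intro t ht e z hz g hg s' hk' h13 h14 h15 h12
            have hg' : ∀ j, g j < F.A.length := fun j =>
              Finset.mem_range.1 (Fintype.mem_piFinset.1 hg j)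
            obtain ⟨τ, hτ, s'', hex, hrep2⟩ := ens_workCode (hrep1.keeps hk') (hC.keeps hk') rfl
              h13 h14 h15 ht hz hg' h12
            have := hpot t e z g
            refine (hex.wins (ih (N - I.unit * F.A.length) (by omega) s'' _ hrep2
              (by omega))).mono (by omega) le_rfl)
        have hw2 := hmain.of_step (x := (.ite (.ltI (.get 8 (iv 27)) (iv 28))
          (setIv 6 (.sub (iv 6) (.lit 1))) visitCode :: searchCode :: K, s1)) (by
          simp [step, hC.top, hC.len, hC.bud, not_lt.2 hbud])
        refine (hpre hw2).mono ?_ ?_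
        -- Any draw serves here: only `unit * |A| ≤ N` is extracted, so that the truncated
        -- subtraction from `N` is exact.
        · have := hpot 0 0 0 (fun _ => 0)
          omega
        · have hval := I.value_le_sumDraws (l := l) (c := c) (B := B) (F := F) (st := st) (tr := T)
            (best := best) hm hk hΔ hl hmiss (fun F' hF' => (h.ok F' hF').1) hbud
          have hnd : 0 < I.numDraws F.A.length := by
            unfold Inst.numDraws
            have : (0 : ℝ) < F.A.length := by exact_mod_cast ha
            have : (0 : ℝ) < I.k := by exact_mod_cast hk
            positivity
          rw [le_div_iff₀ hnd, mul_comm]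
          exact hval

end MissingKMeans

/-! ### The complete program: parameters, search and output -/

namespace MissingKMeans

open Finset RealRAM Program

namespace Program

/-- Compute the labels of the best solution. -/
def outCode : Cmd :=
  .seq (setIv 27 (.lit 0)) (.seq (setIv 28 nE) (.seq (setIv 7 nE)
    (.seq (forTo 16 nE (.setI 9 (iv 16) (iv 16)))
      (.seq (forTo 19 (.mul kE dE) (.seq (.setI 10 (iv 19) (.lit 1))
          (.setR 4 (iv 19) (.get 2 (iv 19)))))
        nearCode))))

/-- Compute the number of samples. -/
def samplesCode : Cmd :=
  .seq (setIv 3 (.lit 33)) (.loop (.ltR (.mul (.ofInt (iv 3)) (rv 0)) (.ofInt (.lit 33)))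
    (setIv 3 (.add (iv 3) (.lit 1))))

/-- Compute `b ^ N` in the integer variable `a`. -/
def powCode (a : ℕ) (b N : IExp) : Cmd :=
  .seq (setIv a (.lit 1)) (forTo 19 N (setIv a (.mul (iv a) b)))

/-- Compute the parameters of the search. -/
def initCode : Cmd :=
  .seq samplesCode (.seq (setIv 4 (.mul kE (.add (.mul (.lit 2) ΔE) (.lit 1))))
    (.seq (powCode 20 (.mul (.mul (.mul (.lit 2) ΔE) kE)
        (.mul (.mul (.lit 32) (iv 3)) (.add (iv 4) (.lit 2)))) (iv 3))
      (.seq (powCode 21 (.mul (.lit 2) (.mul (.mul (.mul (.lit 2) kE)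
          (.add (.mul (.lit 2) ΔE) (.lit 1))) (iv 20))) (iv 4))
        (setIv 5 (.mul (.lit 2) (iv 21))))))

/-- The program. -/
def mainCode : Cmd := .seq initCode (.seq searchCode outCode)

end Program

/-! ### Output -/

theorem near_full_ne_none {I : Inst} (hk : 1 ≤ I.k) (v : ℕ → ℕ → ℝ) (x : ℕ) :
    I.near (Inst.full v) x I.k ≠ none :=
  I.has_of_avail (t := 0) hk fun i _ _ => by simp [Inst.full]

/-- The search code is reused: in a frame with all points active and all coordinates of the best
centers marked as known, the nearest available center is the nearest center. -/
theorem ens_outCode {I : Inst} {s : Store} (h : Consts I s) :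
    Ens outCode s (I.n * (I.k * (I.d * 6 + 17) + 14) + I.k * I.d * 6 + 17) fun s' =>
      s'.reals 2 = s.reals 2 ∧
      ∀ x < I.n, ∀ t, I.near (Inst.full fun t i => s.reals 2 (adr I.d t i)) x I.k = some t →
        s'.ints 2 x = t := by
  refine Ens.seq_of (Ens.setI (P := fun s' => s' = _) rfl) ?_
    (τ' := I.n * (I.k * (I.d * 6 + 17) + 14) + I.k * I.d * 6 + 15) (by omega)
  rintro _ - rfl
  refine Ens.seq_of (Ens.setI (P := fun s' => s' = _) rfl) ?_
    (τ' := I.n * (I.k * (I.d * 6 + 17) + 14) + I.k * I.d * 6 + 13) (by omega)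
  rintro _ - rfl
  refine Ens.seq_of (Ens.setI (P := fun s' => s' = _) rfl) ?_
    (τ' := I.n * (I.k * (I.d * 6 + 17) + 14) + I.k * I.d * 6 + 11) (by omega)
  rintro _ - rfl
  simp only [IExp.eval, RExp.eval, Store.writeI_ints, OfNat.zero_ne_ofNat, if_false, h.n]
  generalize hs1 : ((s.writeI 27 0 0).writeI 28 0 I.n).writeI 7 0 I.n = s1
  have hC1 : Consts I s1 := by
    rw [← hs1]
    exact ((h.keeps (.writeI _ _ _ _)).keeps (.writeI _ _ _ _)).keeps (.writeI _ _ _ _)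
  have a27 : s1.ints 27 0 = 0 := by simp [← hs1]
  have a28 : s1.ints 28 0 = I.n := by simp [← hs1]
  have a7 : s1.ints 7 0 = I.n := by simp [← hs1]
  have a2 : s1.reals 2 = s.reals 2 := by simp [← hs1]
  have hloop : Ens (forTo 16 nE (.setI 9 (iv 16) (iv 16))) s1 (I.n * 4 + 3)
      fun s' => ∀ p < I.n, s'.ints 9 p = p := by
    refine Ens.forTo (M := I.n) (τ := 1) (fun j s' => ∀ p < j, s'.ints 9 p = p)
      (by decide) ?_ ?_ ?_ ?_
    · intro s' hk
      exact (hC1.keeps hk).n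
    · simp
    · intro p s' hp hk hps hI
      refine Ens.setI fun q hq => ?_
      simp only [IExp.eval, hps, Store.writeI_ints, Nat.reduceEqDiff, if_false, if_true]
      split_ifs with hqp
      · exact hqp.symm
      · exact hI q (by omega)
    · exact fun s' _ h => h
  refine Ens.seq_of hloop ?_ (τ' := I.n * (I.k * (I.d * 6 + 17) + 10) + I.k * I.d * 6 + 7)
    (by nlinarith)
  intro s2 hk2 h9
  have hC2 := hC1.keeps hk2
  have b2 : s2.reals 2 = s.reals 2 := by rw [hk2.2 2 (by decide), a2]
  have hloop' : Ens (forTo 19 (.mul kE dE) (.seq (.setI 10 (iv 19) (.lit 1))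
      (.setR 4 (iv 19) (.get 2 (iv 19))))) s2 (I.k * I.d * 6 + 3)
      fun s' => ∀ p < I.k * I.d, s'.ints 10 p = 1 ∧ s'.reals 4 p = s.reals 2 p := by
    refine Ens.forTo (M := I.k * I.d) (τ := 3)
      (fun j s' => ∀ p < j, s'.ints 10 p = 1 ∧ s'.reals 4 p = s.reals 2 p) (by decide) ?_ ?_ ?_ ?_
    · intro s' hk
      have := hC2.keeps hk
      simp [this.k, this.d]
    · simp
    · intro p s' hp hk hps hI
      have e2 : s'.reals 2 = s.reals 2 := by rw [hk.2 2 (by decide), b2]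
      refine Ens.seq_of (Ens.setI (P := fun s' => s' = _) rfl) ?_ (τ' := 1) le_rfl
      rintro _ - rfl
      refine Ens.setR fun q hq => ?_
      by_cases hqp : q = p
      · simp [hps, hqp, e2]
      · simpa [hps, hqp] using hI q (by omega)
    · exact fun s' _ h => h
  refine Ens.seq_of hloop' ?_ (τ' := I.n * (I.k * (I.d * 6 + 17) + 10) + 3) (by omega)
  intro s3 hk3 h10
  have e9 : s3.ints 9 = s2.ints 9 := hk3.1 9 (by decide)
  have e2 : s3.reals 2 = s.reals 2 := by rw [hk3.2 2 (by decide), b2]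
  have hact : ∀ p < I.n, Frame.act ⟨List.range I.n, Inst.full fun t i => s.reals 2 (adr I.d t i),
      s3.reals 3 0, s3.ints 8 0, 0⟩ p = p := fun p hp => I.act_root hp
  have hC3 : Cur I s3 0 ⟨List.range I.n, Inst.full fun t i => s.reals 2 (adr I.d t i),
      s3.reals 3 0, s3.ints 8 0, 0⟩ :=
    { toConsts := hC2.keeps hk3
      cnt := by
        rw [hk3.1 7 (by decide), hk2.1 7 (by decide), a7]
        simp
      bud := rfl
      acc := rfl
      act := fun p hp => by
        have hp' : p < I.n := by simpa using hp
        rw [hact p hp', adr_zero, e9, h9 p hp']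
      cen := fun t ht i hi => by
        have := h10 _ (adr_lt hi ht)
        simp only [Inst.cen, adr_zero, this]
        exact ⟨rfl, rfl⟩
      le := by simp
      lt := fun p hp => by
        have hp' : p < I.n := by simpa using hp
        rw [hact p hp']
        exact hp'
      top := by rw [hk3.1 27 (by decide), hk2.1 27 (by decide), a27]
      len := by
        rw [hk3.1 28 (by decide), hk2.1 28 (by decide), a28]
        simp }
  refine (ens_nearCode hC3).conseq (by simp) fun s4 hk4 hnear => ⟨?_, fun x hx t ht => ?_⟩
  · rw [hk4.2 2 (by decide), e2]
  · have := (hnear x (by simpa using hx)).2.2 t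
    rw [hact x hx] at this
    exact this ht

/-! ### Initialization -/

/-- The number of samples for the approximation parameter `ε`. -/
noncomputable def numSamples (ε : ℝ) : ℕ := max 33 ⌈33 / ε⌉₊

/-- The machine cannot round reals, so the least integer at least `33 / ε` is found by counting
upwards from `33`; this takes `O(m)` steps. The last clause of the invariant prevents an overshoot.
-/
theorem ens_samplesCode {s : Store} {ε : ℝ} (hε : 0 < ε) (h : s.reals 0 0 = ε) :
    Ens samplesCode s (numSamples ε * 2 + 3) fun s' => s'.ints 3 0 = numSamples ε := by
  refine Ens.seq_of (Ens.setI (P := fun s' => s' = _) rfl) ?_ (τ' := numSamples ε * 2 + 1)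
    (by omega)
  rintro _ - rfl
  have hceil : ⌈33 / ε⌉₊ ≤ numSamples ε := le_max_right _ _
  refine Ens.le (Ens.loop (τ := 1) (N := ⌈33 / ε⌉₊) (j := 0) (fun j s' => s'.ints 3 0 = 33 + j ∧
    s'.reals 0 0 = ε ∧ (j = 0 ∨ 33 + j ≤ ⌈33 / ε⌉₊)) ?_ ?_ ?_ ?_) (by omega)
  · rintro j s' ⟨h1, h2, -⟩ hb
    simp only [BExp.Holds, RExp.eval, IExp.eval, h1, h2] at hb
    rw [Nat.lt_ceil, lt_div_iff₀ hε]
    push_cast at hb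
    nlinarith
  · rintro j s' ⟨h1, h2, -⟩ hb
    simp only [BExp.Holds, RExp.eval, IExp.eval, h1, h2] at hb
    refine Ens.setI ⟨by simp [h1]; omega, by simpa using h2, Or.inr ?_⟩
    have : 33 + j < ⌈33 / ε⌉₊ := by
      rw [Nat.lt_ceil, lt_div_iff₀ hε]
      exact_mod_cast hb
    omega
  · rintro j s' ⟨h1, h2, h3⟩ hb
    simp only [BExp.Holds, RExp.eval, IExp.eval, h1, h2, not_lt] at hb
    have h4 : ⌈33 / ε⌉₊ ≤ 33 + j := by
      rw [Nat.ceil_le, div_le_iff₀ hε]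
      exact_mod_cast hb
    rw [h1, numSamples]
    omega
  · simp [h]

theorem ens_powCode {s : Store} {a B M : ℕ} {b N : IExp} (ha : a ≠ 19)
    (hb : ∀ s', Keeps (powCode a b N) s s' → b.eval s' = B)
    (hN : ∀ s', Keeps (powCode a b N) s s' → N.eval s' = M) :
    Ens (powCode a b N) s (M * 4 + 5) fun s' => s'.ints a 0 = B ^ M := by
  refine Ens.seq_of (Ens.setI (P := fun s' => s' = _) rfl) ?_ (τ' := M * 4 + 3) (by omega)
  intro s1 hk1 hs1
  have hkeep : ∀ s', Keeps (forTo 19 N (setIv a (.mul (iv a) b))) s1 s' →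
      Keeps (powCode a b N) s s' := fun s' hk =>
    ⟨fun c hc => (hk.1 c hc.2).trans (hk1.1 c hc.1),
      fun c hc => (hk.2 c hc.2).trans (hk1.2 c hc.1)⟩
  refine Ens.forTo (M := M) (τ := 1) (fun j s' => s'.ints a 0 = B ^ j) ha ?_ ?_ ?_ ?_
  · exact fun s' hk => hN s' (hkeep s' hk)
  · subst hs1
    simp [ha]
  · intro j s' hj hk hjs hI
    refine Ens.setI ?_
    have := hb s' (hkeep s' hk)
    simp [ha, hI, this, pow_succ]
  · exact fun s' _ h => h

/-- The memory contains the input. -/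
structure Input (I : Inst) (ε : ℝ) (s : Store) : Prop where
  n : s.ints 0 0 = I.n
  d : s.ints 0 1 = I.d
  k : s.ints 0 2 = I.k
  Δ : s.ints 0 3 = I.Δ
  ε : s.reals 0 0 = ε
  pt : ∀ x < I.n, ∀ i < I.d,
    RepO (s.ints 1 (adr I.d x i)) (s.reals 1 (adr I.d x i)) (I.pt x i)
  dep : s.ints 6 0 = 0
  best : s.ints 25 0 = 0

theorem ens_initCode {I : Inst} {ε : ℝ} {s : Store} (hε : 0 < ε) (h : Input I ε s)
    (hm : I.m = numSamples ε) :
    Ens initCode s (I.m * 6 + I.R * 4 + 19) fun s' =>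
      Rep I s' ⟨[], 2 * (2 * I.Bp) ^ I.R, none⟩ := by
  refine Ens.seq_of (ens_samplesCode hε h.ε) ?_ (τ' := I.m * 4 + I.R * 4 + 15) (by omega)
  intro s1 hk1 h3
  rw [← hm] at h3
  have e0 := hk1.1 0 (by decide)
  refine Ens.seq_of (Ens.setI (P := fun s' => s' = _) rfl) ?_ (τ' := I.m * 4 + I.R * 4 + 13)
    (by omega)
  rintro _ - rfl
  simp only [IExp.eval, e0, h.k, h.Δ]
  generalize hs2 : s1.writeI 4 0 (I.k * (2 * I.Δ + 1)) = s2
  have hk2 : Keeps (.setI 4 (.lit 0) (.lit 0)) s1 s2 := by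
    rw [← hs2]
    exact .writeI _ _ _ _
  have hC2 : Consts I s2 := by
    have f0 : s2.ints 0 = s.ints 0 := by rw [hk2.1 0 (by decide), e0]
    have f1 : s2.ints 1 = s.ints 1 := by rw [hk2.1 1 (by decide), hk1.1 1 (by decide)]
    have f1' : s2.reals 1 = s.reals 1 := by rw [hk2.2 1 (by decide), hk1.2 1 (by decide)]
    refine ⟨?_, ?_, ?_, ?_, ?_, ?_, ?_⟩
    · rw [f0, h.n]
    · rw [f0, h.d]
    · rw [f0, h.k]
    · rw [f0, h.Δ]
    · rw [hk2.1 3 (by decide), h3]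
    · simp [← hs2, Inst.R]
    · rw [f1, f1']
      exact h.pt
  refine Ens.seq_of (ens_powCode (B := 2 * I.Δ * I.k * I.D) (M := I.m) (by decide) ?_ ?_) ?_
    (τ' := I.R * 4 + 7) (by omega)
  · intro s' hk
    have := hC2.keeps hk
    simp [this.k, this.Δ, this.m, this.R, Inst.D]
  · exact fun s' hk => (hC2.keeps hk).m
  intro s3 hk3 h20
  have hC3 := hC2.keeps hk3
  refine Ens.seq_of (ens_powCode (B := 2 * I.Bp) (M := I.R) (by decide) ?_ ?_) ?_
    (τ' := 1) (by omega)
  · intro s' hk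
    have := hC3.keeps hk
    simp [this.k, this.Δ, Inst.Bp, hk.1 20 (by decide), h20]
  · exact fun s' hk => (hC3.keeps hk).R
  intro s4 hk4 h21
  refine Ens.setI ?_
  refine ⟨(hC3.keeps hk4).keeps (.writeI _ _ _ _), trivial, ?_, ?_, ⟨?_, by simp⟩, by simp, by simp⟩
  · simp [hk4.1 6 (by decide), hk3.1 6 (by decide), hk2.1 6 (by decide), hk1.1 6 (by decide), h.dep]
  · simp [h21]
  · simp [hk4.1 25 (by decide), hk3.1 25 (by decide), hk2.1 25 (by decide),
      hk1.1 25 (by decide), h.best]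

/-! ### The whole program -/

/-- The bound for the number of steps. -/
noncomputable def Inst.time (I : Inst) : ℕ :=
  I.potential I.unit ⟨[], 2 * (2 * I.Bp) ^ I.R, none⟩ +
    (I.n * (I.k * (I.d * 6 + 17) + 14) + I.k * I.d * 6 + 17) + 1 + (I.m * 6 + I.R * 4 + 21)

/-- When the search ends, either a good solution is stored and the output is certain to lie in `S`,
or the value is `0` and nothing is claimed. So the initial value, at least `1 / 2`, bounds the
probability of success. -/
theorem wins_mainCode {I : Inst} {ε : ℝ} {s : Store} {l : ℕ → ℕ} {c : ℕ → ℕ → ℝ}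
    {S : Set Config} (hn : 1 ≤ I.n) (hd : 1 ≤ I.d) (hk : 1 ≤ I.k) (hΔ : 1 ≤ I.Δ)
    (hm : I.m = numSamples ε) (hε : 0 < ε) (hl : ∀ x, l x < I.k)
    (hmiss : ∀ x, ((range I.d).filter fun i => I.pt x i = none).card ≤ I.Δ)
    (h : Input I ε s)
    (hS : ∀ s', (∑ x ∈ range I.n, I.dv (Inst.full fun t i => s'.reals 2 (adr I.d t i)) x
        ≤ (1 + 33 / I.m) * I.cost l c) →
      (∀ x < I.n, ∀ t, I.near (Inst.full fun t i => s'.reals 2 (adr I.d t i)) x I.k = some t →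
        s'.ints 2 x = t) → (([] : List Cmd), s') ∈ S) :
    Wins S I.time (1 / 2) ([mainCode], s) := by
  have hm1 : 1 ≤ I.m := by
    have : 33 ≤ numSamples ε := le_max_left _ _
    omega
  have hcost : 0 ≤ I.cost l c :=
    Finset.sum_nonneg fun _ _ => Finset.sum_nonneg fun _ _ => sqd_nonneg _ _
  obtain ⟨t, ht, s1, hex, hrep⟩ := ens_initCode hε h hm
  have hsearch := wins_searchCode (S := S) (K := [outCode])
    (T₀ := I.n * (I.k * (I.d * 6 + 17) + 14) + I.k * I.d * 6 + 17)
    hn hd hm1 hk hΔ hl hmiss (I.lucky_root (l := l) (c := c)) ?_ _ s1 _ hrep le_rfl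
  · have hw := (hex.wins (hsearch.of_step (x := ([.seq searchCode outCode], s1)) rfl)).of_step
      (x := ([mainCode], s)) rfl
    exact hw.mono (by unfold Inst.time; omega) (I.half_le_value hk hΔ hm1 le_rfl)
  · intro s2 best hrep2
    obtain ⟨t', ht', s3, hex', h2, hlab⟩ := ens_outCode hrep2.toConsts
    by_cases hG : I.Good ((1 + 16 / I.m) * I.cost l c) best
    · have hv : I.value l c ((1 + 16 / I.m) * I.cost l c) ⟨[], 0, best⟩ = 1 := by
        unfold Inst.value
        rw [if_pos hG]
      rw [hv]
      obtain ⟨b, hb, hbt⟩ := hG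
      have hle := (hrep2.best.2 b hb).2
      refine (hex'.wins (Wins.halted (hS s3 ?_ ?_))).mono (by omega) le_rfl
      · rw [h2]
        exact (hle.trans hbt).trans (I.thr_le hm1 hcost)
      · rw [h2]
        exact hlab
    · rw [I.value_end hG]
      exact (hex'.wins Wins.halted_zero).mono (by omega) le_rfl

end MissingKMeans

namespace MissingKMeans

open Finset RealRAM Program

/-! ### The bound for the running time -/

/-- A base for the powers in the running time. -/
def Inst.base (I : Inst) : ℕ := 320 * I.m * I.k ^ 2 * I.Δ ^ 2

theorem two_mul_Bp_le {I : Inst} (hk : 1 ≤ I.k) (hΔ : 1 ≤ I.Δ) (hm : 1 ≤ I.m) :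
    2 * I.Bp ≤ I.base ^ (I.m + 1) := by
  have hkΔ : 1 ≤ I.k * I.Δ := Nat.mul_pos hk hΔ
  have hR : I.R + 2 ≤ 5 * (I.k * I.Δ) := by
    unfold Inst.R
    have : I.k ≤ I.k * I.Δ := Nat.le_mul_of_pos_right _ hΔ
    have e : I.k * (2 * I.Δ + 1) = 2 * (I.k * I.Δ) + I.k := by ring
    omega
  have h1 : 2 * I.Δ * I.k * I.D ≤ I.base := by
    calc 2 * I.Δ * I.k * I.D = 64 * I.m * (I.k * I.Δ) * (I.R + 2) := by unfold Inst.D; ring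
      _ ≤ 64 * I.m * (I.k * I.Δ) * (5 * (I.k * I.Δ)) := Nat.mul_le_mul_left _ hR
      _ = I.base := by unfold Inst.base; ring
  have h2 : 4 * (I.k * (2 * I.Δ + 1)) ≤ I.base := by
    have h3 : I.k * (2 * I.Δ + 1) ≤ 3 * (I.k * I.Δ) := by
      have : I.k ≤ I.k * I.Δ := Nat.le_mul_of_pos_right _ hΔ
      have e : I.k * (2 * I.Δ + 1) = 2 * (I.k * I.Δ) + I.k := by ring
      omega
    have h4 : I.k * I.Δ ≤ I.m * (I.k * I.Δ) ^ 2 := by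
      calc I.k * I.Δ ≤ (I.k * I.Δ) ^ 2 := Nat.le_self_pow two_ne_zero _
        _ ≤ I.m * (I.k * I.Δ) ^ 2 := Nat.le_mul_of_pos_left _ hm
    have h5 : I.base = 320 * (I.m * (I.k * I.Δ) ^ 2) := by unfold Inst.base; ring
    omega
  calc 2 * I.Bp = 4 * (I.k * (2 * I.Δ + 1)) * (2 * I.Δ * I.k * I.D) ^ I.m := by
        unfold Inst.Bp; ring
    _ ≤ I.base * I.base ^ I.m := Nat.mul_le_mul h2 (Nat.pow_le_pow_left h1 _)
    _ = I.base ^ (I.m + 1) := by ring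

theorem time_le {I : Inst} (hn : 1 ≤ I.n) (hd : 1 ≤ I.d) (hk : 1 ≤ I.k) (hΔ : 1 ≤ I.Δ)
    (hm : 33 ≤ I.m) : I.time ≤ I.base ^ (5 * I.m * I.R) * I.d * I.n := by
  have hR1 : 1 ≤ I.R := Nat.mul_pos hk (by omega)
  have hbase : 320 * (I.m * I.k) ≤ I.base := by
    have h1 : I.k ≤ I.k ^ 2 * I.Δ ^ 2 := by
      calc I.k ≤ I.k ^ 2 := Nat.le_self_pow two_ne_zero _
        _ ≤ _ := Nat.le_mul_of_pos_right _ (by positivity)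
    calc 320 * (I.m * I.k) ≤ 320 * (I.m * (I.k ^ 2 * I.Δ ^ 2)) := by gcongr
      _ = I.base := by unfold Inst.base; ring
  have hmk : 33 ≤ I.m * I.k := by nlinarith
  have hW : 1 ≤ (2 * I.Bp) ^ I.R :=
    Nat.one_le_pow _ _ (by have := I.one_le_Bp hk hΔ (by omega); omega)
  have h22 : I.R < 22 ^ I.R := Nat.lt_pow_self (by norm_num)
  set W := (2 * I.Bp) ^ I.R with hWdef
  set E := 22 ^ I.R with hE
  have hE1 : 1 ≤ E := by omega
  -- There are `2 W` trials of about `20 * 22 ^ R * n * unit` steps, which gives the leading term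
  -- `8000`; all coefficients together stay below `9000`.
  have key : I.time ≤ 9000 * (I.m * I.k) * E * W * (I.d * I.n) := by
    have hU : 1 ≤ I.k * I.d * I.m * I.n := by
      exact Nat.mul_pos (Nat.mul_pos (Nat.mul_pos hk hd) (by omega)) hn
    set U := I.k * I.d * I.m * I.n with hUdef
    have e0 : 9000 * (I.m * I.k) * E * W * (I.d * I.n) = 9000 * (U * (E * W)) := by
      rw [hUdef]; ring
    have hEW : 1 ≤ E * W := Nat.mul_pos hE1 hW
    have hEE : E ≤ E * W := Nat.le_mul_of_pos_right _ hW
    have hWW : W ≤ E * W := Nat.le_mul_of_pos_left _ hE1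
    have hUE : U ≤ U * (E * W) := Nat.le_mul_of_pos_right _ hEW
    have hEU : E * W ≤ U * (E * W) := Nat.le_mul_of_pos_left _ hU
    have hUW : U * W ≤ U * (E * W) := Nat.mul_le_mul_left _ hWW
    have hkdm : I.k * I.d * I.m ≤ U := Nat.le_mul_of_pos_right _ hn
    have hkdmW : I.k * I.d * I.m * W ≤ U * (E * W) := Nat.mul_le_mul hkdm hWW
    have hmU : I.m ≤ U := (Nat.le_mul_of_pos_left _ (Nat.mul_pos hk hd)).trans hkdm
    have hkdU : I.k * I.d ≤ U := (Nat.le_mul_of_pos_right _ (by omega)).trans hkdm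
    have hknU : I.n * (I.k * I.d) ≤ U := by
      rw [hUdef, mul_comm I.n]
      exact Nat.mul_le_mul_right _ (Nat.le_mul_of_pos_right _ (by omega))
    have hnk : I.n * I.k ≤ I.n * (I.k * I.d) := Nat.mul_le_mul_left _ (Nat.le_mul_of_pos_right _ hd)
    have hnn : I.n ≤ I.n * I.k := Nat.le_mul_of_pos_right _ hk
    have e1 : I.n * (I.k * (I.d * 6 + 17) + 14)
        = 6 * (I.n * (I.k * I.d)) + 17 * (I.n * I.k) + 14 * I.n := by ring
    have e2 : I.potential I.unit ⟨[], 2 * W, none⟩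
        = 400 * (U * W) + 8000 * (U * (E * W)) + 400 * (I.k * I.d * I.m * W) := by
      simp only [Inst.potential, Inst.spot, Inst.unit]
      rw [hUdef]
      ring
    rw [e0, Inst.time, e1, ← hWdef, e2]
    omega
  have hY1 : 1 ≤ I.base := by omega
  have hE' : E ≤ I.base ^ I.R := Nat.pow_le_pow_left (by omega) _
  have hW' : W ≤ I.base ^ ((I.m + 1) * I.R) := by
    rw [hWdef, pow_mul]
    exact Nat.pow_le_pow_left (two_mul_Bp_le hk hΔ (by omega)) _
  have h9 : 9000 * (I.m * I.k) ≤ I.base ^ 2 := by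
    rw [sq]
    calc 9000 * (I.m * I.k) ≤ I.base * (320 * (I.m * I.k)) := by
          have : 9000 ≤ I.base * 320 := by omega
          nlinarith
      _ ≤ I.base * I.base := Nat.mul_le_mul_left _ hbase
  calc I.time ≤ 9000 * (I.m * I.k) * E * W * (I.d * I.n) := key
    _ ≤ I.base ^ 2 * I.base ^ I.R * I.base ^ ((I.m + 1) * I.R) * (I.d * I.n) := by gcongr
    _ = I.base ^ (2 + I.R + (I.m + 1) * I.R) * (I.d * I.n) := by rw [pow_add, pow_add]
    _ ≤ I.base ^ (5 * I.m * I.R) * (I.d * I.n) := by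
        refine Nat.mul_le_mul_right _ (Nat.pow_le_pow_right hY1 ?_)
        nlinarith
    _ = _ := by ring

theorem numSamples_le {ε : ℝ} (hε : 0 < ε) : (numSamples ε : ℝ) ≤ 34 * max 1 (1 / ε) := by
  have h1 : (1 : ℝ) ≤ max 1 (1 / ε) := le_max_left _ _
  have h2 : 1 / ε ≤ max 1 (1 / ε) := le_max_right _ _
  unfold numSamples
  rw [Nat.cast_max]
  refine max_le (by push_cast; linarith) ?_
  have h3 := (Nat.ceil_lt_add_one (a := 33 / ε) (by positivity)).le
  have h4 : 33 / ε = 33 * (1 / ε) := by ring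
  linarith

/-- If `max 1 (1 / ε) ≤ Δ`, both logarithms are at most `log Δ` and the product is at most `2 Δ ^ 2
k (log Δ + k)`, within the first term. Otherwise `Δ ≤ 1 / ε`, so `log Δ ≤ log (1 / ε)`, and the
second term takes over. -/
theorem mul_add_le_max {Δ k ε : ℝ} (hΔ : 1 ≤ Δ) (hk : 1 ≤ k) (hε : 0 < ε) :
    max 1 (1 / ε) * k * Δ * (Real.log (max 1 (1 / ε)) + k + Real.log Δ)
      ≤ 2 * max (Δ ^ 4 * k * (Real.log Δ + k)) (Δ * k / ε * (Real.log (1 / ε) + k)) := by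
  have hlΔ : 0 ≤ Real.log Δ := Real.log_nonneg hΔ
  have hΔ2 : Δ ≤ Δ ^ 2 := by nlinarith
  have hΔ4 : Δ ^ 2 ≤ Δ ^ 4 := pow_le_pow_right₀ hΔ (by norm_num)
  have first : ∀ M L : ℝ, 0 ≤ M → M ≤ Δ → 0 ≤ L → L ≤ Real.log Δ →
      M * k * Δ * (L + k + Real.log Δ) ≤ 2 * (Δ ^ 4 * k * (Real.log Δ + k)) := by
    intro M L hM hMΔ hL hLΔ
    calc M * k * Δ * (L + k + Real.log Δ) ≤ Δ * k * Δ * (2 * (Real.log Δ + k)) := by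
          gcongr
          linarith
      _ = 2 * (Δ ^ 2 * k * (Real.log Δ + k)) := by ring
      _ ≤ 2 * (Δ ^ 4 * k * (Real.log Δ + k)) := by gcongr
  rcases le_total (1 / ε) 1 with h | h
  · rw [max_eq_left h]
    refine (first 1 (Real.log 1) zero_le_one hΔ (by simp) (by simpa using hlΔ)).trans ?_
    gcongr
    exact le_max_left _ _
  · rw [max_eq_right h]
    have hl : 0 ≤ Real.log (1 / ε) := Real.log_nonneg h
    rcases le_total (1 / ε) Δ with h' | h'
    · refine (first (1 / ε) _ (by positivity) h' hl
        (Real.log_le_log (by positivity) h')).trans ?_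
      gcongr
      exact le_max_left _ _
    · have hlog : Real.log Δ ≤ Real.log (1 / ε) := Real.log_le_log (by linarith) h'
      calc 1 / ε * k * Δ * (Real.log (1 / ε) + k + Real.log Δ)
          ≤ 1 / ε * k * Δ * (2 * (Real.log (1 / ε) + k)) := by
            gcongr
            linarith
        _ = 2 * (Δ * k / ε * (Real.log (1 / ε) + k)) := by ring
        _ ≤ _ := by
            gcongr
            exact le_max_right _ _

theorem base_pow_le {I : Inst} {ε : ℝ} (hk : 1 ≤ I.k) (hΔ : 1 ≤ I.Δ) (hε : 0 < ε)
    (hm : I.m = numSamples ε) :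
    ((I.base : ℕ) : ℝ) ^ (5 * I.m * I.R) ≤ (2 : ℝ) ^ (12240 / Real.log 2 *
      max ((I.Δ : ℝ) ^ 4 * I.k * (Real.log I.Δ + I.k))
        ((I.Δ : ℝ) * I.k / ε * (Real.log (1 / ε) + I.k))) := by
  have hkR : (1 : ℝ) ≤ I.k := by exact_mod_cast hk
  have hΔR : (1 : ℝ) ≤ I.Δ := by exact_mod_cast hΔ
  have hm33 : 33 ≤ I.m := by rw [hm]; exact le_max_left _ _
  have hmR : (33 : ℝ) ≤ I.m := by exact_mod_cast hm33
  have hmM : (I.m : ℝ) ≤ 34 * max 1 (1 / ε) := by rw [hm]; exact numSamples_le hε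
  have hM1 : (1 : ℝ) ≤ max 1 (1 / ε) := le_max_left _ _
  have hmax := mul_add_le_max hΔR hkR hε
  set M := max 1 (1 / ε) with hM
  have hlM : 0 ≤ Real.log M := Real.log_nonneg hM1
  have hlΔ : 0 ≤ Real.log I.Δ := Real.log_nonneg hΔR
  have hbpos : (0 : ℝ) < I.base := by
    have : 0 < I.base := by
      unfold Inst.base
      have : 0 < I.m := by omega
      positivity
    exact_mod_cast this
  have hlog : Real.log I.base ≤ 12 * (Real.log M + I.k + Real.log I.Δ) := by
    -- The power of two absorbs `320 * 34`.
    have h1 : (I.base : ℝ) ≤ 2 ^ 14 * M * I.k ^ 2 * I.Δ ^ 2 := by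
      have : (I.base : ℝ) = 320 * I.m * I.k ^ 2 * I.Δ ^ 2 := by unfold Inst.base; push_cast; ring
      rw [this]
      have h320 : 320 * (I.m : ℝ) ≤ 2 ^ 14 * M := by linarith
      gcongr
    have h2 : Real.log (2 ^ 14 * M * I.k ^ 2 * I.Δ ^ 2)
        = 14 * Real.log 2 + Real.log M + 2 * Real.log I.k + 2 * Real.log I.Δ := by
      rw [Real.log_mul (by positivity) (by positivity), Real.log_mul (by positivity) (by positivity),
        Real.log_mul (by positivity) (by positivity), Real.log_pow, Real.log_pow, Real.log_pow]
      push_cast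
      ring
    have h3 := Real.log_le_log hbpos h1
    -- This is why no logarithm of `k` appears in the final bound.
    have h4 : Real.log I.k ≤ I.k - 1 := Real.log_le_sub_one_of_pos (by linarith)
    have h5 := Real.log_two_lt_d9
    linarith
  have hR : (I.R : ℝ) ≤ 3 * (I.k * I.Δ) := by
    have : (I.R : ℝ) = I.k * (2 * I.Δ + 1) := by unfold Inst.R; push_cast; ring
    rw [this]
    nlinarith
  have hl2 : 0 < Real.log 2 := Real.log_pos (by norm_num)
  rw [← Real.exp_log hbpos, ← Real.exp_nat_mul, Real.rpow_def_of_pos (by norm_num), Real.exp_le_exp]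
  push_cast
  calc 5 * (I.m : ℝ) * I.R * Real.log I.base
      ≤ 5 * (34 * M) * (3 * (I.k * I.Δ)) * (12 * (Real.log M + I.k + Real.log I.Δ)) := by gcongr
    _ = 6120 * (M * I.k * I.Δ * (Real.log M + I.k + Real.log I.Δ)) := by ring
    _ ≤ 6120 * (2 * max ((I.Δ : ℝ) ^ 4 * I.k * (Real.log I.Δ + I.k))
        ((I.Δ : ℝ) * I.k / ε * (Real.log (1 / ε) + I.k))) := by gcongr
    _ = _ := by field_simp; ring

/-! ### Optimal clusterings -/

/-- Completing the square shows that the mean of the specified values is optimal; if none is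
specified, the sum does not depend on `w`. -/
theorem exists_min_sqd {ι : Type*} (A : Finset ι) (f : ι → Option ℝ) :
    ∃ w, ∀ w', ∑ x ∈ A, sqd (f x) (some w) ≤ ∑ x ∈ A, sqd (f x) (some w') := by
  have key : ∀ w, ∑ x ∈ A, sqd (f x) (some w) = ∑ x ∈ A, (f x).elim 0 (fun y => y ^ 2)
      - 2 * w * ∑ x ∈ A, (f x).getD 0 + w ^ 2 * ∑ x ∈ A, (f x).elim 0 (fun _ => (1 : ℝ)) := by
    intro w
    rw [mul_sum, mul_sum, ← sum_sub_distrib, ← sum_add_distrib]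
    refine sum_congr rfl fun x _ => ?_
    cases f x with
    | none => simp [sqd]
    | some y => simp [sqd]; ring
  set s := ∑ x ∈ A, (f x).getD 0 with hs
  set N := ∑ x ∈ A, (f x).elim 0 (fun _ => (1 : ℝ)) with hN
  have hnn : ∀ x ∈ A, 0 ≤ (f x).elim 0 (fun _ => (1 : ℝ)) := by
    intro x _
    cases f x <;> simp
  refine ⟨s / N, fun w' => ?_⟩
  rw [key, key]
  by_cases h0 : N = 0
  · have hall := (sum_eq_zero_iff_of_nonneg hnn).1 h0
    have hs0 : s = 0 := sum_eq_zero fun x hx => by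
      have := hall x hx
      cases hfx : f x with
      | none => rfl
      | some y => simp [hfx] at this
    simp [h0, hs0]
  · have hNpos : 0 < N := lt_of_le_of_ne (sum_nonneg hnn) (Ne.symm h0)
    have e : N * (w' - s / N) ^ 2 = w' ^ 2 * N - 2 * w' * s + s ^ 2 / N := by
      field_simp
      ring
    have e2 : (s / N) ^ 2 * N = s ^ 2 / N := by field_simp
    have e3 : 2 * (s / N) * s = 2 * (s ^ 2 / N) := by ring
    have := mul_nonneg hNpos.le (sq_nonneg (w' - s / N))
    linarith

theorem absDiff_sq (o : Option ℝ) (c : ℝ) :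
    MissingPoint.absDiff o (some c) ^ 2 = sqd o (some c) := by
  cases o <;> simp [MissingPoint.absDiff, sqd]

theorem clusteringCost_eq {n d k : ℕ} (P : Fin n → MissingPoint d) (lab : Fin n → Fin k)
    (c : Fin k → Fin d → ℝ) :
    clusteringCost P lab c = ∑ x, ∑ i, sqd (P x i) (some (c (lab x) i)) := by
  unfold clusteringCost MissingPoint.distOn MissingPoint.ofReal
  rw [← sum_fiberwise_of_maps_to (s := univ) (t := univ) (g := lab) (fun _ _ => mem_univ _)]
  refine sum_congr rfl fun t _ => sum_congr rfl fun x hx => ?_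
  rw [Real.sq_sqrt (sum_nonneg fun _ _ => sq_nonneg _), (mem_filter.1 hx).2]
  exact sum_congr rfl fun i _ => absDiff_sq _ _

/-- For fixed labels the cost separates into one minimization for each coordinate of each center,
and finitely many labelings remain to be compared. An attained optimum spares a limiting argument.
-/
theorem exists_optimal {n d k : ℕ} (hk : 1 ≤ k) (P : Fin n → MissingPoint d) :
    ∃ (lab : Fin n → Fin k) (c : Fin k → Fin d → ℝ),
      ∀ (lab' : Fin n → Fin k) (c' : Fin k → Fin d → ℝ), clusteringCost P lab c ≤ clusteringCost P lab' c' := by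
  have hfix : ∀ lab : Fin n → Fin k, ∃ c : Fin k → Fin d → ℝ, ∀ c',
      clusteringCost P lab c ≤ clusteringCost P lab c' := by
    intro lab
    choose c hc using fun (t : Fin k) (i : Fin d) =>
      exists_min_sqd (univ.filter fun x => lab x = t) fun x => P x i
    refine ⟨c, fun c' => ?_⟩
    have key : ∀ c, clusteringCost P lab c = ∑ t, ∑ i, ∑ x ∈ univ.filter fun x => lab x = t,
        sqd (P x i) (some (c t i)) := by
      intro c
      rw [clusteringCost_eq,
        ← sum_fiberwise_of_maps_to (s := univ) (t := univ) (g := lab) (fun _ _ => mem_univ _)]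
      refine sum_congr rfl fun t _ => ?_
      rw [sum_comm]
      exact sum_congr rfl fun i _ => sum_congr rfl fun x hx => by rw [(mem_filter.1 hx).2]
    rw [key, key]
    exact sum_le_sum fun t _ => sum_le_sum fun i _ => hc t i (c' t i)
  choose c hc using hfix
  have : Nonempty (Fin n → Fin k) := ⟨fun _ => ⟨0, hk⟩⟩
  obtain ⟨lab, hlab⟩ := Finite.exists_min fun lab => clusteringCost P lab (c lab)
  exact ⟨lab, c lab, fun lab₁ c₁ => (hlab lab₁).trans (hc lab₁ c₁)⟩

/-! ### The instance of the input -/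

/-- The instance that is given by the input. -/
noncomputable def instOf {n d : ℕ} (k Δ : ℕ) (ε : ℝ) (P : Fin n → MissingPoint d) : Inst where
  n := n
  d := d
  k := k
  Δ := Δ
  m := numSamples ε
  -- Outside the input the entries count as specified, so that the bound for the missing entries
  -- holds for every `x`.
  pt x i := if h : x < n ∧ i < d then P ⟨x, h.1⟩ ⟨i, h.2⟩ else some 0

theorem pt_instOf {n d : ℕ} (k Δ : ℕ) (ε : ℝ) (P : Fin n → MissingPoint d) (x : Fin n)
    (i : Fin d) : (instOf k Δ ε P).pt x i = P x i := by
  simp [instOf]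

theorem input_instOf {n d : ℕ} (k Δ : ℕ) (ε : ℝ) (P : Fin n → MissingPoint d) :
    Input (instOf k Δ ε P) ε (inputStore k Δ ε P) where
  n := rfl
  d := rfl
  k := rfl
  Δ := rfl
  ε := by simp [inputStore]
  pt := by
    intro x hx i hi
    change x < n at hx
    change i < d at hi
    have h : adr d x i < n * d := adr_lt hi hx
    have he : finProdFinEquiv.symm (⟨adr d x i, h⟩ : Fin (n * d)) = (⟨x, hx⟩, ⟨i, hi⟩) := by
      rw [Equiv.symm_apply_eq]
      exact Fin.ext rfl
    have hp : (instOf k Δ ε P).pt x i = P ⟨x, hx⟩ ⟨i, hi⟩ := pt_instOf k Δ ε P ⟨x, hx⟩ ⟨i, hi⟩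
    rw [hp]
    change RepO ((inputStore k Δ ε P).ints 1 (adr d x i)) ((inputStore k Δ ε P).reals 1 (adr d x i)) _
    simp only [inputStore, one_ne_zero, if_false, if_true, h, dite_true, he]
    exact ⟨rfl, rfl⟩
  dep := by simp [inputStore]
  best := by simp [inputStore]

theorem card_missing_instOf {n d k Δ : ℕ} {ε : ℝ} {P : Fin n → MissingPoint d}
    (h : ∀ i, (P i).IsMissing Δ) (x : ℕ) :
    ((range d).filter fun i => (instOf k Δ ε P).pt x i = none).card ≤ Δ := by
  by_cases hx : x < n
  · refine le_trans (le_of_eq ?_) (h ⟨x, hx⟩)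
    rw [card_filter, card_filter, Finset.sum_range]
    refine sum_congr rfl fun i _ => ?_
    rw [pt_instOf k Δ ε P ⟨x, hx⟩ i]
  · simp [instOf, hx]

theorem cost_instOf {n d k Δ : ℕ} {ε : ℝ} {P : Fin n → MissingPoint d} {lab : Fin n → Fin k}
    {c : Fin k → Fin d → ℝ} {l : ℕ → ℕ} {c' : ℕ → ℕ → ℝ} (hl : ∀ x : Fin n, l x = lab x)
    (hc : ∀ (t : Fin k) (i : Fin d), c' t i = c t i) :
    (instOf k Δ ε P).cost l c' = clusteringCost P lab c := by
  rw [clusteringCost_eq, Inst.cost]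
  change ∑ x ∈ range n, ∑ i ∈ range d, _ = _
  rw [Finset.sum_range]
  refine sum_congr rfl fun x _ => ?_
  rw [Finset.sum_range]
  exact sum_congr rfl fun i _ => by rw [pt_instOf, hl, hc]

end MissingKMeans

/-! ### The theorem -/

open MissingKMeans RealRAM Program in
theorem theorem5p1 :
    ∃ (prog : RealRAM.Cmd) (C : ℝ),
      ∀ (n d k Δ : ℕ) (ε : ℝ) (P : Fin n → MissingPoint d),
        1 ≤ n → 1 ≤ d → 1 ≤ k → 1 ≤ Δ → 0 < ε → (∀ i, (P i).IsMissing Δ) →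
        ∃ t : ℕ,
          (t : ℝ) ≤ (2 : ℝ) ^ (C * max ((Δ : ℝ) ^ 4 * k * (Real.log Δ + k))
            ((Δ : ℝ) * k / ε * (Real.log (1 / ε) + k))) * d * n ∧
          RealRAM.HaltsWithin prog (RealRAM.inputStore k Δ ε P) t ∧
          1 / 2 ≤ (RealRAM.run prog (RealRAM.inputStore k Δ ε P) t).toOuterMeasure
            (RealRAM.successSet k ε P) := by
  refine ⟨mainCode, 12240 / Real.log 2, fun n d k Δ ε P hn hd hk hΔ hε hP => ?_⟩
  obtain ⟨lab, c, hopt⟩ := exists_optimal hk P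
  have hm : (instOf k Δ ε P).m = numSamples ε := rfl
  have hwins : Wins (successSet k ε P) (instOf k Δ ε P).time (1 / 2)
      ([mainCode], inputStore k Δ ε P) := by
    refine wins_mainCode (ε := ε) (l := fun x => if h : x < n then lab ⟨x, h⟩ else 0)
      (c := fun t i => if h : t < k ∧ i < d then c ⟨t, h.1⟩ ⟨i, h.2⟩ else 0) hn hd hk hΔ hm hε ?_
      (card_missing_instOf hP) (input_instOf k Δ ε P) ?_
    · intro x
      split_ifs with h
      · exact (lab ⟨x, h⟩).2
      · exact hk
    · intro s' hcost hlab
      rw [cost_instOf (lab := lab) (c := c) (by simp) (by simp)] at hcost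
      set v : ℕ → ℕ → ℝ := fun t i => s'.reals 2 (adr d t i) with hv
      choose lo hlo using fun x =>
        Option.ne_none_iff_exists'.1 (near_full_ne_none (I := instOf k Δ ε P) hk v x)
      have hlok : ∀ x, lo x < k := fun x => ((instOf k Δ ε P).near_some (hlo x)).1
      refine ⟨rfl, fun x => ⟨lo x, hlok x⟩, fun t j => s'.reals 2 (j + d * t), ⟨fun x => ?_,
        fun t j => rfl⟩, fun lab' c' => ?_⟩
      · exact hlab x x.2 _ (hlo x)
      -- The output labels are nearest centers, so the cost of the output is the sum of the
      -- distances to the nearest output centers, which the search has bounded.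
      · have hout : clusteringCost P (fun x => ⟨lo x, hlok x⟩)
            (fun (t : Fin k) (j : Fin d) => s'.reals 2 (j + d * t))
            = ∑ x ∈ Finset.range n, (instOf k Δ ε P).dv (Inst.full v) x := by
          rw [← cost_instOf (lab := fun x : Fin n => ⟨lo x, hlok x⟩)
            (c := fun (t : Fin k) (j : Fin d) => s'.reals 2 (j + d * t))
            (l := lo) (c' := v) (Δ := Δ) (ε := ε) (fun _ => rfl) (fun _ _ => rfl)]
          refine Finset.sum_congr rfl fun x _ => ?_
          rw [Inst.dv, hlo x]
          rfl
        have hopt' := hopt lab' c'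
        have hnn : 0 ≤ clusteringCost P lab' c' := by
          rw [clusteringCost_eq]
          exact Finset.sum_nonneg fun _ _ => Finset.sum_nonneg fun _ _ => sqd_nonneg _ _
        -- This is where the number of samples, at least `33 / ε`, is used.
        have hm33 : 33 / ((instOf k Δ ε P).m : ℝ) ≤ ε := by
          rw [hm]
          have h1 : (33 : ℕ) ≤ numSamples ε := le_max_left _ _
          have h2 : (0 : ℝ) < numSamples ε := by
            have : 0 < numSamples ε := by omega
            exact_mod_cast this
          have h3 : 33 / ε ≤ numSamples ε :=
            (Nat.le_ceil _).trans (by exact_mod_cast le_max_right 33 ⌈33 / ε⌉₊)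
          rw [div_le_iff₀ hε] at h3
          rw [div_le_iff₀ h2]
          linarith
        rw [hout]
        refine hcost.trans ?_
        calc (1 + 33 / ((instOf k Δ ε P).m : ℝ)) * clusteringCost P lab c
            ≤ (1 + 33 / ((instOf k Δ ε P).m : ℝ)) * clusteringCost P lab' c' :=
              mul_le_mul_of_nonneg_left hopt' (by positivity)
          _ ≤ (1 + ε) * clusteringCost P lab' c' :=
              mul_le_mul_of_nonneg_right (by linarith) hnn
  refine ⟨(instOf k Δ ε P).time, ?_, ?_, ?_⟩
  · have h1 := time_le (I := instOf k Δ ε P) hn hd hk hΔ (le_max_left _ _)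
    have h2 := base_pow_le (I := instOf k Δ ε P) hk hΔ hε hm
    have h3 : ((instOf k Δ ε P).time : ℝ) ≤ ((instOf k Δ ε P).base : ℝ) ^
        (5 * (instOf k Δ ε P).m * (instOf k Δ ε P).R) * d * n := by exact_mod_cast h1
    refine h3.trans ?_
    gcongr
    exact h2
  · unfold HaltsWithin
    rw [run_eq_runFrom]
    exact hwins.1
  · rw [run_eq_runFrom]
    refine le_trans (le_of_eq ?_) hwins.2
    rw [ENNReal.ofReal_div_of_pos (by norm_num)]
    simp
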